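/- Let $\Pi$ be a Polish space with its Borel $\sigma$-algebra and a finite Borel measure $\nu$; let $\mathcal P(\Pi)$ be the set of Borel probability measures on $\Pi$, and let $\mathcal P(\Pi)\cap L^1(\nu)$ denote the set of probability densities with respect to $\nu$, each identified with the probability measure it defines. Let $N\ge 2$, and let $\hat{\mathcal P}_N(\Pi)=\{\mu(\boldsymbol y):=\frac1{N-1}\sum_{k=1}^{N-1}\delta_{y_k}:\ \boldsymbol y\in\Pi^{N-1}\}$. *Semigroup.* An adjoint Markov semigroup on $L^1(\nu)$ is a $C_0$-semigroup $(S_t)_{t\ge0}$ on $L^1(\nu)$ with $S_t\rho\ge0$ for $\rho\ge0$ and $\int S_t\rho\,d\nu=\int\rho\,d\nu$ for all $\rho \in L^1(\nu)$. Let $\mathcal K^*$, with domain $D(\mathcal K^*)$, be the infinitesimal generator of such a semigroup, and write $e^{t\mathcal K^*}=S_t$. *Jump kernels.* For a positive kernel $\Lambda$ on $\Pi$ put $\|\Lambda\|_{\mathcal J}=\sup_x\Lambda(x,\Pi)$. An adjoint kernel of $\Lambda$ is a positive kernel $\Lambda^*$ with $\Lambda(x,dy)\,\nu(dx)=\Lambda^*(y,dx)\,\nu(dy)$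 as measures on $\Pi^2$. For bounded $\Lambda$, $\mathcal A_\Lambda\varphi(x)=\int[\varphi(y)-\varphi(x)]\Lambda(x,dy)$, and its $L^1(\nu)$-adjoint $\mathcal A_\Lambda^*$ is the bounded operator on $L^1(\nu)$ with $\int\rho\,\mathcal A_\Lambda\varphi\,d\nu=\int(\mathcal A_\Lambda^*\rho)\,\varphi\,d\nu$ for all $\rho\in L^1(\nu)$ and all bounded measurable $\varphi$ (unique if it exists). An $N$-particle empirical jump kernel assigns to each $\mu\in\hat{\mathcal P}_N(\Pi)$ a bounded positive kernel $\Lambda(\mu)=\Lambda(x,dy;\mu)$ with $\Lambda(x,\{x\};\mu)=0$ for all $x$, such that $(x,\boldsymbol y)\mapsto\Lambda(x,E;\mu(\boldsymbol y))$ is measurable for every Borel set $E$. Let $\Lambda$ be such a kernel satisfying (A1) $M_\Lambda:=\sup_{\mu\in\hat{\mathcal P}_N(\Pi)}\|\Lambda(\mu)\|_{\mathcal J}<\infty$, and each $\Lambda(\mu)$ admits an adjoint kernel $\Lambda^*(\mu)$. For $\rho\in\mathcal P(\Pi)$ let $\bar\Lambda(x,dz;\rho)=\int_{\Pi^{N-1}}\Lambda(x,dz;\mu(\boldsymbol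 y))\,d\rho^{\otimes(N-1)}(\boldsymbol y)$. Write $\mathcal A^*(\sigma;\mu)=\mathcal A^*_{\Lambda(\mu)}\sigma$ and $\bar{\mathcal A}^*(\sigma;\rho)=\mathcal A^*_{\bar\Lambda(\rho)}\sigma$ for $\sigma\in L^1(\nu)$. The averaged mean-field equation is $$\partial_t\bar\rho_t=\mathcal K^*\bar\rho_t+\bar{\mathcal A}^*(\bar\rho_t;\bar\rho_t),\qquad t>0 ,$$ with initial datum $\bar\rho_0\in\mathcal P(\Pi)\cap L^1(\nu)$. A mild solution on $[0,T]$ is a curve of probability densities $(\bar\rho_t)$, continuous from $[0,T]$ to $L^1(\nu)$, with $\bar\rho_t=e^{t\mathcal K^*}\bar\rho_0+\int_0^te^{(t-s)\mathcal K^*}\bar{\mathcal A}^*(\bar\rho_s;\bar\rho_s)\,ds$ for all $t\in[0,T]$; a global mild solution is one on every $[0,T]$, $T>0$. A global mild solution is classical if $t\mapsto\bar\rho_t$ is continuously differentiable from $[0,\infty)$ to $L^1(\nu)$ (with one-sided derivative at $0$), and for all $t>0$ one has $\bar\rho_t\in D(\mathcal K^*)$ and the equation holds in $L^1(\nu)$.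 For measurable $f:\Pi\to[-\infty,\infty]$ put $\Delta(f)=\operatorname{ess\,sup}_{x,y}|f(x)-f(y)|\in[0,\infty]$, the essential supremum being with respect to $\nu\otimes\nu$, with $\log0=-\infty$ and $|(\pm\infty)-(\pm\infty)|=\infty$. **Theorem.** The $L^1(\nu)$-adjoints $\mathcal A^*_{\Lambda(\mu)}$, $\mu\in\hat{\mathcal P}_N(\Pi)$, and $\mathcal A^*_{\bar\Lambda(\rho)}$, $\rho\in\mathcal P(\Pi)$, exist, and: (i) For every $\bar\rho_0\in\mathcal P(\Pi)\cap L^1(\nu)$ the averaged mean-field equation has a global mild solution $(\bar\rho_t)_{t\ge0}$, and for each $T>0$ any two mild solutions on $[0,T]$ with initial datum $\bar\rho_0$ coincide on $[0,T]$. (ii) If in addition $\bar\rho_0\in D(\mathcal K^*)$, then the global mild solution is classical. (iii) Assume (K1): $1\in D(\mathcal K^*)$ and $\|\mathcal K^*1\|_{L^\infty(\nu)}<\infty$; and (A2): $M_\Lambda^*:=\sup_{\mu\in\hat{\mathcal P}_N(\Pi)}\|\Lambda^*(\mu)\|_{\mathcal J}<\infty$. Then for every $\bar\rho_0\in\mathcal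 P(\Pi)\cap L^1(\nu)$ the global mild solution satisfies, for all $t\ge0$, $$\Delta(\log\bar\rho_t)\le\Delta(\log\bar\rho_0)+2Mt,\qquad M=\sup_{\mu\in\hat{\mathcal P}_N(\Pi)}\|\mathcal K^*1+\mathcal A^*(1;\mu)\|_{L^\infty(\nu)},$$ and the same bound holds with $M=\|\mathcal K^*1\|_{L^\infty(\nu)}+M_\Lambda+M_\Lambda^*$. -/

import Mathlib

open MeasureTheory ProbabilityTheory Filter Topology Set
open scoped ENNReal NNReal

noncomputable section

namespace MeanField

/-! ### Adjoint Markov semigroups and their generators -/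

/-- An adjoint Markov semigroup on `L¹(ν)`: a strongly continuous semigroup of bounded operators
that preserves positivity and total mass. Only times `t ≥ 0` carry meaning. -/
structure AdjointMarkovSemigroup {X : Type*} [MeasurableSpace X] (ν : Measure X) where
  toFun : ℝ → (Lp ℝ 1 ν →L[ℝ] Lp ℝ 1 ν)
  toFun_zero : toFun 0 = ContinuousLinearMap.id ℝ (Lp ℝ 1 ν)
  toFun_add : ∀ s t : ℝ, 0 ≤ s → 0 ≤ t → toFun (s + t) = (toFun s).comp (toFun t)
  tendsto_zero : ∀ ρ : Lp ℝ 1 ν, Tendsto (fun t => toFun t ρ) (𝓝[>] 0) (𝓝 ρ)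
  nonneg : ∀ t : ℝ, 0 ≤ t → ∀ ρ : Lp ℝ 1 ν, 0 ≤ ρ → 0 ≤ toFun t ρ
  mass : ∀ t : ℝ, 0 ≤ t → ∀ ρ : Lp ℝ 1 ν, ∫ x, (toFun t ρ) x ∂ν = ∫ x, ρ x ∂ν

instance {X : Type*} [MeasurableSpace X] (ν : Measure X) :
    CoeFun (AdjointMarkovSemigroup ν) (fun _ => ℝ → (Lp ℝ 1 ν →L[ℝ] Lp ℝ 1 ν)) :=
  ⟨AdjointMarkovSemigroup.toFun⟩

/-- The difference quotients of `t ↦ S t ρ` at `0` from the right converge to `g` in `L¹(ν)`. -/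
def AdjointMarkovSemigroup.HasGenerator {X : Type*} [MeasurableSpace X] {ν : Measure X}
    (S : AdjointMarkovSemigroup ν) (ρ g : Lp ℝ 1 ν) : Prop :=
  Tendsto (fun h : ℝ => h⁻¹ • (S h ρ - ρ)) (𝓝[>] 0) (𝓝 g)

theorem AdjointMarkovSemigroup.HasGenerator.add {X : Type*} [MeasurableSpace X] {ν : Measure X}
    {S : AdjointMarkovSemigroup ν} {ρ g ρ' g' : Lp ℝ 1 ν}
    (h : S.HasGenerator ρ g) (h' : S.HasGenerator ρ' g') :
    S.HasGenerator (ρ + ρ') (g + g') := by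
  refine (Tendsto.add h h').congr fun t => ?_
  rw [← smul_add, map_add, sub_add_sub_comm]

theorem AdjointMarkovSemigroup.HasGenerator.smul {X : Type*} [MeasurableSpace X] {ν : Measure X}
    {S : AdjointMarkovSemigroup ν} {ρ g : Lp ℝ 1 ν} (c : ℝ)
    (h : S.HasGenerator ρ g) : S.HasGenerator (c • ρ) (c • g) := by
  refine (Tendsto.const_smul h c).congr fun t => ?_
  rw [map_smul, ← smul_sub, smul_comm]

theorem AdjointMarkovSemigroup.HasGenerator.zero {X : Type*} [MeasurableSpace X] {ν : Measure X}
    (S : AdjointMarkovSemigroup ν) : S.HasGenerator 0 0 := by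
  simp [AdjointMarkovSemigroup.HasGenerator]

/-- The infinitesimal generator `K*` of `S`, an unbounded operator on `L¹(ν)` whose domain `D(K*)`
consists of all `ρ` for which the limit of `(S h ρ - ρ) / h` as `h ↓ 0` exists. -/
def AdjointMarkovSemigroup.generator {X : Type*} [MeasurableSpace X] {ν : Measure X}
    (S : AdjointMarkovSemigroup ν) : Lp ℝ 1 ν →ₗ.[ℝ] Lp ℝ 1 ν where
  domain :=
    { carrier := {ρ | ∃ g, S.HasGenerator ρ g}
      add_mem' := fun ⟨_, h⟩ ⟨_, h'⟩ => ⟨_, h.add h'⟩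
      zero_mem' := ⟨0, AdjointMarkovSemigroup.HasGenerator.zero S⟩
      smul_mem' := fun c _ ⟨_, h⟩ => ⟨_, h.smul c⟩ }
  toFun :=
    { toFun := fun ρ => Classical.choose ρ.2
      map_add' := fun ρ ρ' => tendsto_nhds_unique (Classical.choose_spec (ρ + ρ').2)
        ((Classical.choose_spec ρ.2).add (Classical.choose_spec ρ'.2))
      map_smul' := fun c ρ => tendsto_nhds_unique (Classical.choose_spec (c • ρ).2)
        ((Classical.choose_spec ρ.2).smul c) }

/-! ### Jump kernels, jump generators and adjoints -/

/-- The norm `sup_x Λ(x, X)` of a positive kernel. -/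
def kernelNorm {X : Type*} [MeasurableSpace X] (Λ : Kernel X X) : ℝ≥0∞ :=
  ⨆ x, Λ x univ

/-- The jump generator `(𝒜 φ)(x) = ∫ (φ(y) - φ(x)) Λ(x, dy)`. -/
def jumpGenerator {X : Type*} [MeasurableSpace X] (Λ : Kernel X X) (φ : X → ℝ) (x : X) : ℝ :=
  ∫ y, (φ y - φ x) ∂(Λ x)

/-- `Λ'` is a positive kernel with `Λ(x,dy) ν(dx) = Λ'(y,dx) ν(dy)` as measures on `X × X`. -/
structure IsAdjointKernel {X : Type*} [MeasurableSpace X] (ν : Measure X)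
    (Λ Λ' : Kernel X X) : Prop where
  finite : ∀ y, IsFiniteMeasure (Λ' y)
  lintegral_eq : ∀ F : X × X → ℝ≥0∞, Measurable F →
    ∫⁻ x, ∫⁻ y, F (x, y) ∂(Λ x) ∂ν = ∫⁻ y, ∫⁻ x, F (x, y) ∂(Λ' y) ∂ν

/-- `A` is the `L¹(ν)`-adjoint of the jump generator of `Λ`:
`⟨ρ, 𝒜 φ⟩_ν = ⟨A ρ, φ⟩_ν` for all bounded measurable `φ` and all `ρ ∈ L¹(ν)`. -/
def IsL1Adjoint {X : Type*} [MeasurableSpace X] (ν : Measure X) (Λ : Kernel X X)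
    (A : Lp ℝ 1 ν →L[ℝ] Lp ℝ 1 ν) : Prop :=
  ∀ φ : X → ℝ, Measurable φ → (∃ C : ℝ, ∀ x, |φ x| ≤ C) → ∀ ρ : Lp ℝ 1 ν,
    ∫ x, ρ x * jumpGenerator Λ φ x ∂ν = ∫ x, (A ρ) x * φ x ∂ν

/-- An `L¹(ν)`-adjoint is unique. -/
theorem IsL1Adjoint.unique {X : Type*} [MeasurableSpace X] {ν : Measure X} {Λ : Kernel X X}
    {A B : Lp ℝ 1 ν →L[ℝ] Lp ℝ 1 ν} (hA : IsL1Adjoint ν Λ A) (hB : IsL1Adjoint ν Λ B) :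
    A = B := by
  ext1 ρ
  refine Lp.ext ?_
  refine Integrable.ae_eq_of_forall_setIntegral_eq _ _ (L1.integrable_coeFn _)
    (L1.integrable_coeFn _) fun s hs _ => ?_
  have hb : ∃ C : ℝ, ∀ x, |s.indicator (fun _ => (1 : ℝ)) x| ≤ C := by
    refine ⟨1, fun x => ?_⟩
    by_cases hx : x ∈ s <;> simp [hx]
  have hm : Measurable (s.indicator (fun _ => (1 : ℝ))) := measurable_const.indicator hs
  have key := (hA _ hm hb ρ).symm.trans (hB _ hm hb ρ)
  have aux : ∀ f : X → ℝ, (fun x => f x * s.indicator (fun _ => (1 : ℝ)) x) = s.indicator f := by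
    intro f
    funext x
    by_cases hx : x ∈ s <;> simp [hx]
  rwa [aux, aux, integral_indicator hs, integral_indicator hs] at key

open Classical in
/-- The `L¹(ν)`-adjoint `𝒜*` of the jump generator of `Λ` (zero if there is none). -/
def adjointGenerator {X : Type*} [MeasurableSpace X] (ν : Measure X) (Λ : Kernel X X) :
    Lp ℝ 1 ν →L[ℝ] Lp ℝ 1 ν :=
  if h : ∃ A, IsL1Adjoint ν Λ A then Classical.choose h else 0

/-! ### Empirical jump kernels and their averages -/

/-- The empirical measure `(1/n) ∑ δ_{y_k}` of a configuration of `n` particles. -/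
def empiricalMeasure {X : Type*} [MeasurableSpace X] {n : ℕ} (y : Fin n → X) : Measure X :=
  (n : ℝ≥0∞)⁻¹ • ∑ k, Measure.dirac (y k)

/-- The set of empirical measures formed by `N - 1` particles (used for `N ≥ 2`). -/
def empiricalMeasures (X : Type*) [MeasurableSpace X] (N : ℕ) : Set (Measure X) :=
  range fun y : Fin (N - 1) → X => empiricalMeasure y

/-- An `N`-particle empirical jump kernel: a map from the empirical measures of `N - 1` particles
to the bounded positive kernels with no mass at the starting point. The kernel is measurable
jointly in the starting point and the configuration, so that it can be averaged. -/
structure EmpiricalJumpKernel (X : Type*) [MeasurableSpace X] (N : ℕ) where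
  toFun : empiricalMeasures X N → Kernel X X
  bounded : ∀ μ, kernelNorm (toFun μ) < ∞
  no_self_jump : ∀ μ x, toFun μ x {x} = 0
  measurable_joint : Measurable fun p : X × (Fin (N - 1) → X) =>
    toFun ⟨empiricalMeasure p.2, mem_range_self p.2⟩ p.1

instance {X : Type*} [MeasurableSpace X] (N : ℕ) :
    CoeFun (EmpiricalJumpKernel X N) (fun _ => empiricalMeasures X N → Kernel X X) :=
  ⟨EmpiricalJumpKernel.toFun⟩

/-- The constant `M_Λ = sup_μ ‖Λ(μ)‖` of a family of kernels over the empirical measures. -/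
def uniformIntensity {X : Type*} [MeasurableSpace X] {N : ℕ}
    (Λ : empiricalMeasures X N → Kernel X X) : ℝ≥0∞ :=
  ⨆ μ, kernelNorm (Λ μ)

/-- Bounded intensity: `M_Λ < ∞`, and each `Λ(μ)` admits an adjoint kernel. -/
structure EmpiricalJumpKernel.BoundedIntensity {X : Type*} [MeasurableSpace X] {N : ℕ}
    (Λ : EmpiricalJumpKernel X N) (ν : Measure X) : Prop where
  uniform : uniformIntensity Λ < ∞
  adjoint : ∀ μ, ∃ Λ' : Kernel X X, IsAdjointKernel ν (Λ μ) Λ'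

theorem measurable_bind {X Y Z : Type*} [MeasurableSpace X] [MeasurableSpace Y]
    [MeasurableSpace Z] (m : Measure Y) [SFinite m] (g : X × Y → Measure Z) (hg : Measurable g) :
    Measurable fun x => m.bind fun y => g (x, y) := by
  refine Measure.measurable_of_measurable_coe _ fun s hs => ?_
  have h1 : ∀ x : X, Measurable fun y => g (x, y) := fun x => hg.comp measurable_prodMk_left
  simp_rw [fun x => Measure.bind_apply (m := m) hs (h1 x).aemeasurable]
  exact ((Measure.measurable_coe hs).comp hg).lintegral_prod_right'

/-- The averaged mean-field jump kernel
`Λ̄(x, dz; ρ) = ∫ Λ(x, dz; μ(y)) dρ^{⊗(N-1)}(y)`. -/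
def EmpiricalJumpKernel.averaged {X : Type*} [MeasurableSpace X] {N : ℕ}
    (Λ : EmpiricalJumpKernel X N) (ρ : ProbabilityMeasure X) : Kernel X X where
  toFun x := (Measure.pi fun _ : Fin (N - 1) => (ρ : Measure X)).bind
    fun y => Λ ⟨empiricalMeasure y, mem_range_self y⟩ x
  measurable' := measurable_bind (Measure.pi fun _ : Fin (N - 1) => (ρ : Measure X))
    (fun p => Λ.toFun ⟨empiricalMeasure p.2, mem_range_self p.2⟩ p.1) Λ.measurable_joint

/-! ### Probability densities, solutions, oscillation -/

/-- The probability densities with respect to `ν`, as a subset of `L¹(ν)`. -/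
def ProbDensity {X : Type*} [MeasurableSpace X] (ν : Measure X) : Type _ :=
  {ρ : Lp ℝ 1 ν // 0 ≤ ρ ∧ ∫ x, ρ x ∂ν = 1}

/-- The element of `L¹(ν)` underlying a probability density. -/
def ProbDensity.toL1 {X : Type*} [MeasurableSpace X] {ν : Measure X} (ρ : ProbDensity ν) :
    Lp ℝ 1 ν := ρ.1

/-- The probability measure `ρ dν`. -/
def ProbDensity.law {X : Type*} [MeasurableSpace X] {ν : Measure X} (ρ : ProbDensity ν) :
    ProbabilityMeasure X :=
  ⟨ν.withDensity fun x => ENNReal.ofReal (ρ.toL1 x), ⟨by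
    have h0 : 0 ≤ᵐ[ν] fun x => ρ.toL1 x := (Lp.coeFn_nonneg _).2 ρ.2.1
    rw [withDensity_apply _ MeasurableSet.univ, Measure.restrict_univ,
      ← ofReal_integral_eq_lintegral_ofReal (L1.integrable_coeFn _) h0]
    have : ∫ x, ρ.toL1 x ∂ν = 1 := ρ.2.2
    rw [this, ENNReal.ofReal_one]⟩⟩

/-- The averaged nonlinearity `𝒜̄*(ρ; ρ)`. -/
def averagedField {X : Type*} [MeasurableSpace X] {ν : Measure X} {N : ℕ}
    (Λ : EmpiricalJumpKernel X N) (ρ : ProbDensity ν) : Lp ℝ 1 ν :=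
  adjointGenerator ν (Λ.averaged ρ.law) ρ.toL1

/-- `ρ` is a mild solution on `[0,T]`, with initial datum `ρ₀`, of the averaged mean-field equation
`∂ₜρ = K*ρ + 𝒜̄*(ρ; ρ)`. Since `𝒜̄*(·; ρ)` is defined for probability laws `ρ`, solutions are
curves of probability densities. -/
structure IsMildSolutionOn {X : Type*} [MeasurableSpace X] {ν : Measure X} {N : ℕ}
    (S : AdjointMarkovSemigroup ν) (Λ : EmpiricalJumpKernel X N) (ρ₀ : ProbDensity ν) (T : ℝ)
    (ρ : ℝ → ProbDensity ν) : Prop where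
  continuousOn : ContinuousOn (fun t => (ρ t).toL1) (Icc 0 T)
  integrable : ∀ t ∈ Icc 0 T,
    IntervalIntegrable (fun s => S (t - s) (averagedField Λ (ρ s))) volume 0 t
  eq : ∀ t ∈ Icc 0 T,
    (ρ t).toL1 = S t ρ₀.toL1 + ∫ s in (0 : ℝ)..t, S (t - s) (averagedField Λ (ρ s))

/-- A global mild solution: a mild solution on every `[0,T]`. -/
def IsMildSolution {X : Type*} [MeasurableSpace X] {ν : Measure X} {N : ℕ}
    (S : AdjointMarkovSemigroup ν) (Λ : EmpiricalJumpKernel X N) (ρ₀ : ProbDensity ν)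
    (ρ : ℝ → ProbDensity ν) : Prop :=
  ∀ T : ℝ, 0 < T → IsMildSolutionOn S Λ ρ₀ T ρ

/-- A global classical solution: a curve that is `C¹` on `[0,∞)` with values in `L¹(ν)` (with
one-sided derivative at `0`), starts at `ρ₀`, and for every `t > 0` lies in `D(K*)` and satisfies
`∂ₜρ = K*ρ + 𝒜̄*(ρ; ρ)`. -/
def IsClassicalSolution {X : Type*} [MeasurableSpace X] {ν : Measure X} {N : ℕ}
    (S : AdjointMarkovSemigroup ν) (Λ : EmpiricalJumpKernel X N) (ρ₀ : ProbDensity ν)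
    (ρ : ℝ → ProbDensity ν) : Prop :=
  (ρ 0).toL1 = ρ₀.toL1 ∧
  ∃ ρ' : ℝ → Lp ℝ 1 ν, ContinuousOn ρ' (Ici 0) ∧
    (∀ t : ℝ, 0 ≤ t → HasDerivWithinAt (fun s => (ρ s).toL1) (ρ' t) (Ici 0) t) ∧
    ∀ t : ℝ, 0 < t → ∃ h : (ρ t).toL1 ∈ S.generator.domain,
      ρ' t = S.generator ⟨(ρ t).toL1, h⟩ + averagedField Λ (ρ t)

/-- The oscillation `Δ(f) = ess sup_{x,y} |f(x) - f(y)|` of an extended real valued function. -/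
def oscillation {X : Type*} [MeasurableSpace X] (ν : Measure X) (f : X → EReal) : ℝ≥0∞ :=
  essSup (fun p : X × X => (f p.1 - f p.2).abs) (ν.prod ν)

/-- `Δ(log ρ)`, where `log 0 = -∞`; it is `∞` when `ρ` vanishes on a set of positive measure. -/
def logOscillation {X : Type*} [MeasurableSpace X] {ν : Measure X} (ρ : ProbDensity ν) : ℝ≥0∞ :=
  oscillation ν fun x => ENNReal.log (ENNReal.ofReal (ρ.toL1 x))

/-- The norm of `L^∞(ν)`, with value `∞` outside that space. -/
def supNorm {X : Type*} [MeasurableSpace X] {ν : Measure X} (f : Lp ℝ 1 ν) : ℝ≥0∞ :=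
  eLpNorm f ∞ ν

/-- The constant function `1` as an element of `L¹(ν)`. -/
def one {X : Type*} [MeasurableSpace X] (ν : Measure X) [IsFiniteMeasure ν] : Lp ℝ 1 ν :=
  Lp.const 1 ν 1

end MeanField

end

/-! The nonlinearity `ρ ↦ 𝒜̄*(ρ; ρ)` is the diagonal of a bounded multilinear map `𝓑` on `L¹(ν)`.
Indeed `𝒜̄*(σ; ρ)` is obtained from the density `σ ⊗ ρ ⊗ ⋯ ⊗ ρ` on the space of all configurations
by letting the first particle jump and recording the resulting gain minus loss. This defines an `L¹`
operator by Radon–Nikodym, since the adjoint kernels force jumps not to charge `ν`-null sets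
(`exists_jumpAdjoint`, `EmpiricalJumpKernel.exists_multilinear`). On the unit ball, which contains
all densities, such a diagonal is Lipschitz with a quadratic Taylor remainder
(`exists_diagonal_deriv_bounds`).

Positivity and mass conservation make `S` a contraction semigroup, so mild solutions come from a
fixed point in an exponentially weighted space (`exists_isMild`). To stay among densities, one
solves for `exp (c t) ρₜ` with `c = M_Λ`: the loss rate is at most `c`, so the new right-hand side
is nonnegative, and the Duhamel map preserves the nonnegative functions of mass `exp (c t)`.
Uniqueness is Grönwall's inequality.

If the datum lies in the domain of the generator, the difference quotients of the solution converge
to the solution of the linearised equation: their error satisfies a Grönwall inequality whose source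
is the quadratic Taylor remainder (`IsMild.tendsto_difference_quotient`). A continuous right
derivative gives a `C¹` curve, and restarting the mild formula at time `t` shows that `ρₜ` lies in
the domain.

For the oscillation, `ρ` is compared with `a exp (-C t)` from below and `b exp (C t)` from above.
With the law of `ρₜ` frozen as a coefficient, the difference solves a linear equation whose jump
part is quasi-positive and conserves mass. The residual is nonnegative because `K*1 + 𝒜̄*(1; ρₜ)` is
an average of the functions `K*1 + 𝒜*(1; μ)`, each bounded by `M`. Hence the difference stays
nonnegative (`nonneg_of_isMild`, `barrier`), and the logarithm of the ratio of the barriers grows by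
`2 C t`. For the second constant, `𝒜*1` is a gain of at most `M_Λ*` minus a loss of at most `M_Λ`.
-/

namespace MeanField

/-! ### Contraction semigroups and mild solutions -/

/-- A strongly continuous semigroup of contractions. Only times `t ≥ 0` carry meaning. -/
structure ContractionSemigroup (E : Type*) [NormedAddCommGroup E] [NormedSpace ℝ E] where
  toFun : ℝ → (E →L[ℝ] E)
  toFun_zero : ∀ x, toFun 0 x = x
  toFun_add : ∀ s t : ℝ, 0 ≤ s → 0 ≤ t → ∀ x, toFun (s + t) x = toFun s (toFun t x)
  tendsto_zero : ∀ x, Tendsto (fun t => toFun t x) (𝓝[>] 0) (𝓝 x)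
  norm_le : ∀ t : ℝ, 0 ≤ t → ∀ x, ‖toFun t x‖ ≤ ‖x‖

namespace ContractionSemigroup

variable {E : Type*} [NormedAddCommGroup E] [NormedSpace ℝ E]

instance : CoeFun (ContractionSemigroup E) (fun _ => ℝ → (E →L[ℝ] E)) := ⟨toFun⟩

theorem tendsto_norm_sub (T : ContractionSemigroup E) (x : E) :
    Tendsto (fun h : ℝ => ‖T |h| x - x‖) (𝓝 0) (𝓝 0) := by
  rw [Metric.tendsto_nhds]
  intro ε hε
  have h1 := Metric.tendsto_nhds.1 (T.tendsto_zero x) ε hε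
  rw [eventually_nhdsWithin_iff, Metric.eventually_nhds_iff] at h1
  obtain ⟨δ, hδ, h1⟩ := h1
  rw [Metric.eventually_nhds_iff]
  refine ⟨δ, hδ, fun h hh => ?_⟩
  rw [Real.dist_0_eq_abs, abs_norm]
  rcases eq_or_ne h 0 with rfl | h0
  · simpa [T.toFun_zero] using hε
  · rw [← dist_eq_norm]
    exact h1 (by simpa using hh) (abs_pos.2 h0)

/-- Factoring out the smaller time leaves a contraction, so strong continuity at time `0` controls
all times. -/
theorem norm_sub_le (T : ContractionSemigroup E) (x : E) {s t : ℝ} (hs : 0 ≤ s) (ht : 0 ≤ t) :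
    ‖T s x - T t x‖ ≤ ‖T |s - t| x - x‖ := by
  wlog h : t ≤ s generalizing s t
  · rw [norm_sub_rev, abs_sub_comm]
    exact this ht hs (le_of_not_ge h)
  have : T s x = T t (T (s - t) x) := by
    rw [← T.toFun_add t (s - t) ht (sub_nonneg.2 h), add_sub_cancel]
  rw [this, ← map_sub, abs_of_nonneg (sub_nonneg.2 h)]
  exact T.norm_le t ht _

/-- Only nonnegative times are meaningful; the cutoff yields a jointly continuous map on all of `ℝ ×
E`, so that Duhamel integrands are continuous without side conditions. -/
theorem continuous_max (T : ContractionSemigroup E) :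
    Continuous fun p : ℝ × E => T (max p.1 0) p.2 := by
  rw [continuous_iff_continuousAt]
  rintro ⟨t, x⟩
  rw [ContinuousAt, tendsto_iff_norm_sub_tendsto_zero]
  have h1 : Tendsto (fun p : ℝ × E => ‖p.2 - x‖ + ‖T |max p.1 0 - max t 0| x - x‖) (𝓝 (t, x))
      (𝓝 0) := by
    have ha : Tendsto (fun p : ℝ × E => ‖p.2 - x‖) (𝓝 (t, x)) (𝓝 0) := by
      have : Continuous fun p : ℝ × E => ‖p.2 - x‖ := by fun_prop
      simpa using this.tendsto (t, x)
    have hb : Tendsto (fun p : ℝ × E => max p.1 0 - max t 0) (𝓝 (t, x)) (𝓝 0) := by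
      have : Continuous fun p : ℝ × E => max p.1 0 - max t 0 := by fun_prop
      simpa using this.tendsto (t, x)
    simpa using ha.add ((T.tendsto_norm_sub x).comp hb)
  refine squeeze_zero (fun _ => norm_nonneg _) (fun p => ?_) h1
  have : T (max p.1 0) p.2 - T (max t 0) x
      = T (max p.1 0) (p.2 - x) + (T (max p.1 0) x - T (max t 0) x) := by
    rw [map_sub]; abel
  rw [this]
  exact (norm_add_le _ _).trans (add_le_add (T.norm_le _ (le_max_right _ _) _)
    (T.norm_sub_le x (le_max_right _ _) (le_max_right _ _)))

/-- The Duhamel integral `∫₀ᵗ T(t - s) f(s) ds`. -/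
noncomputable def duhamel (T : ContractionSemigroup E) (f : ℝ → E) (t : ℝ) : E :=
  ∫ s in (0 : ℝ)..t, T (t - s) (f s)

theorem continuous_integrand (T : ContractionSemigroup E) {f : ℝ → E} (hf : Continuous f) (t : ℝ) :
    Continuous fun s => T (max (t - s) 0) (f s) :=
  T.continuous_max.comp ((continuous_const.sub continuous_id).prodMk hf)

theorem integrand_eqOn (T : ContractionSemigroup E) (f : ℝ → E) {t : ℝ} (ht : 0 ≤ t) :
    EqOn (fun s => T (t - s) (f s)) (fun s => T (max (t - s) 0) (f s)) (uIcc 0 t) := by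
  intro s hs
  rw [uIcc_of_le ht] at hs
  simp only [max_eq_left (sub_nonneg.2 hs.2)]

theorem duhamel_eq (T : ContractionSemigroup E) (f : ℝ → E) {t : ℝ} (ht : 0 ≤ t) :
    T.duhamel f t = ∫ s in (0 : ℝ)..t, T (max (t - s) 0) (f s) :=
  intervalIntegral.integral_congr (T.integrand_eqOn f ht)

theorem continuousOn_integrand (T : ContractionSemigroup E) {f : ℝ → E} {t : ℝ}
    (hf : ContinuousOn f (Icc 0 t)) : ContinuousOn (fun s => T (t - s) (f s)) (Icc 0 t) := by
  have h : ContinuousOn (fun s => T (max (t - s) 0) (f s)) (Icc 0 t) :=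
    T.continuous_max.comp_continuousOn ((by fun_prop : ContinuousOn (fun s => t - s) _).prodMk hf)
  exact h.congr fun s hs => by simp only [max_eq_left (sub_nonneg.2 hs.2)]

theorem intervalIntegrable_integrand (T : ContractionSemigroup E) {f : ℝ → E} {t : ℝ} (ht : 0 ≤ t)
    (hf : ContinuousOn f (Icc 0 t)) :
    IntervalIntegrable (fun s => T (t - s) (f s)) volume 0 t :=
  ContinuousOn.intervalIntegrable (by rw [uIcc_of_le ht]; exact T.continuousOn_integrand hf)

theorem norm_duhamel_le (T : ContractionSemigroup E) {f : ℝ → E} {t : ℝ} (ht : 0 ≤ t)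
    {φ : ℝ → ℝ} (hφ : IntervalIntegrable φ volume 0 t) (h : ∀ s ∈ Icc 0 t, ‖f s‖ ≤ φ s) :
    ‖T.duhamel f t‖ ≤ ∫ s in (0 : ℝ)..t, φ s := by
  refine intervalIntegral.norm_integral_le_of_norm_le ht (ae_of_all _ fun s hs => ?_) hφ
  exact (T.norm_le _ (sub_nonneg.2 hs.2) _).trans (h s (Ioc_subset_Icc_self hs))

theorem continuous_duhamel_max (T : ContractionSemigroup E) {f : ℝ → E} (hf : Continuous f) :
    Continuous fun t => T.duhamel f (max t 0) := by
  have h : Continuous (Function.uncurry fun t s : ℝ => T (max (t - s) 0) (f s)) :=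
    T.continuous_max.comp ((continuous_fst.sub continuous_snd).prodMk (hf.comp continuous_snd))
  have h2 := intervalIntegral.continuous_parametric_intervalIntegral_of_continuous (μ := volume)
    (a₀ := (0 : ℝ)) h continuous_id
  refine (h2.comp (continuous_id.max (continuous_const (y := (0 : ℝ))))).congr fun t => ?_
  exact (T.duhamel_eq f (le_max_right t 0)).symm

theorem duhamel_add (T : ContractionSemigroup E) {f g : ℝ → E} (hf : Continuous f)
    (hg : Continuous g) {t : ℝ} (ht : 0 ≤ t) :
    T.duhamel (fun s => f s + g s) t = T.duhamel f t + T.duhamel g t := by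
  simp only [duhamel, map_add]
  exact intervalIntegral.integral_add (T.intervalIntegrable_integrand ht hf.continuousOn)
    (T.intervalIntegrable_integrand ht hg.continuousOn)

theorem duhamel_sub (T : ContractionSemigroup E) {f g : ℝ → E} {t : ℝ} (ht : 0 ≤ t)
    (hf : ContinuousOn f (Icc 0 t)) (hg : ContinuousOn g (Icc 0 t)) :
    T.duhamel (fun s => f s - g s) t = T.duhamel f t - T.duhamel g t := by
  simp only [duhamel, map_sub]
  exact intervalIntegral.integral_sub (T.intervalIntegrable_integrand ht hf)
    (T.intervalIntegrable_integrand ht hg)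

theorem duhamel_const_smul (T : ContractionSemigroup E) (f : ℝ → E) (c t : ℝ) :
    T.duhamel (fun s => c • f s) t = c • T.duhamel f t := by
  simp only [duhamel, map_smul]
  exact intervalIntegral.integral_smul c _

theorem duhamel_congr (T : ContractionSemigroup E) {f g : ℝ → E} {t : ℝ} (ht : 0 ≤ t)
    (h : EqOn f g (Icc 0 t)) : T.duhamel f t = T.duhamel g t := by
  refine intervalIntegral.integral_congr fun s hs => ?_
  rw [uIcc_of_le ht] at hs
  simp only [h hs]

/-- `u` is the mild solution on `[0,∞)` of `u' = A u + f`, where `A` generates `T`. -/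
def IsMild (T : ContractionSemigroup E) (f u : ℝ → E) : Prop :=
  ∀ t, 0 ≤ t → u t = T t (u 0) + T.duhamel f t

theorem IsMild.sub {T : ContractionSemigroup E} {f g u v : ℝ → E} (hu : T.IsMild f u)
    (hv : T.IsMild g v) (hf : Continuous f) (hg : Continuous g) :
    T.IsMild (fun s => f s - g s) (fun s => u s - v s) := by
  intro t ht
  rw [T.duhamel_sub ht hf.continuousOn hg.continuousOn]
  simp only
  rw [map_sub, hu t ht, hv t ht]
  abel

theorem IsMild.congr {T : ContractionSemigroup E} {f g u : ℝ → E} (hu : T.IsMild f u)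
    (h : EqOn f g (Ici 0)) : T.IsMild g u := fun t ht =>
  (hu t ht).trans (by rw [T.duhamel_congr ht (h.mono Icc_subset_Ici_self)])

/-- Since `T (t - s) = T (t - r) T (r - s)`, the bounded operator `T (t - r)` comes out of the
integral. -/
theorem duhamel_split [CompleteSpace E] (T : ContractionSemigroup E) {f : ℝ → E}
    (hf : Continuous f) {r t : ℝ} (hr : 0 ≤ r) (hrt : r ≤ t) :
    (∫ s in (0 : ℝ)..r, T (max (t - s) 0) (f s)) = T (t - r) (T.duhamel f r) := by
  rw [duhamel, ← ContinuousLinearMap.intervalIntegral_comp_comm _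
    (T.intervalIntegrable_integrand hr hf.continuousOn)]
  refine intervalIntegral.integral_congr fun s hs => ?_
  rw [uIcc_of_le hr] at hs
  rw [← T.toFun_add _ _ (sub_nonneg.2 hrt) (sub_nonneg.2 hs.2), sub_add_sub_cancel,
    max_eq_left (sub_nonneg.2 (hs.2.trans hrt))]

/-- Product rule for mild solutions and scalar functions. -/
theorem IsMild.smul [CompleteSpace E] {T : ContractionSemigroup E} {f u : ℝ → E}
    (hu : T.IsMild f u) (hf : Continuous f) {α α' : ℝ → ℝ}
    (hα : ∀ t, HasDerivAt α (α' t) t) (hα' : Continuous α') :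
    T.IsMild (fun s => α s • f s + α' s • u s) (fun s => α s • u s) := by
  intro t ht
  have hαc : Continuous α := continuous_iff_continuousAt.2 fun t => (hα t).continuousAt
  -- `T (t - r) (u r)` coincides on `[0, t]` with this primitive, hence is differentiable in `r`
  -- although `u r` need not lie in the domain of the generator. Integrating the derivative of `α r
  -- • F r` gives the claim.
  set F : ℝ → E := fun r => T t (u 0) + ∫ s in (0 : ℝ)..r, T (max (t - s) 0) (f s) with hF
  have hFu : ∀ r ∈ Icc 0 t, F r = T (t - r) (u r) := by
    intro r hr
    rw [hF]
    simp only
    rw [T.duhamel_split hf hr.1 hr.2, hu r hr.1, map_add, ← T.toFun_add _ _ (sub_nonneg.2 hr.2) hr.1,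
      sub_add_cancel]
  have hd : ∀ r, HasDerivAt F (T (max (t - r) 0) (f r)) r := fun r =>
    ((T.continuous_integrand hf t).integral_hasStrictDerivAt 0 r).hasDerivAt.const_add _
  have hFc : Continuous F := continuous_iff_continuousAt.2 fun t => (hd t).continuousAt
  have key := intervalIntegral.integral_eq_sub_of_hasDerivAt (a := 0) (b := t)
    (f := fun r => α r • F r) (f' := fun r => α r • T (max (t - r) 0) (f r) + α' r • F r)
    (fun r _ => (hα r).smul (hd r))
    (Continuous.intervalIntegrable
      ((hαc.smul (T.continuous_integrand hf t)).add (hα'.smul hFc)) _ _)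
  have h2 : T.duhamel (fun s => α s • f s + α' s • u s) t
      = ∫ r in (0 : ℝ)..t, (α r • T (max (t - r) 0) (f r) + α' r • F r) := by
    refine intervalIntegral.integral_congr fun r hr => ?_
    rw [uIcc_of_le ht] at hr
    simp only
    rw [hFu r hr, map_add, map_smul, map_smul, max_eq_left (sub_nonneg.2 hr.2)]
  rw [h2, key]
  simp only
  rw [hFu t ⟨ht, le_rfl⟩, hFu 0 ⟨le_rfl, ht⟩, sub_self, sub_zero, T.toFun_zero, map_smul]
  abel

theorem duhamel_shift [CompleteSpace E] (T : ContractionSemigroup E) {f : ℝ → E}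
    (hf : Continuous f) {r t : ℝ} (hr : 0 ≤ r) (ht : 0 ≤ t) :
    T.duhamel f (t + r) = T t (T.duhamel f r) + T.duhamel (fun s => f (s + r)) t := by
  rw [T.duhamel_eq f (add_nonneg ht hr), ← intervalIntegral.integral_add_adjacent_intervals
    ((T.continuous_integrand hf (t + r)).intervalIntegrable 0 r)
    ((T.continuous_integrand hf (t + r)).intervalIntegrable r (t + r)),
    T.duhamel_split hf hr (le_add_of_nonneg_left ht), add_sub_cancel_right]
  congr 1
  rw [T.duhamel_eq _ ht]
  have := intervalIntegral.integral_comp_add_right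
    (f := fun s => T (max (t + r - s) 0) (f s)) (a := 0) (b := t) r
  rw [zero_add] at this
  rw [← this]
  simp only [add_sub_add_right_eq_sub]

theorem IsMild.shift [CompleteSpace E] {T : ContractionSemigroup E} {f u : ℝ → E}
    (hu : T.IsMild f u) (hf : Continuous f) {r : ℝ} (hr : 0 ≤ r) :
    T.IsMild (fun s => f (s + r)) (fun s => u (s + r)) := by
  intro t ht
  beta_reduce
  rw [zero_add, hu (t + r) (add_nonneg ht hr), T.duhamel_shift hf hr ht, hu r hr, map_add,
    T.toFun_add t r ht hr, add_assoc]

end ContractionSemigroup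

/-! ### Grönwall's inequality and the weighted fixed point -/

/-- The integral form of Grönwall's inequality. -/
theorem le_mul_exp_of_le_add_integral {φ : ℝ → ℝ} {a L T : ℝ}
    (hφ : ContinuousOn φ (Icc 0 T)) (hL : 0 ≤ L)
    (h : ∀ t ∈ Icc 0 T, φ t ≤ a + L * ∫ s in (0 : ℝ)..t, φ s) :
    ∀ t ∈ Icc 0 T, φ t ≤ a * Real.exp (L * t) := by
  intro t ht
  -- Extension by the endpoint values makes the primitive of `φ` differentiable everywhere.
  wlog hφc : Continuous φ generalizing φ
  · have hT : 0 ≤ T := ht.1.trans ht.2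
    have hext : EqOn (IccExtend hT ((Icc 0 T).domRestrict φ)) φ (Icc 0 T) := fun s hs => by
      rw [IccExtend_of_mem hT _ hs, domRestrict_apply]
    have hc : Continuous (IccExtend hT ((Icc 0 T).domRestrict φ)) := hφ.domRestrict.Icc_extend'
    rw [← hext ht]
    refine this hc.continuousOn (fun s hs => ?_) hc
    rw [hext hs]
    refine (h s hs).trans_eq ?_
    congr 2
    refine intervalIntegral.integral_congr fun r hr => ?_
    rw [uIcc_of_le hs.1] at hr
    exact (hext ⟨hr.1, hr.2.trans hs.2⟩).symm
  -- `ψ` dominates `φ` on the interval, so `ψ' = L φ ≤ L ψ` with `ψ 0 = a`, and the differential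
  -- form of the inequality applies.
  set ψ : ℝ → ℝ := fun t => a + L * ∫ s in (0 : ℝ)..t, φ s with hψ
  have hd : ∀ t, HasDerivAt ψ (L * φ t) t := fun t =>
    ((hφc.integral_hasStrictDerivAt 0 t).hasDerivAt.const_mul L).const_add a
  have := le_gronwallBound_of_liminf_deriv_right_le (f := ψ) (f' := fun t => L * φ t) (δ := a)
    (K := L) (ε := 0) (a := 0) (b := T)
    (fun t _ => (hd t).continuousAt.continuousWithinAt)
    (fun t _ r hr => (hd t).hasDerivWithinAt.liminf_right_slope_le hr)
    (by simp [hψ]) (fun t ht => by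
      rw [add_zero]; exact mul_le_mul_of_nonneg_left (h t (Ico_subset_Icc_self ht)) hL) t ht
  rw [gronwallBound_ε0, sub_zero] at this
  exact (h t ht).trans this

namespace ContractionSemigroup

variable {E : Type*} [NormedAddCommGroup E] [NormedSpace ℝ E]

/-- The weight is chosen so that integrating the exponential gains `L / (2 L + 1) ≤ 1 / 2`; the
added `1` keeps the rate positive when `L = 0`. The estimate serves both for boundedness of the
Duhamel map and for its contraction constant. -/
theorem norm_exp_smul_duhamel_le (T : ContractionSemigroup E) {g : ℝ → E} {L D t : ℝ}
    (hL : 0 ≤ L) (hD : 0 ≤ D) (ht : 0 ≤ t)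
    (hg : ∀ s, 0 ≤ s → ‖g s‖ ≤ L * D * Real.exp ((2 * L + 1) * s)) :
    ‖Real.exp (-((2 * L + 1) * t)) • T.duhamel g t‖ ≤ D / 2 := by
  have hk : 0 < 2 * L + 1 := by linarith
  have h1 : ‖T.duhamel g t‖ ≤ ∫ s in (0 : ℝ)..t, L * D * Real.exp ((2 * L + 1) * s) :=
    T.norm_duhamel_le ht (Continuous.intervalIntegrable (by fun_prop) _ _) fun s hs => hg s hs.1
  rw [intervalIntegral.integral_const_mul, intervalIntegral.integral_comp_mul_left _ hk.ne',
    integral_exp, mul_zero, Real.exp_zero, smul_eq_mul] at h1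
  rw [norm_smul, Real.norm_eq_abs, Real.abs_exp]
  have hLk : L * (2 * L + 1)⁻¹ ≤ 1 / 2 := by
    rw [← div_eq_mul_inv, div_le_div_iff₀ hk two_pos]; linarith
  calc Real.exp (-((2 * L + 1) * t)) * ‖T.duhamel g t‖
      ≤ Real.exp (-((2 * L + 1) * t)) * (L * D * ((2 * L + 1)⁻¹ *
          Real.exp ((2 * L + 1) * t))) := by
        refine mul_le_mul_of_nonneg_left (h1.trans ?_) (Real.exp_nonneg _)
        have : 0 ≤ (2 * L + 1)⁻¹ := by positivity
        gcongr
        linarith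
    _ = L * (2 * L + 1)⁻¹ * D := by
        rw [Real.exp_neg]
        field_simp
    _ ≤ 1 / 2 * D := by gcongr
    _ = D / 2 := by ring

open BoundedContinuousFunction in
/-- Global existence of a mild solution of `u' = A u + F(t, u)` with values in prescribed closed
sets `K t`, for a Lipschitz nonlinearity. -/
theorem exists_isMild [CompleteSpace E] (T : ContractionSemigroup E) {K : ℝ → Set E}
    (hK : ∀ t, 0 ≤ t → IsClosed (K t)) {F : ℝ → E → E} (hF : Continuous (Function.uncurry F))
    {L : ℝ} (hL : 0 ≤ L)
    (hLip : ∀ t, 0 ≤ t → ∀ x ∈ K t, ∀ y ∈ K t, ‖F t x - F t y‖ ≤ L * ‖x - y‖)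
    (hbd : ∀ t, 0 ≤ t → ∀ x ∈ K t, ‖F t x‖ ≤ L * ‖x‖) (x₀ : E)
    (hinv : ∀ v : ℝ → E, Continuous v → (∀ t, 0 ≤ t → v t ∈ K t) →
      ∀ t, 0 ≤ t → T t x₀ + T.duhamel (fun s => F s (v s)) t ∈ K t)
    {v₀ : ℝ → E} {C : ℝ} (hv₀ : Continuous v₀) (hv₀K : ∀ t, 0 ≤ t → v₀ t ∈ K t)
    (hv₀b : ∀ t, 0 ≤ t → ‖v₀ t‖ ≤ C * Real.exp (L * t)) :
    ∃ u : ℝ → E, Continuous u ∧ u 0 = x₀ ∧ (∀ t, 0 ≤ t → u t ∈ K t) ∧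
      T.IsMild (fun s => F s (u s)) u := by
  -- The unknown of the fixed point problem is `w t = exp (-k t) • u t`: it is bounded, and in the
  -- sup norm the Duhamel map contracts by `1 / 2` on all of `[0, ∞)` at once.
  set k := 2 * L + 1 with hk
  let A : Set (ℝ →ᵇ E) := {w | ∀ t, 0 ≤ t → Real.exp (k * t) • w t ∈ K t}
  have hAc : IsClosed A := by
    have : A = ⋂ t, ⋂ (_ : 0 ≤ t), (fun w : ℝ →ᵇ E => Real.exp (k * t) • w t) ⁻¹' K t := by
      ext w; simp [A]
    rw [this]
    exact isClosed_iInter fun t => isClosed_iInter fun ht =>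
      (hK t ht).preimage ((continuous_eval_const t).const_smul _)
  let G : (ℝ →ᵇ E) → ℝ → E := fun w s => F s (Real.exp (k * s) • w s)
  have hGc : ∀ w, Continuous (G w) := fun w => hF.comp
    (continuous_id.prodMk ((by fun_prop : Continuous fun s : ℝ => Real.exp (k * s)).smul
      w.continuous))
  have hGb : ∀ w ∈ A, ∀ s, 0 ≤ s → ‖G w s‖ ≤ L * ‖w‖ * Real.exp (k * s) := fun w hw s hs => by
    refine (hbd s hs _ (hw s hs)).trans ?_
    rw [norm_smul, Real.norm_eq_abs, Real.abs_exp, mul_assoc, mul_comm ‖w‖]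
    gcongr
    exact w.norm_coe_le_norm s
  have hcont : ∀ w, Continuous fun t : ℝ =>
      Real.exp (-(k * max t 0)) • (T (max t 0) x₀ + T.duhamel (G w) (max t 0)) := fun w =>
    (by fun_prop : Continuous fun t : ℝ => Real.exp (-(k * max t 0))).smul
      ((T.continuous_max.comp (continuous_id.prodMk continuous_const)).add
        (T.continuous_duhamel_max (hGc w)))
  let Φ : A → A := fun w => ⟨BoundedContinuousFunction.ofNormedAddCommGroup _ (hcont w)
    (‖x₀‖ + ‖(w : ℝ →ᵇ E)‖ / 2) fun t => by
      rw [smul_add]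
      refine (norm_add_le _ _).trans (add_le_add ?_
        (T.norm_exp_smul_duhamel_le hL (norm_nonneg _) (le_max_right _ _) (hGb w w.2)))
      rw [norm_smul, Real.norm_eq_abs, Real.abs_exp]
      refine (mul_le_of_le_one_left (norm_nonneg _) (Real.exp_le_one_iff.2 ?_)).trans
        (T.norm_le _ (le_max_right _ _) _)
      have : 0 ≤ max t 0 := le_max_right _ _
      have : 0 ≤ k * max t 0 := by positivity
      linarith, fun t ht => by
      have h1 := hinv (fun s => Real.exp (k * s) • (w : ℝ →ᵇ E) s)
        ((by fun_prop : Continuous fun s : ℝ => Real.exp (k * s)).smul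
          (w : ℝ →ᵇ E).continuous) w.2 t ht
      rw [BoundedContinuousFunction.coe_ofNormedAddCommGroup, max_eq_left ht, smul_smul,
        ← Real.exp_add, add_neg_cancel, Real.exp_zero, one_smul]
      exact h1⟩
  have hΦ : ContractingWith (1 / 2) Φ := by
    refine ⟨by
      rw [← NNReal.coe_lt_coe]; norm_num, LipschitzWith.of_dist_le_mul fun w w' => ?_⟩
    rw [Subtype.dist_eq, BoundedContinuousFunction.dist_le (by positivity)]
    intro t
    have ht : 0 ≤ max t 0 := le_max_right _ _
    have : (Φ w : ℝ →ᵇ E) t - (Φ w' : ℝ →ᵇ E) t = Real.exp (-(k * max t 0)) •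
        T.duhamel (fun s => G w s - G w' s) (max t 0) := by
      rw [T.duhamel_sub ht (hGc w).continuousOn (hGc w').continuousOn]
      simp only [Φ, BoundedContinuousFunction.coe_ofNormedAddCommGroup]
      rw [← smul_sub]
      congr 1
      abel
    rw [dist_eq_norm, this]
    refine (T.norm_exp_smul_duhamel_le hL (norm_nonneg ((w : ℝ →ᵇ E) - w')) ht
      fun s hs => ?_).trans_eq ?_
    · refine (hLip s hs _ (w.2 s hs) _ (w'.2 s hs)).trans ?_
      rw [← smul_sub, norm_smul, Real.norm_eq_abs, Real.abs_exp, mul_assoc,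
        mul_comm ‖(w : ℝ →ᵇ E) - w'‖]
      gcongr
      exact ((w : ℝ →ᵇ E) - w').norm_coe_le_norm s
    · rw [Subtype.dist_eq, dist_eq_norm]
      push_cast
      ring
  have hC : 0 ≤ C := by
    have := (norm_nonneg _).trans (hv₀b 0 le_rfl)
    simpa using this
  -- The iteration needs a starting point in the constraint set. The rescaled `v₀` is bounded
  -- because its growth rate `L` is below `k`.
  let w₀ : A := ⟨BoundedContinuousFunction.ofNormedAddCommGroup
    (fun t => Real.exp (-(k * max t 0)) • v₀ (max t 0))
    ((by fun_prop : Continuous fun t : ℝ => Real.exp (-(k * max t 0))).smul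
      (hv₀.comp (continuous_id.max continuous_const))) C fun t => by
      have ht : 0 ≤ max t 0 := le_max_right _ _
      rw [norm_smul, Real.norm_eq_abs, Real.abs_exp]
      calc Real.exp (-(k * max t 0)) * ‖v₀ (max t 0)‖
          ≤ Real.exp (-(k * max t 0)) * (C * Real.exp (L * max t 0)) := by
            gcongr; exact hv₀b _ ht
        _ = C * Real.exp (-((L + 1) * max t 0)) := by
            rw [mul_left_comm, ← Real.exp_add, hk]; ring_nf
        _ ≤ C := mul_le_of_le_one_right hC (Real.exp_le_one_iff.2 (by
            have : 0 ≤ (L + 1) * max t 0 := by positivity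
            linarith)), fun t ht => by
      rw [BoundedContinuousFunction.coe_ofNormedAddCommGroup, max_eq_left ht, smul_smul,
        ← Real.exp_add, add_neg_cancel, Real.exp_zero, one_smul]
      exact hv₀K t ht⟩
  have : CompleteSpace A := hAc.completeSpace_coe
  obtain ⟨w, hw, -⟩ := hΦ.exists_fixedPoint w₀ (edist_ne_top _ _)
  have hw' : ∀ t, 0 ≤ t → (w : ℝ →ᵇ E) t =
      Real.exp (-(k * t)) • (T t x₀ + T.duhamel (G w) t) := fun t ht => by
    have h1 : (Φ w : ℝ →ᵇ E) t = (w : ℝ →ᵇ E) t := by rw [hw.eq]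
    rw [← h1]
    simp only [Φ, BoundedContinuousFunction.coe_ofNormedAddCommGroup, max_eq_left ht]
  have hu : ∀ t, 0 ≤ t → Real.exp (k * t) • (w : ℝ →ᵇ E) t = T t x₀ + T.duhamel (G w) t :=
    fun t ht => by
      rw [hw' t ht, smul_smul, ← Real.exp_add, add_neg_cancel, Real.exp_zero, one_smul]
  have hu0 : Real.exp (k * 0) • (w : ℝ →ᵇ E) 0 = x₀ := by
    rw [hu 0 le_rfl, T.toFun_zero, duhamel, intervalIntegral.integral_same, add_zero]
  refine ⟨fun t => Real.exp (k * t) • (w : ℝ →ᵇ E) t,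
    (by fun_prop : Continuous fun s : ℝ => Real.exp (k * s)).smul (w : ℝ →ᵇ E).continuous,
    hu0, w.2, fun t ht => ?_⟩
  simp only
  rw [hu0]
  exact hu t ht

end ContractionSemigroup

/-! ### Differentiability in time of mild solutions -/

namespace ContractionSemigroup

variable {E : Type*} [NormedAddCommGroup E] [NormedSpace ℝ E]

/-- By joint continuity, `T (h - s) (f s)` is uniformly close to `f 0` for `0 < s ≤ h` small, and so
is its mean over `[0, h]`. -/
theorem tendsto_smul_duhamel [CompleteSpace E] (T : ContractionSemigroup E) {f : ℝ → E}
    (hf : Continuous f) : Tendsto (fun h : ℝ => h⁻¹ • T.duhamel f h) (𝓝[>] 0) (𝓝 (f 0)) := by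
  rw [Metric.tendsto_nhds]
  intro ε hε
  have hc : Continuous fun p : ℝ × ℝ => T (max (p.1 - p.2) 0) (f p.2) :=
    T.continuous_max.comp ((continuous_fst.sub continuous_snd).prodMk (hf.comp continuous_snd))
  have h0 : T (max ((0 : ℝ) - 0) 0) (f 0) = f 0 := by simp [T.toFun_zero]
  have h1 := Metric.tendsto_nhds.1 (hc.tendsto ((0 : ℝ), (0 : ℝ))) (ε / 2) (half_pos hε)
  rw [Metric.eventually_nhds_iff] at h1
  obtain ⟨δ, hδ, h1⟩ := h1
  filter_upwards [Ioo_mem_nhdsGT hδ] with h hh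
  have h2 : T.duhamel f h - h • f 0 = ∫ s in (0 : ℝ)..h, (T (max (h - s) 0) (f s) - f 0) := by
    rw [intervalIntegral.integral_sub ((T.continuous_integrand hf h).intervalIntegrable _ _)
      (by simp), T.duhamel_eq f hh.1.le]
    simp
  have h3 : ‖T.duhamel f h - h • f 0‖ ≤ ε / 2 * |h - 0| := by
    rw [h2]
    refine intervalIntegral.norm_integral_le_of_norm_le_const fun s hs => ?_
    rw [uIoc_of_le hh.1.le] at hs
    have := h1 (y := (h, s)) (by
      rw [Prod.dist_eq, max_lt_iff, Real.dist_0_eq_abs, Real.dist_0_eq_abs, abs_of_pos hh.1,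
        abs_of_pos hs.1]
      exact ⟨hh.2, hs.2.trans_lt hh.2⟩)
    rw [dist_eq_norm] at this
    simp only at this
    rw [h0] at this
    exact this.le
  have h4 : h⁻¹ • T.duhamel f h - f 0 = h⁻¹ • (T.duhamel f h - h • f 0) := by
    rw [smul_sub, smul_smul, inv_mul_cancel₀ hh.1.ne', one_smul]
  rw [dist_eq_norm, h4, norm_smul, norm_inv, Real.norm_eq_abs]
  rw [sub_zero] at h3
  have hpos : 0 < |h| := abs_pos.2 hh.1.ne'
  calc |h|⁻¹ * ‖T.duhamel f h - h • f 0‖ ≤ |h|⁻¹ * (ε / 2 * |h|) := by gcongr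
    _ = ε / 2 := by field_simp
    _ < ε := half_lt_self hε

/-- A mild solution of a semilinear equation that starts in the domain of the generator is
differentiable from the right, provided that the nonlinearity has a derivative with a quadratic
remainder along the solution. -/
theorem IsMild.tendsto_difference_quotient [CompleteSpace E] {T : ContractionSemigroup E}
    {b : E → E} {b' : E → E →L[ℝ] E} (hb : Continuous b) (hb' : Continuous b') {u : ℝ → E}
    (huc : Continuous u) (hu : T.IsMild (fun s => b (u s)) u) {L Q : ℝ} (hL : 0 ≤ L) (hQ : 0 ≤ Q)
    (hlip : ∀ s t, 0 ≤ s → 0 ≤ t → ‖b (u t) - b (u s)‖ ≤ L * ‖u t - u s‖)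
    (hnorm : ∀ s, 0 ≤ s → ‖b' (u s)‖ ≤ L)
    (hquad : ∀ s t, 0 ≤ s → 0 ≤ t →
      ‖b (u t) - b (u s) - b' (u s) (u t - u s)‖ ≤ Q * ‖u t - u s‖ ^ 2)
    {g : E} (hg : Tendsto (fun h : ℝ => h⁻¹ • (T h (u 0) - u 0)) (𝓝[>] 0) (𝓝 g)) :
    ∃ w : ℝ → E, Continuous w ∧ ∀ t, 0 ≤ t →
      Tendsto (fun h : ℝ => h⁻¹ • (u (t + h) - u t)) (𝓝[>] 0) (𝓝 (w t)) := by
  set f : ℝ → E := fun s => b (u s) with hf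
  have hfc : Continuous f := hb.comp huc
  have hd0 : Tendsto (fun h : ℝ => h⁻¹ • (u h - u 0)) (𝓝[>] 0) (𝓝 (g + f 0)) := by
    refine (hg.add (T.tendsto_smul_duhamel hfc)).congr' ?_
    filter_upwards [self_mem_nhdsWithin] with h (hh : 0 < h)
    rw [hu h hh.le, ← smul_add]
    congr 1
    abel
  have hF : Continuous (Function.uncurry fun (t : ℝ) (x : E) => b' (u (max t 0)) x) :=
    (hb'.comp (huc.comp (continuous_fst.max continuous_const))).clm_apply continuous_snd
  -- The candidate for the derivative of `u`: the mild solution of the linearised equation, started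
  -- at the right derivative `g + f 0` of `u` at time `0`.
  obtain ⟨w, hwc, hw0, -, hw⟩ := T.exists_isMild (K := fun _ => univ)
    (fun _ _ => isClosed_univ) hF hL
    (fun t _ x _ y _ => by
      rw [← map_sub]
      exact (b' (u (max t 0))).le_of_opNorm_le (hnorm _ (le_max_right _ _)) _)
    (fun t _ x _ => (b' (u (max t 0))).le_of_opNorm_le (hnorm _ (le_max_right _ _)) _)
    (g + f 0) (fun _ _ _ _ _ => mem_univ _) (v₀ := fun _ => 0) (C := 0) continuous_const
    (fun _ _ => mem_univ _) (fun _ _ => by simp)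
  have hFw : Continuous fun s => b' (u (max s 0)) (w s) :=
    hF.comp (continuous_id.prodMk hwc)
  refine ⟨w, hwc, fun τ hτ => ?_⟩
  have hdm : ∀ h, 0 ≤ h → T.IsMild (fun s => f (s + h) - f s) (fun s => u (s + h) - u s) :=
    fun h hh => (hu.shift hfc hh).sub hu (hfc.comp (by fun_prop)) hfc
  have hdc : ∀ h, Continuous fun s => u (s + h) - u s := fun h =>
    (huc.comp (by fun_prop)).sub huc
  -- Grönwall's inequality bounds every increment over a time step `h` by the increment at time `0`.
  have hdb : ∀ h, 0 ≤ h → ∀ t ∈ Icc 0 τ,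
      ‖u (t + h) - u t‖ ≤ ‖u h - u 0‖ * Real.exp (L * τ) := fun h hh t ht => by
    have := le_mul_exp_of_le_add_integral (φ := fun s => ‖u (s + h) - u s‖) (a := ‖u h - u 0‖)
      (T := τ) (hdc h).norm.continuousOn hL (fun t ht => by
        have h1 := hdm h hh t ht.1
        simp only [zero_add] at h1
        rw [h1]
        refine (norm_add_le _ _).trans (add_le_add (T.norm_le t ht.1 _) ?_)
        rw [← intervalIntegral.integral_const_mul]
        exact T.norm_duhamel_le ht.1 (((hdc h).norm.const_smul L).intervalIntegrable _ _)
          fun s hs => hlip _ _ hs.1 (add_nonneg hs.1 hh)) t ht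
    refine this.trans ?_
    gcongr
    exact ht.2
  set e : ℝ → ℝ → E := fun h s => h⁻¹ • (u (s + h) - u s) - w s with he
  have hec : ∀ h, Continuous (e h) := fun h => ((hdc h).const_smul _).sub hwc
  have heb : ∀ h, 0 < h → ‖e h τ‖ ≤
      (‖e h 0‖ + τ * (h⁻¹ * (Q * (‖u h - u 0‖ * Real.exp (L * τ)) ^ 2))) *
        Real.exp (L * τ) := fun h hh => by
    have hforce : ∀ s ∈ Icc 0 τ, ‖h⁻¹ • (f (s + h) - f s) - b' (u (max s 0)) (w s)‖ ≤
        L * ‖e h s‖ + h⁻¹ * (Q * (‖u h - u 0‖ * Real.exp (L * τ)) ^ 2) := fun s hs => by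
      -- The forcing of the error is the linearisation applied to the error, plus the Taylor
      -- remainder divided by `h`.
      have h1 : h⁻¹ • (f (s + h) - f s) - b' (u (max s 0)) (w s) = b' (u s) (e h s) +
          h⁻¹ • (b (u (s + h)) - b (u s) - b' (u s) (u (s + h) - u s)) := by
        simp only [he, hf, max_eq_left hs.1, map_sub, map_smul, smul_sub]
        abel
      rw [h1]
      refine (norm_add_le _ _).trans (add_le_add
        ((b' (u s)).le_of_opNorm_le (hnorm s hs.1) _) ?_)
      rw [norm_smul, norm_inv, Real.norm_eq_abs, abs_of_pos hh]
      have h2 := hquad s (s + h) hs.1 (add_nonneg hs.1 hh.le)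
      have h3 := hdb h hh.le s hs
      have : 0 < h⁻¹ := inv_pos.2 hh
      refine mul_le_mul_of_nonneg_left (h2.trans ?_) this.le
      gcongr
    refine le_mul_exp_of_le_add_integral (φ := fun s => ‖e h s‖) (T := τ)
      (hec h).norm.continuousOn hL (fun t ht => ?_) τ ⟨hτ, le_rfl⟩
    have h1 : T.IsMild (fun s => h⁻¹ • (f (s + h) - f s) - b' (u (max s 0)) (w s)) (e h) := by
      have hsm : T.IsMild (fun s => h⁻¹ • (f (s + h) - f s))
          (fun s => h⁻¹ • (u (s + h) - u s)) := fun t ht => by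
        rw [T.duhamel_const_smul, map_smul, ← smul_add, ← hdm h hh.le t ht]
      exact hsm.sub hw (((hfc.comp (by fun_prop)).sub hfc).const_smul _) hFw
    rw [h1 t ht.1, add_assoc]
    refine (norm_add_le _ _).trans (add_le_add (T.norm_le t ht.1 _) ?_)
    have hint : IntervalIntegrable (fun s => L * ‖e h s‖) volume 0 t :=
      ((hec h).norm.const_smul L).intervalIntegrable _ _
    refine (T.norm_duhamel_le ht.1 (hint.add intervalIntegrable_const)
      fun s hs => hforce s ⟨hs.1, hs.2.trans ht.2⟩).trans ?_
    rw [intervalIntegral.integral_add hint intervalIntegrable_const,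
      intervalIntegral.integral_const_mul, intervalIntegral.integral_const, sub_zero, smul_eq_mul,
      add_comm]
    gcongr
    exact ht.2
  have hd : Tendsto (fun h : ℝ => u h - u 0) (𝓝[>] 0) (𝓝 0) := by
    have := (huc.sub continuous_const).tendsto' 0 (u 0 - u 0) rfl
    rw [sub_self] at this
    exact this.mono_left nhdsWithin_le_nhds
  have he0 : Tendsto (fun h => ‖e h 0‖) (𝓝[>] 0) (𝓝 0) := by
    have := (hd0.sub (tendsto_const_nhds (x := g + f 0))).norm
    rw [sub_self, norm_zero] at this
    refine this.congr fun h => ?_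
    simp only [he, zero_add, hw0]
  -- The remainder is a constant times `‖h⁻¹ • (u h - u 0)‖ * ‖u h - u 0‖`: the first factor
  -- converges by `hd0` and the second vanishes.
  have hbound : Tendsto (fun h : ℝ =>
      (‖e h 0‖ + τ * (h⁻¹ * (Q * (‖u h - u 0‖ * Real.exp (L * τ)) ^ 2))) * Real.exp (L * τ))
      (𝓝[>] 0) (𝓝 0) := by
    have h1 := ((hd0.norm.mul hd.norm).const_mul (τ * Q * Real.exp (L * τ) ^ 2)).congr'
      (f₂ := fun h => τ * (h⁻¹ * (Q * (‖u h - u 0‖ * Real.exp (L * τ)) ^ 2))) (by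
        filter_upwards [self_mem_nhdsWithin] with h (hh : 0 < h)
        rw [norm_smul, norm_inv, Real.norm_eq_abs, abs_of_pos hh]
        ring)
    have h2 := (he0.add h1).mul_const (Real.exp (L * τ))
    simpa using h2
  rw [tendsto_iff_norm_sub_tendsto_zero]
  refine tendsto_of_tendsto_of_tendsto_of_le_of_le' tendsto_const_nhds hbound
    (Eventually.of_forall fun _ => norm_nonneg _) ?_
  filter_upwards [self_mem_nhdsWithin] with h (hh : 0 < h)
  exact heb h hh

/-- A continuous function with a continuous right derivative is the integral of that derivative, so
the left derivative exists as well. -/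
theorem hasDerivWithinAt_Ici_of_tendsto [CompleteSpace E] {u w : ℝ → E} (huc : Continuous u)
    (hwc : Continuous w) (h : ∀ t, 0 ≤ t →
      Tendsto (fun h : ℝ => h⁻¹ • (u (t + h) - u t)) (𝓝[>] 0) (𝓝 (w t))) {t : ℝ} (ht : 0 ≤ t) :
    HasDerivWithinAt u (w t) (Ici 0) t := by
  have hr : ∀ s, 0 ≤ s → HasDerivWithinAt u (w s) (Ioi s) s := fun s hs => by
    rw [hasDerivWithinAt_iff_tendsto_slope' self_notMem_Ioi]
    have h1 : Tendsto (fun y => y - s) (𝓝[>] s) (𝓝[>] 0) := by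
      refine tendsto_nhdsWithin_iff.2 ⟨?_, ?_⟩
      · have : Continuous fun y : ℝ => y - s := by fun_prop
        exact (this.tendsto' s 0 (sub_self s)).mono_left nhdsWithin_le_nhds
      · filter_upwards [self_mem_nhdsWithin] with y hy
        exact mem_Ioi.2 (sub_pos.2 (mem_Ioi.1 hy))
    refine ((h s hs).comp h1).congr fun y => ?_
    simp [slope_def_module]
  have hint : ∀ s, 0 ≤ s → u s = u 0 + ∫ r in (0 : ℝ)..s, w r := fun s hs => by
    rw [intervalIntegral.integral_eq_sub_of_hasDeriv_right huc.continuousOn (fun x hx => hr x ?_)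
      (hwc.intervalIntegrable _ _), add_sub_cancel]
    rw [min_eq_left hs] at hx
    exact hx.1.le
  exact (((hwc.integral_hasStrictDerivAt 0 t).hasDerivAt.const_add (u 0)).hasDerivWithinAt).congr
    (fun s hs => hint s hs) (hint t ht)

/-- Restarting at time `t` writes `T h (u t) - u t` as the increment of `u` minus a Duhamel integral
of length `h`, whose quotient by `h` tends to `f t`. Thus differentiability in time puts `u t` in
the domain. -/
theorem IsMild.tendsto_generator [CompleteSpace E] {T : ContractionSemigroup E} {f u : ℝ → E}
    (hu : T.IsMild f u) (hf : Continuous f) {t : ℝ} (ht : 0 ≤ t) {w : E}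
    (h : Tendsto (fun h : ℝ => h⁻¹ • (u (t + h) - u t)) (𝓝[>] 0) (𝓝 w)) :
    Tendsto (fun h : ℝ => h⁻¹ • (T h (u t) - u t)) (𝓝[>] 0) (𝓝 (w - f t)) := by
  have h1 := T.tendsto_smul_duhamel (f := fun s => f (s + t)) (hf.comp (by fun_prop))
  simp only [zero_add] at h1
  refine (h.sub h1).congr' ?_
  filter_upwards [self_mem_nhdsWithin] with r (hr : 0 < r)
  have := hu.shift hf ht r hr.le
  beta_reduce at this
  rw [zero_add] at this
  rw [← smul_sub, add_comm t r, this]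
  congr 1
  abel

/-- A vector in the domain of the generator is a mild solution with constant forcing. -/
theorem isMild_const [CompleteSpace E] (T : ContractionSemigroup E) {x g : E}
    (hg : Tendsto (fun h : ℝ => h⁻¹ • (T h x - x)) (𝓝[>] 0) (𝓝 g)) :
    T.IsMild (fun _ => -g) (fun _ => x) := by
  have hc : Continuous fun t : ℝ => T (max t 0) x :=
    T.continuous_max.comp (continuous_id.prodMk continuous_const)
  have hgc : Continuous fun t : ℝ => T (max t 0) g :=
    T.continuous_max.comp (continuous_id.prodMk continuous_const)
  intro t ht
  -- On the domain, the orbit of `x` has derivative `T s g`. Integrating it and reversing time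
  -- produces the Duhamel integral of `-g`.
  have hd : ∀ s, 0 ≤ s → HasDerivWithinAt (fun t => T (max t 0) x) (T (max s 0) g) (Ici 0) s :=
    fun s hs => hasDerivWithinAt_Ici_of_tendsto hc hgc (fun s hs => by
    rw [max_eq_left hs]
    refine (((T s).continuous.tendsto g).comp hg).congr' ?_
    filter_upwards [self_mem_nhdsWithin] with h (hh : 0 < h)
    simp only [Function.comp, map_smul, map_sub]
    rw [max_eq_left (add_nonneg hs hh.le), T.toFun_add s h hs hh.le]) hs
  have h1 := intervalIntegral.integral_eq_sub_of_hasDeriv_right (a := 0) (b := t)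
    hc.continuousOn (fun s hs => (hd s (by rw [min_eq_left ht] at hs; exact hs.1.le)).mono
      (fun r hr => by
        rw [min_eq_left ht] at hs; exact (hs.1.trans hr).le)) (hgc.intervalIntegrable _ _)
  simp only [max_self, max_eq_left ht, T.toFun_zero] at h1
  have h2 : T.duhamel (fun _ => -g) t = -∫ s in (0 : ℝ)..t, T (max s 0) g := by
    rw [T.duhamel_eq _ ht]
    simp only [map_neg, intervalIntegral.integral_neg]
    rw [intervalIntegral.integral_comp_sub_left (fun s => T (max s 0) g) t, sub_self, sub_zero]
  rw [h2, h1]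
  beta_reduce
  abel

end ContractionSemigroup

/-! ### Adjoints of jump operators via the Radon–Nikodym theorem -/

section Adjoint

variable {X Y : Type*} [MeasurableSpace X] [MeasurableSpace Y]

theorem Lp_eq_of_forall_integral_mul_eq {ν : Measure X} {f g : Lp ℝ 1 ν}
    (h : ∀ φ : X → ℝ, Measurable φ → (∃ C : ℝ, ∀ x, |φ x| ≤ C) →
      ∫ x, f x * φ x ∂ν = ∫ x, g x * φ x ∂ν) : f = g := by
  refine Lp.ext (Integrable.ae_eq_of_forall_setIntegral_eq _ _ (L1.integrable_coeFn _)
    (L1.integrable_coeFn _) fun s hs _ => ?_)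
  have key := h (s.indicator fun _ => 1) (measurable_const.indicator hs) ⟨1, fun x => by
    by_cases hx : x ∈ s <;> simp [hx]⟩
  simpa only [← indicator_mul_right, mul_one, integral_indicator hs] using key

theorem isFiniteKernel_of_le {κ : Kernel Y X} {C : ℝ≥0} (hC : ∀ y, κ y univ ≤ C) :
    IsFiniteKernel κ :=
  ⟨C, ENNReal.coe_lt_top, hC⟩

theorem abs_integral_kernel_le {κ : Kernel Y X} {C : ℝ≥0} (hC : ∀ y, κ y univ ≤ C) {φ : X → ℝ}
    {B : ℝ} (hB0 : 0 ≤ B) (hB : ∀ x, |φ x| ≤ B) (y : Y) : |∫ z, φ z ∂(κ y)| ≤ B * C := by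
  have := isFiniteKernel_of_le hC
  refine (norm_integral_le_of_norm_le_const (μ := κ y) (f := φ) (ae_of_all _ hB)).trans
    (mul_le_mul_of_nonneg_left ?_ hB0)
  exact ENNReal.toReal_le_of_le_ofReal C.2 (by simpa using hC y)

theorem measurable_integral_kernel {κ : Kernel Y X} {C : ℝ≥0} (hC : ∀ y, κ y univ ≤ C)
    {φ : X → ℝ} (hφ : Measurable φ) : Measurable fun y => ∫ z, φ z ∂(κ y) := by
  have := isFiniteKernel_of_le hC
  exact (hφ.stronglyMeasurable.integral_kernel (κ := κ)).measurable

theorem integrable_mul_integral_kernel {η : Measure Y} {κ : Kernel Y X} {C : ℝ≥0}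
    (hC : ∀ y, κ y univ ≤ C) {F : Y → ℝ} (hF : Integrable F η) {φ : X → ℝ} (hφ : Measurable φ)
    (hB : ∃ B : ℝ, ∀ x, |φ x| ≤ B) : Integrable (fun y => F y * ∫ z, φ z ∂(κ y)) η := by
  obtain ⟨B, hB⟩ := hB
  refine hF.mul_bdd (c := max B 0 * C) (measurable_integral_kernel hC hφ).aestronglyMeasurable
    (ae_of_all _ fun y => ?_)
  exact abs_integral_kernel_le hC (le_max_right _ _) (fun x => (hB x).trans (le_max_left _ _)) y

theorem integrable_mul_of_bounded {ν : Measure X} {f : X → ℝ} (hf : Integrable f ν) {φ : X → ℝ}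
    (hφ : Measurable φ) (hB : ∃ B : ℝ, ∀ x, |φ x| ≤ B) : Integrable (fun x => f x * φ x) ν := by
  obtain ⟨B, hB⟩ := hB
  exact hf.mul_bdd (c := B) hφ.aestronglyMeasurable (ae_of_all _ hB)

/-- The density of the image of a nonnegative density under a kernel. -/
theorem exists_density_of_nonneg {ν : Measure X} [IsFiniteMeasure ν] {η : Measure Y}
    {κ : Kernel Y X} {C : ℝ≥0} (hC : ∀ y, κ y univ ≤ C)
    (hκ : ∀ s, MeasurableSet s → ν s = 0 → ∀ᵐ y ∂η, κ y s = 0) {F : Y → ℝ} (hFm : Measurable F)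
    (hF : Integrable F η) (hF0 : ∀ y, 0 ≤ F y) :
    ∃ g : X → ℝ, Integrable g ν ∧ (∀ x, 0 ≤ g x) ∧
      ∀ φ : X → ℝ, Measurable φ → (∃ B : ℝ, ∀ x, |φ x| ≤ B) →
        ∫ y, F y * ∫ z, φ z ∂(κ y) ∂η = ∫ x, g x * φ x ∂ν := by
  have := isFiniteKernel_of_le hC
  -- The measure `F dη` transported by `κ` charges no `ν`-null set, by `hκ`; its Radon–Nikodym
  -- derivative is the required density.
  set μ := η.withDensity fun y => ENNReal.ofReal (F y) with hμ
  have : IsFiniteMeasure μ := isFiniteMeasure_withDensity_ofReal hF.2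
  have hac : κ ∘ₘ μ ≪ ν := Measure.AbsolutelyContinuous.mk fun s hs h0 => by
    rw [Measure.bind_apply hs κ.aemeasurable,
      lintegral_eq_zero_iff (κ.measurable_coe hs)]
    exact (withDensity_absolutelyContinuous _ _).ae_le (hκ s hs h0)
  refine ⟨fun x => ((κ ∘ₘ μ).rnDeriv ν x).toReal, Measure.integrable_toReal_rnDeriv,
    fun x => ENNReal.toReal_nonneg, fun φ hφ hB => ?_⟩
  have hint : Integrable φ (κ ∘ₘ μ) := by
    obtain ⟨B, hB⟩ := hB
    exact (integrable_const B).mono' hφ.aestronglyMeasurable (ae_of_all _ hB)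
  rw [integral_toReal_rnDeriv_mul hac]
  rw [Measure.comp_eq_comp_const_apply] at hint ⊢
  rw [Kernel.integral_comp hint, Kernel.const_apply, hμ,
    integral_withDensity_eq_integral_toReal_smul (by fun_prop) (by simp)]
  refine integral_congr_ae (ae_of_all _ fun y => ?_)
  simp only [ENNReal.toReal_ofReal (hF0 y), smul_eq_mul]

/-- Positive and negative parts are transported separately; testing with the constant `1` shows that
each mass grows at most by the factor `C`. -/
theorem exists_density {ν : Measure X} [IsFiniteMeasure ν] {η : Measure Y}
    {κ : Kernel Y X} {C : ℝ≥0} (hC : ∀ y, κ y univ ≤ C)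
    (hκ : ∀ s, MeasurableSet s → ν s = 0 → ∀ᵐ y ∂η, κ y s = 0) (F : Lp ℝ 1 η) :
    ∃ g : Lp ℝ 1 ν, ‖g‖ ≤ C * ‖F‖ ∧
      ∀ φ : X → ℝ, Measurable φ → (∃ B : ℝ, ∀ x, |φ x| ≤ B) →
        ∫ y, F y * ∫ z, φ z ∂(κ y) ∂η = ∫ x, g x * φ x ∂ν := by
  have hFi := L1.integrable_coeFn F
  have hFm : Measurable F := (Lp.stronglyMeasurable F).measurable
  obtain ⟨g₁, hg₁, hg₁0, h₁⟩ := exists_density_of_nonneg hC hκ (hFm.max measurable_const)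
    hFi.pos_part (fun y => le_max_right (F y) 0)
  obtain ⟨g₂, hg₂, hg₂0, h₂⟩ := exists_density_of_nonneg hC hκ (F := fun y => max (-F y) 0)
    (hFm.neg.max measurable_const) hFi.neg_part (fun y => le_max_right (-F y) 0)
  have hsub : ∀ y, F y = max (F y) 0 - max (-F y) 0 := fun y => by
    rcases le_total (F y) 0 with h | h
    · rw [max_eq_right h, max_eq_left (by linarith)]; ring
    · rw [max_eq_left h, max_eq_right (by linarith)]; ring
  have hadd : ∀ y, |F y| = max (F y) 0 + max (-F y) 0 := fun y => by
    rcases le_total (F y) 0 with h | h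
    · rw [max_eq_right h, max_eq_left (by linarith), abs_of_nonpos h]; ring
    · rw [max_eq_left h, max_eq_right (by linarith), abs_of_nonneg h]; ring
  have hmass : ∀ {G : Y → ℝ} {g : X → ℝ}, Integrable G η → (∀ y, 0 ≤ G y) → (∀ x, 0 ≤ g x) →
      (∀ φ : X → ℝ, Measurable φ → (∃ B : ℝ, ∀ x, |φ x| ≤ B) →
        ∫ y, G y * ∫ z, φ z ∂(κ y) ∂η = ∫ x, g x * φ x ∂ν) →
      ∫ x, g x ∂ν ≤ C * ∫ y, G y ∂η := by
    intro G g hG hG0 hg0 h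
    have hb : ∃ B : ℝ, ∀ x : X, |(1 : ℝ)| ≤ B := ⟨1, fun _ => by simp⟩
    have := h (fun _ => 1) measurable_const hb
    simp only [mul_one] at this
    rw [← this, ← integral_const_mul]
    refine integral_mono (integrable_mul_integral_kernel hC hG measurable_const hb)
      (hG.const_mul _) fun y => ?_
    have h1 := abs_integral_kernel_le hC (φ := fun _ => 1) zero_le_one (fun _ => by simp) y
    rw [mul_comm]
    exact mul_le_mul_of_nonneg_right ((le_abs_self _).trans (by simpa using h1)) (hG0 y)
  refine ⟨hg₁.toL1 g₁ - hg₂.toL1 g₂, ?_, fun φ hφ hB => ?_⟩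
  · refine (norm_sub_le _ _).trans ?_
    rw [L1.norm_of_fun_eq_integral_norm hg₁, L1.norm_of_fun_eq_integral_norm hg₂,
      L1.norm_eq_integral_norm]
    simp only [Real.norm_eq_abs, hadd, abs_of_nonneg (hg₁0 _), abs_of_nonneg (hg₂0 _)]
    rw [integral_add hFi.pos_part hFi.neg_part, mul_add]
    exact add_le_add (hmass hFi.pos_part (fun _ => le_max_right _ _) hg₁0 h₁)
      (hmass hFi.neg_part (fun _ => le_max_right _ _) hg₂0 h₂)
  · have h3 : ∫ x, (hg₁.toL1 g₁ - hg₂.toL1 g₂ : Lp ℝ 1 ν) x * φ x ∂ν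
        = ∫ x, (g₁ x * φ x - g₂ x * φ x) ∂ν := by
      refine integral_congr_ae ?_
      filter_upwards [Lp.coeFn_sub (hg₁.toL1 g₁) (hg₂.toL1 g₂), hg₁.coeFn_toL1, hg₂.coeFn_toL1]
        with x h1 h2 h3
      rw [h1, Pi.sub_apply, h2, h3, sub_mul]
    rw [h3, integral_sub (integrable_mul_of_bounded hg₁ hφ hB)
      (integrable_mul_of_bounded hg₂ hφ hB), ← h₁ φ hφ hB, ← h₂ φ hφ hB,
      ← integral_sub (integrable_mul_integral_kernel hC hFi.pos_part hφ hB)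
      (integrable_mul_integral_kernel hC hFi.neg_part hφ hB)]
    refine integral_congr_ae (ae_of_all _ fun y => ?_)
    simp only
    rw [← sub_mul, ← hsub]

/-- The action of a kernel on densities, as a bounded operator between `L¹` spaces. -/
theorem exists_densityOperator {ν : Measure X} [IsFiniteMeasure ν] {η : Measure Y}
    {κ : Kernel Y X} {C : ℝ≥0} (hC : ∀ y, κ y univ ≤ C)
    (hκ : ∀ s, MeasurableSet s → ν s = 0 → ∀ᵐ y ∂η, κ y s = 0) :
    ∃ G : Lp ℝ 1 η →L[ℝ] Lp ℝ 1 ν,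
      ∀ φ : X → ℝ, Measurable φ → (∃ B : ℝ, ∀ x, |φ x| ≤ B) → ∀ F : Lp ℝ 1 η,
        ∫ y, F y * ∫ z, φ z ∂(κ y) ∂η = ∫ x, G F x * φ x ∂ν := by
  -- The choice is automatically linear, because a density is determined by its integrals against
  -- bounded functions and these depend linearly on `F`.
  choose g hgn hg using exists_density hC hκ
  refine ⟨LinearMap.mkContinuous
    { toFun := g
      map_add' := fun F F' => Lp_eq_of_forall_integral_mul_eq fun φ hφ hB => ?_
      map_smul' := fun c F => Lp_eq_of_forall_integral_mul_eq fun φ hφ hB => ?_ } C hgn,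
    fun φ hφ hB F => hg F φ hφ hB⟩
  · have h1 : ∫ x, (g F + g F' : Lp ℝ 1 ν) x * φ x ∂ν
        = ∫ x, (g F x * φ x + g F' x * φ x) ∂ν := by
      refine integral_congr_ae ?_
      filter_upwards [Lp.coeFn_add (g F) (g F')] with x h
      rw [h, Pi.add_apply, add_mul]
    rw [h1, integral_add (integrable_mul_of_bounded (L1.integrable_coeFn _) hφ hB)
      (integrable_mul_of_bounded (L1.integrable_coeFn _) hφ hB), ← hg F φ hφ hB, ← hg F' φ hφ hB,
      ← hg (F + F') φ hφ hB, ← integral_add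
        (integrable_mul_integral_kernel hC (L1.integrable_coeFn _) hφ hB)
        (integrable_mul_integral_kernel hC (L1.integrable_coeFn _) hφ hB)]
    refine integral_congr_ae ?_
    filter_upwards [Lp.coeFn_add F F'] with x h
    rw [h, Pi.add_apply, add_mul]
  · have h1 : ∫ x, (c • g F : Lp ℝ 1 ν) x * φ x ∂ν = ∫ x, c * (g F x * φ x) ∂ν := by
      refine integral_congr_ae ?_
      filter_upwards [Lp.coeFn_smul c (g F)] with x h
      rw [h, Pi.smul_apply, smul_eq_mul, mul_assoc]
    rw [RingHom.id_apply, h1, integral_const_mul, ← hg F φ hφ hB, ← hg (c • F) φ hφ hB,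
      ← integral_const_mul]
    refine integral_congr_ae ?_
    filter_upwards [Lp.coeFn_smul c F] with x h
    rw [h, Pi.smul_apply, smul_eq_mul, mul_assoc]

/-- The kernel that keeps the total mass of `κ` and puts it at the starting point `p y`. -/
noncomputable def lossKernel (κ : Kernel Y X) {p : Y → X} (hp : Measurable p) : Kernel Y X where
  toFun y := κ y univ • Measure.dirac (p y)
  measurable' := Measure.measurable_of_measurable_coe _ fun s hs => by
    simp only [Measure.smul_apply, smul_eq_mul, Measure.dirac_apply' _ hs]
    exact (κ.measurable_coe .univ).mul ((measurable_const.indicator hs).comp hp)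

theorem lossKernel_apply (κ : Kernel Y X) {p : Y → X} (hp : Measurable p) (y : Y) :
    lossKernel κ hp y = κ y univ • Measure.dirac (p y) := rfl

theorem integral_lossKernel (κ : Kernel Y X) {p : Y → X} (hp : Measurable p) {φ : X → ℝ}
    (hφ : Measurable φ) (y : Y) :
    ∫ z, φ z ∂(lossKernel κ hp y) = (κ y univ).toReal * φ (p y) := by
  rw [lossKernel_apply, integral_smul_measure,
    integral_dirac' _ _ hφ.stronglyMeasurable, smul_eq_mul]

theorem integral_jump_eq {κ : Kernel Y X} {C : ℝ≥0} (hC : ∀ y, κ y univ ≤ C) {φ : X → ℝ}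
    (hφ : Measurable φ) (hB : ∃ B : ℝ, ∀ x, |φ x| ≤ B) (y : Y) (a : X) :
    ∫ z, (φ z - φ a) ∂(κ y) = ∫ z, φ z ∂(κ y) - (κ y univ).toReal * φ a := by
  have := isFiniteKernel_of_le hC
  obtain ⟨B, hB⟩ := hB
  have hi : Integrable φ (κ y) :=
    (integrable_const B).mono' hφ.aestronglyMeasurable (ae_of_all _ hB)
  rw [integral_sub hi (integrable_const _), integral_const, smul_eq_mul, measureReal_def]

/-- The adjoint of the operator `φ ↦ (y ↦ ∫ (φ(z) - φ(p y)) κ(y, dz))`, as a bounded operator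
between `L¹` spaces. -/
theorem exists_jumpAdjoint {ν : Measure X} [IsFiniteMeasure ν] {η : Measure Y}
    {κ : Kernel Y X} {C : ℝ≥0} (hC : ∀ y, κ y univ ≤ C)
    (hκ : ∀ s, MeasurableSet s → ν s = 0 → ∀ᵐ y ∂η, κ y s = 0) {p : Y → X}
    (hp : Measure.QuasiMeasurePreserving p η ν) :
    ∃ G : Lp ℝ 1 η →L[ℝ] Lp ℝ 1 ν,
      ∀ φ : X → ℝ, Measurable φ → (∃ B : ℝ, ∀ x, |φ x| ≤ B) → ∀ F : Lp ℝ 1 η,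
        ∫ y, F y * ∫ z, (φ z - φ (p y)) ∂(κ y) ∂η = ∫ x, G F x * φ x ∂ν := by
  obtain ⟨G₁, h₁⟩ := exists_densityOperator hC hκ
  -- `G₁` is the gain. The loss removes the same mass at the starting point `p y`, and it respects
  -- null sets because `p` is quasi-measure-preserving.
  have hC' : ∀ y, lossKernel κ hp.measurable y univ ≤ C := fun y => by
    simpa [lossKernel_apply] using hC y
  obtain ⟨G₂, h₂⟩ := exists_densityOperator (ν := ν) (η := η) hC' (fun s hs h0 => by
    filter_upwards [measure_eq_zero_iff_ae_notMem.1 (hp.preimage_null h0)] with y hy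
    have hy : p y ∉ s := hy
    simp [lossKernel_apply, Measure.dirac_apply' _ hs, hy])
  refine ⟨G₁ - G₂, fun φ hφ hB F => ?_⟩
  have h3 : ∫ x, (G₁ - G₂) F x * φ x ∂ν = ∫ x, (G₁ F x * φ x - G₂ F x * φ x) ∂ν := by
    refine integral_congr_ae ?_
    filter_upwards [Lp.coeFn_sub (G₁ F) (G₂ F)] with x h
    rw [sub_apply, h, Pi.sub_apply, sub_mul]
  rw [h3, integral_sub (integrable_mul_of_bounded (L1.integrable_coeFn _) hφ hB)
    (integrable_mul_of_bounded (L1.integrable_coeFn _) hφ hB), ← h₁ φ hφ hB, ← h₂ φ hφ hB,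
    ← integral_sub (integrable_mul_integral_kernel hC (L1.integrable_coeFn _) hφ hB)
      (integrable_mul_integral_kernel hC' (L1.integrable_coeFn _) hφ hB)]
  refine integral_congr_ae (ae_of_all _ fun y => ?_)
  simp only
  rw [integral_jump_eq hC hφ hB, integral_lossKernel κ hp.measurable hφ, mul_sub]

theorem kernel_le_toNNReal {Λ : Kernel X X} (h : kernelNorm Λ < ∞) (x : X) :
    Λ x univ ≤ (kernelNorm Λ).toNNReal := by
  rw [ENNReal.coe_toNNReal h.ne]
  exact le_iSup (fun x => Λ x univ) x

theorem isL1Adjoint_adjointGenerator {ν : Measure X} [IsFiniteMeasure ν] {Λ : Kernel X X}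
    (hΛ : kernelNorm Λ < ∞) (hac : ∀ s, MeasurableSet s → ν s = 0 → ∀ᵐ x ∂ν, Λ x s = 0) :
    IsL1Adjoint ν Λ (adjointGenerator ν Λ) := by
  have h : ∃ A, IsL1Adjoint ν Λ A :=
    exists_jumpAdjoint (kernel_le_toNNReal hΛ) hac (Measure.QuasiMeasurePreserving.id ν)
  rw [adjointGenerator, dif_pos h]
  exact Classical.choose_spec h

/-- Duality tested on the indicator of `X × s` gives `∫ Λ(x, s) dν = ∫ₛ Λ'(y, X) dν = 0`. This is
all that the Radon–Nikodym construction needs from an adjoint kernel. -/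
theorem IsAdjointKernel.ae_eq_zero {ν : Measure X} {Λ Λ' : Kernel X X}
    (h : IsAdjointKernel ν Λ Λ') {s : Set X} (hs : MeasurableSet s) (h0 : ν s = 0) :
    ∀ᵐ x ∂ν, Λ x s = 0 := by
  have h1 := h.lintegral_eq (fun p => s.indicator 1 p.2)
    ((measurable_one.indicator hs).comp measurable_snd)
  simp only [lintegral_indicator_one hs, lintegral_const] at h1
  have h2 : ∫⁻ y, s.indicator 1 y * Λ' y univ ∂ν = 0 := by
    refine lintegral_eq_zero_of_ae_eq_zero ?_
    filter_upwards [measure_eq_zero_iff_ae_notMem.1 h0] with y hy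
    simp [hy]
  rwa [h2, lintegral_eq_zero_iff (Λ.measurable_coe hs)] at h1

end Adjoint

/-! ### The averaged nonlinearity as a bounded multilinear map -/

section Calculus

variable {ι E G : Type*} [Fintype ι] [Nonempty ι] [NormedAddCommGroup E] [NormedSpace ℝ E]
  [NormedAddCommGroup G] [NormedSpace ℝ G]

/-- A bounded homogeneous polynomial is Lipschitz on the unit ball, and its first order Taylor
expansion has a quadratic remainder there. -/
theorem exists_diagonal_deriv_bounds (f : ContinuousMultilinearMap ℝ (fun _ : ι => E) G) :
    ∃ L Q : ℝ, 0 ≤ L ∧ 0 ≤ Q ∧ ∃ g' : E → E →L[ℝ] G, Continuous g' ∧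
      (∀ x, ‖x‖ ≤ 1 → ‖f fun _ => x‖ ≤ L * ‖x‖) ∧
      (∀ x, ‖x‖ ≤ 1 → ‖g' x‖ ≤ L) ∧
      ∀ x y, ‖x‖ ≤ 1 → ‖y‖ ≤ 1 → ‖(f fun _ => y) - f fun _ => x‖ ≤ L * ‖y - x‖ ∧
        ‖(f fun _ => y) - (f fun _ => x) - g' x (y - x)‖ ≤ Q * ‖y - x‖ ^ 2 := by
  classical
  -- The diagonal embedding, of norm at most `1` for the sup norm on the product; the polynomial is
  -- `f ∘ D`.
  set D : E →L[ℝ] (ι → E) := ContinuousLinearMap.pi fun _ => ContinuousLinearMap.id ℝ E with hD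
  have hDn : ‖D‖ ≤ 1 := ContinuousLinearMap.opNorm_le_bound _ zero_le_one fun x => by
    rw [one_mul]; exact pi_norm_const_le x
  have hDx : ∀ x : E, ‖D x‖ ≤ ‖x‖ := fun x => pi_norm_const_le x
  have hfd : ContDiff ℝ 2 f := f.contDiff
  have hf'd : ContDiff ℝ 1 (fderiv ℝ f) := hfd.fderiv_right (by norm_num)
  -- With `n` arguments, the first two derivatives of `f` on the unit ball are bounded by `n ‖f‖`
  -- and `n (n - 1) ‖f‖`.
  set L₁ : ℝ := Fintype.card ι * ‖f‖ with hL₁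
  set Q : ℝ := (Fintype.card ι).descFactorial 2 * ‖f‖ with hQ
  have hL₁0 : 0 ≤ L₁ := by positivity
  have hQ0 : 0 ≤ Q := by positivity
  have h1 : ∀ z : ι → E, ‖z‖ ≤ 1 → ‖fderiv ℝ f z‖ ≤ L₁ := fun z hz => by
    have := f.norm_iteratedFDeriv_le 1 z
    rw [norm_iteratedFDeriv_one] at this
    refine this.trans ?_
    rw [Nat.descFactorial_one]
    exact mul_le_of_le_one_right hL₁0 (pow_le_one₀ (norm_nonneg _) hz)
  have h2 : ∀ z : ι → E, ‖z‖ ≤ 1 → ‖fderiv ℝ (fderiv ℝ f) z‖ ≤ Q := fun z hz => by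
    have := f.norm_iteratedFDeriv_le 2 z
    rw [← norm_iteratedFDeriv_fderiv, norm_iteratedFDeriv_one] at this
    exact this.trans (mul_le_of_le_one_right hQ0 (pow_le_one₀ (norm_nonneg _) hz))
  have hball : ∀ z : ι → E, z ∈ Metric.closedBall (0 : ι → E) 1 → ‖z‖ ≤ 1 := fun z hz => by
    simpa using hz
  have h3 : ∀ z ∈ Metric.closedBall (0 : ι → E) 1, ∀ w ∈ Metric.closedBall (0 : ι → E) 1,
      ‖fderiv ℝ f w - fderiv ℝ f z‖ ≤ Q * ‖w - z‖ := fun z hz w hw =>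
    (convex_closedBall (0 : ι → E) 1).norm_image_sub_le_of_norm_fderiv_le
      (fun x _ => (hf'd.differentiable one_ne_zero).differentiableAt)
      (fun x hx => h2 x (hball x hx)) hz hw
  refine ⟨L₁, Q, hL₁0, hQ0, fun x => (fderiv ℝ f (D x)).comp D, ?_, fun x hx => ?_,
    fun x hx => ?_, fun x y hx hy => ⟨?_, ?_⟩⟩
  · exact (hf'd.continuous.comp D.continuous).clm_comp continuous_const
  · have := (convex_closedBall (0 : ι → E) 1).norm_image_sub_le_of_norm_fderiv_le
      (𝕜 := ℝ) (f := f) (C := L₁) (fun x _ => (hfd.differentiable two_ne_zero).differentiableAt)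
      (fun x hx => h1 x (hball x hx)) (x := 0) (y := D x) (by simp)
      (by simpa using (hDx x).trans hx)
    rw [f.map_zero, sub_zero, sub_zero] at this
    exact this.trans (mul_le_mul_of_nonneg_left (hDx x) hL₁0)
  · refine (ContinuousLinearMap.opNorm_comp_le _ _).trans ?_
    exact (mul_le_mul (h1 _ ((hDx x).trans hx)) hDn (norm_nonneg _) hL₁0).trans_eq (mul_one _)
  · have := (convex_closedBall (0 : ι → E) 1).norm_image_sub_le_of_norm_fderiv_le
      (𝕜 := ℝ) (f := f) (C := L₁) (fun x _ => (hfd.differentiable two_ne_zero).differentiableAt)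
      (fun x hx => h1 x (hball x hx)) (x := D x) (y := D y)
      (by simpa using (hDx x).trans hx) (by simpa using (hDx y).trans hy)
    refine this.trans (mul_le_mul_of_nonneg_left ?_ hL₁0)
    rw [← map_sub D]
    exact hDx _
  -- The mean value inequality is used on the segment only: there the derivative differs from the
  -- one at `D x` by at most `Q ‖D y - D x‖`, which produces the square.
  · have hseg : segment ℝ (D x) (D y) ⊆ Metric.closedBall (0 : ι → E) 1 :=
      (convex_closedBall (0 : ι → E) 1).segment_subset
        (by simpa using (hDx x).trans hx) (by simpa using (hDx y).trans hy)
    have := (convex_segment (𝕜 := ℝ) (D x) (D y)).norm_image_sub_le_of_norm_fderiv_le'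
      (𝕜 := ℝ) (f := f) (φ := fderiv ℝ f (D x)) (C := Q * ‖D y - D x‖)
      (fun z _ => (hfd.differentiable two_ne_zero).differentiableAt)
      (fun z hz => (h3 _ (hseg (left_mem_segment ℝ _ _)) _ (hseg hz)).trans (by
        gcongr
        obtain ⟨a, b, ha, hb, hab, rfl⟩ := hz
        have : a • D x + b • D y - D x = b • (D y - D x) := by
          rw [← sub_eq_of_eq_add hab.symm, sub_smul, smul_sub, one_smul]
          abel
        rw [this, norm_smul, Real.norm_eq_abs, abs_of_nonneg hb]
        exact mul_le_of_le_one_left (norm_nonneg _) (by linarith)))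
      (left_mem_segment ℝ _ _) (right_mem_segment ℝ _ _)
    rw [← map_sub D] at this
    refine this.trans ?_
    rw [pow_two, ← mul_assoc]
    have := hDx (y - x)
    gcongr

end Calculus

/-! ### Tensor products of integrable functions -/

section Tensor

open Function in
theorem prod_update_apply {X ι : Type*} [Fintype ι] [DecidableEq ι] (f : ι → X → ℝ) (i : ι)
    (z : X → ℝ) (y : ι → X) :
    ∏ j, update f i z j (y j) = z (y i) * ∏ j ∈ {i}ᶜ, f j (y j) := by
  rw [Fintype.prod_eq_mul_prod_compl i, update_self]
  congr 1
  refine Finset.prod_congr rfl fun j hj => ?_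
  rw [update_of_ne (by simpa using hj)]

variable {X : Type*} [MeasurableSpace X]

theorem coeFn_update {ν : Measure X} {ι : Type*} [DecidableEq ι] (f : ι → Lp ℝ 1 ν) (i : ι)
    (z : Lp ℝ 1 ν) (j : ι) :
    (Function.update f i z j : X → ℝ) = Function.update (fun k => (f k : X → ℝ)) i z j := by
  rcases eq_or_ne j i with rfl | h
  · simp
  · simp [h]

theorem integrable_tensor {ν : Measure X} [SigmaFinite ν] {m : ℕ} (f : Fin m → Lp ℝ 1 ν) :
    Integrable (fun y : Fin m → X => ∏ i, f i (y i)) (Measure.pi fun _ : Fin m => ν) :=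
  Integrable.fintype_prod (𝕜 := ℝ) (μ := fun _ : Fin m => ν) fun i => L1.integrable_coeFn (f i)

/-- The tensor product `(f₁, …, fₘ) ↦ (y ↦ f₁(y₁) ⋯ fₘ(yₘ))` of integrable functions. -/
noncomputable def tensorL1 (ν : Measure X) [SigmaFinite ν] (m : ℕ) :
    ContinuousMultilinearMap ℝ (fun _ : Fin m => Lp ℝ 1 ν)
      (Lp ℝ 1 (Measure.pi fun _ : Fin m => ν)) :=
  MultilinearMap.mkContinuous
    { toFun := fun f =>
        (integrable_tensor f).toL1 _
      map_update_add' := fun f i x y => by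
        rw [← Integrable.toL1_add]
        refine (Integrable.toL1_eq_toL1_iff _ _ _ _).2 ?_
        -- An almost everywhere identity in one variable lifts to the product, since coordinate
        -- projections pull null sets back to null sets.
        filter_upwards [(Measure.quasiMeasurePreserving_eval (fun _ : Fin m => ν) i).ae
          (Lp.coeFn_add x y)] with ω hω
        simp only [coeFn_update, Pi.add_apply]
        rw [prod_update_apply, prod_update_apply, prod_update_apply, ← add_mul]
        congr 1
      map_update_smul' := fun f i c x => by
        rw [← Integrable.toL1_smul]
        refine (Integrable.toL1_eq_toL1_iff _ _ _ _).2 ?_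
        filter_upwards [(Measure.quasiMeasurePreserving_eval (fun _ : Fin m => ν) i).ae
          (Lp.coeFn_smul c x)] with ω hω
        simp only [coeFn_update]
        rw [prod_update_apply, prod_update_apply, smul_eq_mul, ← mul_assoc]
        congr 1 } 1 fun f => by
    rw [one_mul]
    refine (L1.norm_of_fun_eq_integral_norm (integrable_tensor f)).trans_le ?_
    simp only [norm_prod, L1.norm_eq_integral_norm]
    exact (integral_fintype_prod_eq_prod (𝕜 := ℝ) (μ := fun _ : Fin m => ν)
      fun i x => ‖f i x‖).le

theorem coeFn_tensorL1 (ν : Measure X) [SigmaFinite ν] {m : ℕ} (f : Fin m → Lp ℝ 1 ν) :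
    tensorL1 ν m f =ᵐ[Measure.pi fun _ : Fin m => ν] fun y => ∏ i, f i (y i) :=
  (integrable_tensor f).coeFn_toL1

/-- The product of measures with densities has the product density. -/
theorem pi_withDensity_ofReal {ν : Measure X} [SigmaFinite ν] {m : ℕ} {f : X → ℝ}
    (hf : Integrable f ν) (hf0 : 0 ≤ᵐ[ν] f) [SigmaFinite (ν.withDensity fun x => ENNReal.ofReal (f x))] :
    (Measure.pi fun _ : Fin m => ν.withDensity fun x => ENNReal.ofReal (f x)) =
      (Measure.pi fun _ : Fin m => ν).withDensity fun y => ENNReal.ofReal (∏ i, f (y i)) := by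
  refine Measure.pi_eq fun s hs => ?_
  rw [withDensity_apply _ (MeasurableSet.univ_pi hs), ← lintegral_indicator (MeasurableSet.univ_pi hs)]
  have h0 : ∀ᵐ y ∂(Measure.pi fun _ : Fin m => ν), ∀ i, 0 ≤ f (y i) := ae_all_iff.2 fun i =>
    (Measure.quasiMeasurePreserving_eval (fun _ : Fin m => ν) i).ae hf0
  have hint : ∀ i, Integrable ((s i).indicator f) ν := fun i => hf.indicator (hs i)
  have hind : ∀ y : Fin m → X, (univ.pi s).indicator
      (fun y => ENNReal.ofReal (∏ i, f (y i))) y =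
      ENNReal.ofReal (∏ i, (s i).indicator f (y i)) := by
    intro y
    by_cases hy : y ∈ univ.pi s
    · rw [indicator_of_mem hy]
      congr 1
      exact Finset.prod_congr rfl fun i _ => (indicator_of_mem (hy i (mem_univ i)) _).symm
    · rw [indicator_of_notMem hy]
      simp only [mem_univ_pi, not_forall] at hy
      obtain ⟨i, hi⟩ := hy
      rw [Finset.prod_eq_zero (Finset.mem_univ i) (indicator_of_notMem hi _), ENNReal.ofReal_zero]
  simp only [hind]
  rw [← ofReal_integral_eq_lintegral_ofReal
    (Integrable.fintype_prod (𝕜 := ℝ) (μ := fun _ : Fin m => ν) hint) (by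
      filter_upwards [h0] with y hy
      exact Finset.prod_nonneg fun i _ => indicator_apply_nonneg fun _ => hy i),
    integral_fintype_prod_eq_prod (𝕜 := ℝ) (μ := fun _ : Fin m => ν)
      fun i => (s i).indicator f, ENNReal.ofReal_prod_of_nonneg fun i _ => integral_nonneg_of_ae ?_]
  · refine Finset.prod_congr rfl fun i _ => ?_
    rw [withDensity_apply _ (hs i), integral_indicator (hs i),
      ofReal_integral_eq_lintegral_ofReal hf.integrableOn (ae_restrict_of_ae hf0)]
  · filter_upwards [hf0] with x hx
    exact indicator_apply_nonneg fun _ => hx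

end Tensor

/-! ### Averaging the jump kernel over the other particles -/

section Averaged

variable {X : Type*} [MeasurableSpace X] {N : ℕ}

/-- The jump kernel of one particle when the others are at the positions `y`. -/
noncomputable def EmpiricalJumpKernel.at (Λ : EmpiricalJumpKernel X N) (y : Fin (N - 1) → X) : Kernel X X :=
  Λ ⟨empiricalMeasure y, mem_range_self y⟩

/-- The jump kernel as a kernel on the configurations of all particles. -/
noncomputable def EmpiricalJumpKernel.config (Λ : EmpiricalJumpKernel X N) :
    Kernel (X × (Fin (N - 1) → X)) X where
  toFun p := Λ.at p.2 p.1
  measurable' := Λ.measurable_joint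

theorem EmpiricalJumpKernel.at_le {Λ : EmpiricalJumpKernel X N} (h : uniformIntensity Λ < ∞)
    (y : Fin (N - 1) → X) (x : X) : Λ.at y x univ ≤ (uniformIntensity Λ).toNNReal := by
  rw [ENNReal.coe_toNNReal h.ne]
  exact (le_iSup (fun x => Λ.at y x univ) x).trans
    (le_iSup (fun μ => kernelNorm (Λ μ)) ⟨empiricalMeasure y, mem_range_self y⟩)

theorem EmpiricalJumpKernel.averaged_apply (Λ : EmpiricalJumpKernel X N)
    (ρ : ProbabilityMeasure X) (x : X) : Λ.averaged ρ x =
      Λ.config.comap (fun y => (x, y)) measurable_prodMk_left ∘ₘ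
        (Measure.pi fun _ : Fin (N - 1) => (ρ : Measure X)) := rfl

theorem EmpiricalJumpKernel.averaged_apply' (Λ : EmpiricalJumpKernel X N)
    (ρ : ProbabilityMeasure X) (x : X) {s : Set X} (hs : MeasurableSet s) : Λ.averaged ρ x s =
      ∫⁻ y, Λ.at y x s ∂(Measure.pi fun _ : Fin (N - 1) => (ρ : Measure X)) := by
  rw [averaged_apply, Measure.bind_apply hs (Kernel.aemeasurable _)]
  rfl

theorem EmpiricalJumpKernel.averaged_le {Λ : EmpiricalJumpKernel X N}
    (h : uniformIntensity Λ < ∞) (ρ : ProbabilityMeasure X) (x : X) :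
    Λ.averaged ρ x univ ≤ (uniformIntensity Λ).toNNReal := by
  rw [averaged_apply' _ _ _ .univ]
  exact (lintegral_mono fun y => at_le h y x).trans (by simp)

/-- Tonelli with the configuration as outer variable: an adjoint kernel is used for one fixed
configuration at a time, so no measurable dependence of the adjoint kernels is required. -/
theorem EmpiricalJumpKernel.ae_prod_eq_zero {Λ : EmpiricalJumpKernel X N} {ν : Measure X}
    [SFinite ν] (h : Λ.BoundedIntensity ν) (π : Measure (Fin (N - 1) → X)) [SFinite π]
    {s : Set X} (hs : MeasurableSet s) (h0 : ν s = 0) :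
    ∀ᵐ p ∂(ν.prod π), Λ.config p s = 0 := by
  have hm := Λ.config.measurable_coe hs
  have h1 : ∫⁻ p, Λ.config p s ∂(ν.prod π) = 0 := by
    rw [lintegral_prod_symm' _ hm]
    refine lintegral_eq_zero_of_ae_eq_zero (ae_of_all _ fun y => ?_)
    obtain ⟨Λ', hΛ'⟩ := h.adjoint ⟨empiricalMeasure y, mem_range_self y⟩
    exact lintegral_eq_zero_of_ae_eq_zero (hΛ'.ae_eq_zero hs h0)
  exact (lintegral_eq_zero_iff hm).1 h1

/-- Gives the averaged generator an `L¹` adjoint without averaging the adjoint kernels. -/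
theorem EmpiricalJumpKernel.averaged_ae_eq_zero {Λ : EmpiricalJumpKernel X N} {ν : Measure X}
    [SFinite ν] (h : Λ.BoundedIntensity ν) (ρ : ProbabilityMeasure X)
    {s : Set X} (hs : MeasurableSet s) (h0 : ν s = 0) : ∀ᵐ x ∂ν, Λ.averaged ρ x s = 0 := by
  filter_upwards [Measure.ae_ae_of_ae_prod (ae_prod_eq_zero h
    (Measure.pi fun _ : Fin (N - 1) => (ρ : Measure X)) hs h0)] with x hx
  rw [averaged_apply' _ _ _ hs]
  exact lintegral_eq_zero_of_ae_eq_zero hx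

theorem EmpiricalJumpKernel.isL1Adjoint_averaged {Λ : EmpiricalJumpKernel X N} {ν : Measure X}
    [IsFiniteMeasure ν] (h : Λ.BoundedIntensity ν) (ρ : ProbabilityMeasure X) :
    IsL1Adjoint ν (Λ.averaged ρ) (adjointGenerator ν (Λ.averaged ρ)) :=
  isL1Adjoint_adjointGenerator
    ((iSup_le fun x => averaged_le h.uniform ρ x).trans_lt ENNReal.coe_lt_top)
    fun _ hs h0 => averaged_ae_eq_zero h ρ hs h0

theorem EmpiricalJumpKernel.isL1Adjoint {Λ : EmpiricalJumpKernel X N} {ν : Measure X}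
    [IsFiniteMeasure ν] (h : Λ.BoundedIntensity ν) (μ : empiricalMeasures X N) :
    IsL1Adjoint ν (Λ μ) (adjointGenerator ν (Λ μ)) :=
  isL1Adjoint_adjointGenerator (Λ.bounded μ) fun _ hs h0 =>
    let ⟨_, hΛ'⟩ := h.adjoint μ
    hΛ'.ae_eq_zero hs h0

theorem EmpiricalJumpKernel.jumpGenerator_averaged {Λ : EmpiricalJumpKernel X N}
    (h : uniformIntensity Λ < ∞) (ρ : ProbabilityMeasure X) {φ : X → ℝ} (hφ : Measurable φ)
    (hB : ∃ B : ℝ, ∀ x, |φ x| ≤ B) (x : X) : jumpGenerator (Λ.averaged ρ) φ x =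
      ∫ y, jumpGenerator (Λ.at y) φ x ∂(Measure.pi fun _ : Fin (N - 1) => (ρ : Measure X)) := by
  have hfin : IsFiniteMeasure (Λ.averaged ρ x) :=
    ⟨(averaged_le h ρ x).trans_lt ENNReal.coe_lt_top⟩
  obtain ⟨B, hB⟩ := hB
  have hint : Integrable (fun z => φ z - φ x) (Λ.averaged ρ x) :=
    ((integrable_const B).mono' hφ.aestronglyMeasurable (ae_of_all _ hB)).sub
      (integrable_const _)
  rw [jumpGenerator]
  rw [averaged_apply, Measure.comp_eq_comp_const_apply] at hint ⊢
  rw [Kernel.integral_comp hint]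
  rfl

section Jump

variable {Y : Type*} [MeasurableSpace Y]

theorem measurable_jump {κ : Kernel Y X} {C : ℝ≥0} (hC : ∀ y, κ y univ ≤ C) {φ : X → ℝ}
    (hφ : Measurable φ) (hB : ∃ B : ℝ, ∀ x, |φ x| ≤ B) {p : Y → X} (hp : Measurable p) :
    Measurable fun y => ∫ z, (φ z - φ (p y)) ∂(κ y) := by
  simp only [integral_jump_eq hC hφ hB]
  exact (measurable_integral_kernel hC hφ).sub
    ((κ.measurable_coe .univ).ennreal_toReal.mul (hφ.comp hp))

theorem exists_abs_jump_le {κ : Kernel Y X} {C : ℝ≥0} (hC : ∀ y, κ y univ ≤ C) {φ : X → ℝ}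
    (hB : ∃ B : ℝ, ∀ x, |φ x| ≤ B) (p : Y → X) :
    ∃ B : ℝ, ∀ y, |∫ z, (φ z - φ (p y)) ∂(κ y)| ≤ B := by
  obtain ⟨B, hB⟩ := hB
  refine ⟨(2 * max B 0) * C, fun y => abs_integral_kernel_le hC (by positivity) (fun z => ?_) y⟩
  rw [two_mul]
  exact (abs_sub _ _).trans (add_le_add ((hB z).trans (le_max_left _ _))
    ((hB _).trans (le_max_left _ _)))

end Jump

/-- The averaged nonlinearity extends to a bounded multilinear map on `L¹(ν)`. -/
theorem EmpiricalJumpKernel.exists_multilinear {Λ : EmpiricalJumpKernel X N} {ν : Measure X}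
    [IsFiniteMeasure ν] (h : Λ.BoundedIntensity ν) :
    ∃ 𝓑 : ContinuousMultilinearMap ℝ (fun _ : Fin (N - 1 + 1) => Lp ℝ 1 ν) (Lp ℝ 1 ν),
      ∀ (ρ : ProbDensity ν) (σ : Lp ℝ 1 ν), 𝓑 (Fin.cons σ fun _ => ρ.toL1) =
        adjointGenerator ν (Λ.averaged ρ.law) σ := by
  set π := Measure.pi fun _ : Fin (N - 1) => ν with hπ
  -- Coordinate `0` is the jumping particle and the remaining `N - 1` coordinates are the particles
  -- that determine its kernel.
  set e := MeasurableEquiv.piFinSuccAbove (fun _ : Fin (N - 1 + 1) => X) 0 with he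
  have hmp : MeasurePreserving e (Measure.pi fun _ => ν) (ν.prod π) :=
    measurePreserving_piFinSuccAbove (fun _ => ν) 0
  have he' : ∀ y, e y = (y 0, fun j => y j.succ) := fun y => rfl
  have hM := h.uniform
  have hC : ∀ p, Λ.config p univ ≤ (uniformIntensity Λ).toNNReal := fun p => at_le hM p.2 p.1
  obtain ⟨J, hJ⟩ := exists_jumpAdjoint (ν := ν) (η := Measure.pi fun _ : Fin (N - 1 + 1) => ν)
    (κ := Λ.config.comap e e.measurable) (C := (uniformIntensity Λ).toNNReal)
    (fun y => hC (e y))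
    (fun s hs h0 => hmp.quasiMeasurePreserving.ae (ae_prod_eq_zero h π hs h0))
    (p := fun y => y 0) (Measure.quasiMeasurePreserving_eval (fun _ => ν) 0)
  -- Multilinearity comes from the tensor product alone, since `J` is linear. It remains to identify
  -- the values by pairing with `φ`, where both sides become the integral of `σ ⊗ ρ ⊗ ⋯ ⊗ ρ` against
  -- `H`.
  refine ⟨J.compContinuousMultilinearMap (tensorL1 ν _), fun ρ σ =>
    Lp_eq_of_forall_integral_mul_eq fun φ hφ hB => ?_⟩
  set H : X × (Fin (N - 1) → X) → ℝ := fun p => ∫ z, (φ z - φ p.1) ∂(Λ.config p) with hH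
  have hHm : Measurable H := measurable_jump hC hφ hB measurable_fst
  have hHb : ∃ B, ∀ p, |H p| ≤ B := exists_abs_jump_le hC hB Prod.fst
  have hρ0 : 0 ≤ᵐ[ν] ρ.toL1 := (Lp.coeFn_nonneg _).2 ρ.2.1
  have hlaw : (Measure.pi fun _ : Fin (N - 1) => (ρ.law : Measure X)) =
      π.withDensity fun y => ENNReal.ofReal (∏ i, ρ.toL1 (y i)) :=
    have : SigmaFinite (ν.withDensity fun x => ENNReal.ofReal (ρ.toL1 x)) :=
      inferInstanceAs (SigmaFinite (ρ.law : Measure X))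
    pi_withDensity_ofReal (L1.integrable_coeFn ρ.toL1) hρ0
  rw [← isL1Adjoint_averaged h ρ.law φ hφ hB σ, ContinuousLinearMap.compContinuousMultilinearMap_coe,
    Function.comp_apply, ← hJ φ hφ hB]
  have h1 : ∫ y, tensorL1 ν (N - 1 + 1) (Fin.cons σ fun _ => ρ.toL1) y *
      ∫ z, (φ z - φ (y 0)) ∂(Λ.config.comap e e.measurable y) ∂(Measure.pi fun _ => ν) =
      ∫ p, σ p.1 * (∏ i, ρ.toL1 (p.2 i)) * H p ∂(ν.prod π) := by
    rw [← hmp.integral_comp']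
    refine integral_congr_ae ?_
    filter_upwards [coeFn_tensorL1 ν (Fin.cons σ fun _ => ρ.toL1)] with y hy
    rw [hy, Fin.prod_univ_succ, Kernel.comap_apply, hH]
    simp only [he', Fin.cons_zero, Fin.cons_succ]
  have hint : Integrable (fun p : X × (Fin (N - 1) → X) =>
      σ p.1 * (∏ i, ρ.toL1 (p.2 i)) * H p) (ν.prod π) :=
    integrable_mul_of_bounded ((L1.integrable_coeFn σ).mul_prod
      (integrable_tensor fun _ => ρ.toL1)) hHm hHb
  rw [h1, integral_prod _ hint]
  refine integral_congr_ae (ae_of_all _ fun x => ?_)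
  simp only [mul_assoc]
  rw [integral_const_mul, jumpGenerator_averaged hM _ hφ hB, hlaw,
    integral_withDensity_eq_integral_toReal_smul₀ (by
      exact (integrable_tensor fun _ => ρ.toL1).aestronglyMeasurable.aemeasurable.ennreal_ofReal)
      (by simp)]
  congr 1
  refine integral_congr_ae ?_
  have h0 : ∀ᵐ y ∂π, ∀ i, 0 ≤ ρ.toL1 (y i) := ae_all_iff.2 fun i =>
    (Measure.quasiMeasurePreserving_eval (fun _ : Fin (N - 1) => ν) i).ae hρ0
  filter_upwards [h0] with y hy
  rw [ENNReal.toReal_ofReal (Finset.prod_nonneg fun i _ => hy i), smul_eq_mul]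
  rfl

end Averaged

/-! ### Order structure of `L¹` and positivity -/

section Positivity

variable {X : Type*} [MeasurableSpace X] {ν : Measure X}

theorem isOrderedModule_L1 : IsOrderedModule ℝ (Lp ℝ 1 ν) := by
  have : PosSMulMono ℝ (Lp ℝ 1 ν) := ⟨fun c hc f g hfg => by
    rw [← Lp.coeFn_le] at hfg ⊢
    filter_upwards [hfg, Lp.coeFn_smul c f, Lp.coeFn_smul c g] with x h h1 h2
    rw [h1, h2]
    exact mul_le_mul_of_nonneg_left h hc⟩
  have : SMulPosMono ℝ (Lp ℝ 1 ν) := ⟨fun f hf c d hcd => by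
    rw [← Lp.coeFn_nonneg] at hf
    rw [← Lp.coeFn_le]
    filter_upwards [hf, Lp.coeFn_smul c f, Lp.coeFn_smul d f] with x h h1 h2
    rw [h1, h2]
    exact mul_le_mul_of_nonneg_right hcd h⟩
  exact {}

theorem smul_nonneg_L1 {c : ℝ} (hc : 0 ≤ c) {f : Lp ℝ 1 ν} (hf : 0 ≤ f) : 0 ≤ c • f :=
  have := isOrderedModule_L1 (ν := ν)
  smul_nonneg hc hf

theorem intervalIntegral_nonneg_L1 {f : ℝ → Lp ℝ 1 ν} {t : ℝ} (ht : 0 ≤ t)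
    (hf : ∀ s ∈ Icc 0 t, 0 ≤ f s) : 0 ≤ ∫ s in (0 : ℝ)..t, f s := by
  have := isOrderedModule_L1 (ν := ν)
  rw [intervalIntegral.integral_of_le ht]
  refine integral_nonneg_of_ae ?_
  filter_upwards [ae_restrict_mem measurableSet_Ioc] with s hs
  exact hf s (Ioc_subset_Icc_self hs)

/-- The total mass as a bounded linear functional on `L¹`. -/
noncomputable def mass (ν : Measure X) : Lp ℝ 1 ν →L[ℝ] ℝ := L1.integralCLM

theorem mass_apply (f : Lp ℝ 1 ν) : mass ν f = ∫ x, f x ∂ν := by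
  rw [mass, ← L1.integral_eq, L1.integral_eq_integral]

theorem norm_eq_mass {f : Lp ℝ 1 ν} (hf : 0 ≤ f) : ‖f‖ = mass ν f := by
  rw [mass_apply, L1.norm_eq_integral_norm]
  refine integral_congr_ae ?_
  filter_upwards [(Lp.coeFn_nonneg f).2 hf] with x hx
  exact abs_of_nonneg hx

theorem mass_posPart_add_mass_negPart (f : Lp ℝ 1 ν) : mass ν f⁺ + mass ν f⁻ = ‖f‖ := by
  rw [← map_add, posPart_add_negPart, ← norm_eq_mass (abs_nonneg f), norm_abs_eq_norm]

/-- The hypotheses say `f⁻ ≤ g`, and the norm is monotone on the positive cone. -/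
theorem norm_negPart_le_of_neg_le {f g : Lp ℝ 1 ν} (hg : 0 ≤ g) (h : -g ≤ f) : ‖f⁻‖ ≤ ‖g‖ := by
  refine norm_le_norm_of_abs_le_abs ?_
  rw [abs_of_nonneg (negPart_nonneg f), abs_of_nonneg hg]
  exact sup_le (neg_le.1 h) hg

theorem Lp_nonneg_of_forall_setIntegral_nonneg {f : Lp ℝ 1 ν}
    (h : ∀ s, MeasurableSet s → 0 ≤ ∫ x in s, f x ∂ν) : 0 ≤ f :=
  (Lp.coeFn_nonneg f).1 (ae_nonneg_of_forall_setIntegral_nonneg (L1.integrable_coeFn f)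
    fun s hs _ => h s hs)

/-- An adjoint Markov semigroup is a contraction semigroup. -/
def AdjointMarkovSemigroup.toContraction (S : AdjointMarkovSemigroup ν) :
    ContractionSemigroup (Lp ℝ 1 ν) where
  toFun := S
  toFun_zero x := by rw [S.toFun_zero]; rfl
  toFun_add s t hs ht x := by rw [S.toFun_add s t hs ht]; rfl
  tendsto_zero := S.tendsto_zero
  norm_le t ht x := by
    -- On the positive cone the norm is the mass, which is conserved; the contraction property
    -- follows by splitting into positive and negative parts.
    have hm : ∀ f : Lp ℝ 1 ν, 0 ≤ f → ‖S t f‖ = MeanField.mass ν f := fun f hf => by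
      rw [norm_eq_mass (S.nonneg t ht f hf), mass_apply, mass_apply, S.mass t ht]
    calc ‖S t x‖ = ‖S t x⁺ - S t x⁻‖ := by rw [← map_sub, posPart_sub_negPart]
      _ ≤ ‖S t x⁺‖ + ‖S t x⁻‖ := norm_sub_le _ _
      _ = ‖x‖ := by
        rw [hm _ (posPart_nonneg x), hm _ (negPart_nonneg x), mass_posPart_add_mass_negPart]

theorem AdjointMarkovSemigroup.toContraction_apply (S : AdjointMarkovSemigroup ν) (t : ℝ)
    (x : Lp ℝ 1 ν) : S.toContraction t x = S t x := rfl

theorem AdjointMarkovSemigroup.duhamel_nonneg (S : AdjointMarkovSemigroup ν) {f : ℝ → Lp ℝ 1 ν}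
    {t : ℝ} (ht : 0 ≤ t) (hf : ∀ s ∈ Icc 0 t, 0 ≤ f s) : 0 ≤ S.toContraction.duhamel f t :=
  intervalIntegral_nonneg_L1 ht fun s hs => S.nonneg _ (sub_nonneg.2 hs.2) _ (hf s hs)

theorem AdjointMarkovSemigroup.mass_duhamel (S : AdjointMarkovSemigroup ν) {f : ℝ → Lp ℝ 1 ν}
    {t : ℝ} (ht : 0 ≤ t) (hf : Continuous f) :
    MeanField.mass ν (S.toContraction.duhamel f t) =
      ∫ s in (0 : ℝ)..t, MeanField.mass ν (f s) := by
  rw [ContractionSemigroup.duhamel, ← ContinuousLinearMap.intervalIntegral_comp_comm _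
    (S.toContraction.intervalIntegrable_integrand ht hf.continuousOn)]
  refine intervalIntegral.integral_congr fun s hs => ?_
  rw [uIcc_of_le ht] at hs
  rw [toContraction_apply, mass_apply, S.mass _ (sub_nonneg.2 hs.2), mass_apply]

/-- The negative part of a mild solution is controlled by those of the datum and the forcing. -/
theorem AdjointMarkovSemigroup.norm_negPart_le (S : AdjointMarkovSemigroup ν)
    {g z : ℝ → Lp ℝ 1 ν} (hg : Continuous g) (hz : S.toContraction.IsMild g z) (h0 : 0 ≤ z 0)
    {t : ℝ} (ht : 0 ≤ t) : ‖(z t)⁻‖ ≤ ∫ s in (0 : ℝ)..t, ‖(g s)⁻‖ := by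
  have hgn : Continuous fun s => (g s)⁻ := continuous_negPart.comp hg
  have hd := S.duhamel_nonneg ht (f := fun s => (g s)⁻) fun s _ => negPart_nonneg _
  refine (norm_negPart_le_of_neg_le hd ?_).trans
    (S.toContraction.norm_duhamel_le ht (hgn.norm.intervalIntegrable _ _) fun s _ => le_rfl)
  -- Adding the Duhamel integral of `g⁻` to `z t` leaves only nonnegative terms, so that integral
  -- dominates `(z t)⁻`.
  have h1 : 0 ≤ S.toContraction.duhamel (fun s => g s + (g s)⁻) t :=
    S.duhamel_nonneg ht fun s _ => by
      rw [← neg_le_iff_add_nonneg, neg_le]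
      exact neg_le_negPart (g s)
  rw [S.toContraction.duhamel_add hg hgn ht] at h1
  rw [hz t ht, neg_le_iff_add_nonneg, add_assoc]
  exact add_nonneg (S.nonneg t ht _ h0) h1

/-- Positivity of mild solutions of linear equations with quasi-positive, mass preserving
right-hand side and nonnegative forcing. -/
theorem AdjointMarkovSemigroup.nonneg_of_isMild (S : AdjointMarkovSemigroup ν)
    {A : ℝ → Lp ℝ 1 ν →L[ℝ] Lp ℝ 1 ν} {r w : ℝ → Lp ℝ 1 ν} {c : ℝ} (hc : 0 ≤ c)
    (hA : ∀ t, 0 ≤ t → ∀ f, 0 ≤ f → 0 ≤ A t f + c • f)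
    (hA0 : ∀ t, 0 ≤ t → ∀ f, MeanField.mass ν (A t f) = 0) (hr : ∀ t, 0 ≤ t → 0 ≤ r t)
    {g : ℝ → Lp ℝ 1 ν} (hg : Continuous g) (hgA : ∀ t, 0 ≤ t → g t = A t (w t) + r t)
    (hwc : Continuous w) (hw : S.toContraction.IsMild g w)
    (h0 : 0 ≤ w 0) {t : ℝ} (ht : 0 ≤ t) : 0 ≤ w t := by
  have he : ∀ t : ℝ, HasDerivAt (fun t => Real.exp (c * t)) (c * Real.exp (c * t)) t := fun t => by
    have := ((hasDerivAt_id t).const_mul c).exp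
    simpa [mul_comm] using this
  -- Multiplication by `exp (c t)` replaces `A` by `A + c`, which is positive.
  have hz := hw.smul hg he (by fun_prop)
  set z : ℝ → Lp ℝ 1 ν := fun s => Real.exp (c * s) • w s with hzd
  have hzc : Continuous z := (by fun_prop : Continuous fun s => Real.exp (c * s)).smul hwc
  have hgc : Continuous fun s => Real.exp (c * s) • g s + (c * Real.exp (c * s)) • w s :=
    ((by fun_prop : Continuous fun s => Real.exp (c * s)).smul hg).add
      ((by fun_prop : Continuous fun s => c * Real.exp (c * s)).smul hwc)
  have hforce : ∀ s, 0 ≤ s →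
      ‖(Real.exp (c * s) • g s + (c * Real.exp (c * s)) • w s)⁻‖ ≤ c * ‖(z s)⁻‖ := by
    intro s hs
    have hn : 0 ≤ (z s)⁻ := negPart_nonneg _
    have hB := hA s hs _ hn
    -- For a positive image the norm is the mass; `A` contributes none, so the norm is exactly
    -- multiplied by `c`.
    have h1 : ‖A s (z s)⁻ + c • (z s)⁻‖ = c * ‖(z s)⁻‖ := by
      rw [norm_eq_mass hB, map_add, hA0 s hs, zero_add, map_smul, norm_eq_mass hn, smul_eq_mul]
    rw [← h1]
    refine norm_negPart_le_of_neg_le hB ?_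
    have h2 : Real.exp (c * s) • g s + (c * Real.exp (c * s)) • w s =
        A s (z s) + c • z s + Real.exp (c * s) • r s := by
      rw [hgA s hs, hzd]
      simp only [map_smul, smul_add, smul_smul]
      abel
    have h3 : 0 ≤ A s (z s)⁺ + c • (z s)⁺ := hA s hs _ (posPart_nonneg _)
    have h4 : 0 ≤ Real.exp (c * s) • r s := smul_nonneg_L1 (Real.exp_nonneg _) (hr s hs)
    -- Only the image of `(z s)⁻` can make the forcing negative. Its negative part is therefore at
    -- most `c ‖(z s)⁻‖` in norm, which closes a Grönwall inequality with zero initial term.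
    have h5 : A s (z s) + c • z s = (A s (z s)⁺ + c • (z s)⁺) - (A s (z s)⁻ + c • (z s)⁻) := by
      conv_lhs => rw [← posPart_sub_negPart (z s)]
      rw [map_sub, smul_sub]
      abel
    rw [h2, h5, neg_le_iff_add_nonneg]
    have : A s (z s)⁺ + c • (z s)⁺ - (A s (z s)⁻ + c • (z s)⁻) + Real.exp (c * s) • r s +
        (A s (z s)⁻ + c • (z s)⁻) = (A s (z s)⁺ + c • (z s)⁺) + Real.exp (c * s) • r s := by abel
    rw [this]
    exact add_nonneg h3 h4
  have hz0 : 0 ≤ z 0 := smul_nonneg_L1 (Real.exp_nonneg _) h0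
  have hzn : Continuous fun s => ‖(z s)⁻‖ := (continuous_negPart.comp hzc).norm
  have hneg := le_mul_exp_of_le_add_integral (φ := fun s => ‖(z s)⁻‖) (a := 0) (L := c) (T := t)
    hzn.continuousOn hc (fun s hs => by
      rw [zero_add, ← intervalIntegral.integral_const_mul]
      refine (S.norm_negPart_le hgc hz hz0 hs.1).trans ?_
      refine intervalIntegral.integral_mono_on hs.1
        ((continuous_negPart.comp hgc).norm.intervalIntegrable _ _)
        ((hzn.const_mul c).intervalIntegrable _ _) fun r hr => hforce r hr.1) t ⟨ht, le_rfl⟩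
  rw [zero_mul] at hneg
  have hz_nonneg : 0 ≤ z t := negPart_eq_zero.1 (norm_le_zero_iff.1 hneg)
  have : w t = Real.exp (-(c * t)) • z t := by
    rw [hzd]
    simp only
    rw [smul_smul, ← Real.exp_add, neg_add_cancel, Real.exp_zero, one_smul]
  rw [this]
  exact smul_nonneg_L1 (Real.exp_nonneg _) hz_nonneg

theorem jumpGenerator_indicator {Λ : Kernel X X} {C : ℝ≥0} (hC : ∀ x, Λ x univ ≤ C) {s : Set X}
    (hs : MeasurableSet s) (x : X) : jumpGenerator Λ (s.indicator fun _ => 1) x =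
      (Λ x s).toReal - (Λ x univ).toReal * s.indicator (fun _ => 1) x := by
  rw [jumpGenerator, integral_jump_eq hC (measurable_const.indicator hs) ⟨1, fun x => by
    by_cases hx : x ∈ s <;> simp [hx]⟩, integral_indicator hs]
  simp [measureReal_def]

theorem IsL1Adjoint.setIntegral_eq {Λ : Kernel X X} {A : Lp ℝ 1 ν →L[ℝ] Lp ℝ 1 ν}
    (hA : IsL1Adjoint ν Λ A) {s : Set X} (hs : MeasurableSet s) (σ : Lp ℝ 1 ν) :
    ∫ x in s, (A σ) x ∂ν = ∫ x, σ x * jumpGenerator Λ (s.indicator fun _ => 1) x ∂ν := by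
  rw [hA _ (measurable_const.indicator hs) ⟨1, fun x => by by_cases hx : x ∈ s <;> simp [hx]⟩,
    ← integral_indicator hs]
  simp only [← indicator_mul_right, mul_one]

theorem IsL1Adjoint.mass_eq_zero {Λ : Kernel X X} {A : Lp ℝ 1 ν →L[ℝ] Lp ℝ 1 ν}
    (hA : IsL1Adjoint ν Λ A) (σ : Lp ℝ 1 ν) : mass ν (A σ) = 0 := by
  have := hA (fun _ => 1) measurable_const ⟨1, fun _ => by simp⟩ σ
  simp only [jumpGenerator, sub_self, integral_zero, mul_zero, mul_one] at this
  rw [mass_apply, ← this]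

/-- The gain is nonnegative and the loss rate is at most `C`. Tested on a set `s`, this reads `Λ(x,
s) - Λ(x, X) 1ₛ(x) ≥ -C 1ₛ(x)`. -/
theorem IsL1Adjoint.add_smul_nonneg {Λ : Kernel X X} {A : Lp ℝ 1 ν →L[ℝ] Lp ℝ 1 ν}
    (hA : IsL1Adjoint ν Λ A) {C : ℝ≥0} (hC : ∀ x, Λ x univ ≤ C) {σ : Lp ℝ 1 ν} (hσ : 0 ≤ σ) :
    0 ≤ A σ + (C : ℝ) • σ := by
  refine Lp_nonneg_of_forall_setIntegral_nonneg fun s hs => ?_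
  have hσi := L1.integrable_coeFn σ
  have hb : ∃ B : ℝ, ∀ x, |s.indicator (fun _ => (1 : ℝ)) x| ≤ B :=
    ⟨1, fun x => by by_cases hx : x ∈ s <;> simp [hx]⟩
  have hm : Measurable (s.indicator fun _ => (1 : ℝ)) := measurable_const.indicator hs
  have hjm : Measurable (jumpGenerator Λ (s.indicator fun _ => 1)) :=
    measurable_jump hC hm hb measurable_id
  have hjb : ∃ B : ℝ, ∀ x, |jumpGenerator Λ (s.indicator fun _ => 1) x| ≤ B :=
    exists_abs_jump_le hC hb id
  have h1 : ∫ x in s, (A σ + (C : ℝ) • σ : Lp ℝ 1 ν) x ∂ν =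
      ∫ x in s, ((A σ) x + C * σ x) ∂ν := by
    refine integral_congr_ae (ae_restrict_of_ae ?_)
    filter_upwards [Lp.coeFn_add (A σ) ((C : ℝ) • σ), Lp.coeFn_smul (C : ℝ) σ] with x h2 h3
    rw [h2, Pi.add_apply, h3, Pi.smul_apply, smul_eq_mul]
  rw [h1, integral_add (L1.integrable_coeFn _).integrableOn (hσi.const_mul _).integrableOn,
    hA.setIntegral_eq hs, ← integral_indicator hs (f := fun x => (C : ℝ) * σ x),
    ← integral_add (integrable_mul_of_bounded hσi hjm hjb) ((hσi.const_mul _).indicator hs)]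
  refine integral_nonneg_of_ae ?_
  filter_upwards [(Lp.coeFn_nonneg σ).2 hσ] with x hx
  have hx : 0 ≤ σ x := hx
  rw [Pi.zero_apply, jumpGenerator_indicator hC hs]
  have hle : (Λ x univ).toReal ≤ C := ENNReal.toReal_le_of_le_ofReal C.2 (by simpa using hC x)
  by_cases hxs : x ∈ s
  · simp only [indicator_of_mem hxs, mul_one]
    have h2 : 0 ≤ σ x * (Λ x s).toReal := mul_nonneg hx ENNReal.toReal_nonneg
    nlinarith [mul_le_mul_of_nonneg_left hle hx]
  · simp only [indicator_of_notMem hxs, mul_zero, sub_zero, add_zero]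
    exact mul_nonneg hx ENNReal.toReal_nonneg

end Positivity

/-! ### Well-posedness and regularity -/

section WellPosed

variable {X : Type*} [MeasurableSpace X] {ν : Measure X} {N : ℕ}

theorem ProbDensity.ext {ρ σ : ProbDensity ν} (h : ρ.toL1 = σ.toL1) : ρ = σ := Subtype.ext h

theorem ProbDensity.nonneg (ρ : ProbDensity ν) : 0 ≤ ρ.toL1 := ρ.2.1

theorem ProbDensity.mass_eq_one (ρ : ProbDensity ν) : mass ν ρ.toL1 = 1 := by
  rw [mass_apply]; exact ρ.2.2

theorem ProbDensity.norm_eq_one (ρ : ProbDensity ν) : ‖ρ.toL1‖ = 1 := by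
  rw [norm_eq_mass ρ.nonneg, ρ.mass_eq_one]

/-- `𝓑` extends `(σ, ρ) ↦ 𝒜̄*(σ; ρ)` to a bounded multilinear map. -/
def IsMultilinearExtension (Λ : EmpiricalJumpKernel X N)
    (𝓑 : ContinuousMultilinearMap ℝ (fun _ : Fin (N - 1 + 1) => Lp ℝ 1 ν) (Lp ℝ 1 ν)) : Prop :=
  ∀ (ρ : ProbDensity ν) (σ : Lp ℝ 1 ν), 𝓑 (Fin.cons σ fun _ => ρ.toL1) =
    adjointGenerator ν (Λ.averaged ρ.law) σ

variable {Λ : EmpiricalJumpKernel X N}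
  {𝓑 : ContinuousMultilinearMap ℝ (fun _ : Fin (N - 1 + 1) => Lp ℝ 1 ν) (Lp ℝ 1 ν)}

theorem IsMultilinearExtension.averagedField_eq (h𝓑 : IsMultilinearExtension Λ 𝓑)
    (ρ : ProbDensity ν) : averagedField Λ ρ = 𝓑 fun _ => ρ.toL1 := by
  rw [averagedField, ← h𝓑 ρ]
  congr 1
  funext i
  refine Fin.cases ?_ (fun j => ?_) i <;> simp

theorem IsMultilinearExtension.isMildSolution (h𝓑 : IsMultilinearExtension Λ 𝓑)
    {S : AdjointMarkovSemigroup ν} {ρ₀ : ProbDensity ν} {u : ℝ → Lp ℝ 1 ν} (huc : Continuous u)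
    (hu : S.toContraction.IsMild (fun s => 𝓑 fun _ => u s) u) (hu0 : u 0 = ρ₀.toL1)
    {ρ : ℝ → ProbDensity ν} (hρ : ∀ t, 0 ≤ t → (ρ t).toL1 = u t) : IsMildSolution S Λ ρ₀ ρ := by
  have hbc : Continuous fun s => 𝓑 fun _ => u s :=
    𝓑.cont.comp (continuous_pi fun _ => huc)
  have hf : ∀ s, 0 ≤ s → averagedField Λ (ρ s) = 𝓑 fun _ => u s := fun s hs => by
    rw [h𝓑.averagedField_eq, hρ s hs]
  intro T hT
  have hcongr : ∀ t, 0 ≤ t → EqOn (fun s => S (t - s) (averagedField Λ (ρ s)))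
      (fun s => S.toContraction (t - s) (𝓑 fun _ => u s)) (uIcc 0 t) := fun t ht s hs => by
    rw [uIcc_of_le ht] at hs
    simp only [hf s hs.1]
    rfl
  refine ⟨huc.continuousOn.congr fun s hs => hρ s hs.1, fun t ht => ?_, fun t ht => ?_⟩
  · refine (S.toContraction.intervalIntegrable_integrand ht.1 hbc.continuousOn).congr ?_
    exact fun s hs => (hcongr t ht.1 (uIoc_subset_uIcc hs)).symm
  · rw [hρ t ht.1, hu t ht.1, hu0, intervalIntegral.integral_congr (hcongr t ht.1)]
    rfl

theorem IsMultilinearExtension.eq_duhamel (h𝓑 : IsMultilinearExtension Λ 𝓑)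
    {S : AdjointMarkovSemigroup ν} {ρ₀ : ProbDensity ν} {T : ℝ} {ρ : ℝ → ProbDensity ν}
    (h : IsMildSolutionOn S Λ ρ₀ T ρ) {t : ℝ} (ht : t ∈ Icc 0 T) :
    (ρ t).toL1 = S.toContraction t ρ₀.toL1 +
      S.toContraction.duhamel (fun s => 𝓑 fun _ => (ρ s).toL1) t := by
  rw [h.eq t ht]
  simp only [h𝓑.averagedField_eq]
  rfl

/-- Replacing `t` by `max t 0` yields a curve continuous on all of `ℝ`, as the abstract results
require. -/
theorem IsMultilinearExtension.isMild (h𝓑 : IsMultilinearExtension Λ 𝓑)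
    {S : AdjointMarkovSemigroup ν} {ρ₀ : ProbDensity ν} {ρ : ℝ → ProbDensity ν}
    (h : IsMildSolution S Λ ρ₀ ρ) : (ρ 0).toL1 = ρ₀.toL1 ∧
      Continuous (fun t => (ρ (max t 0)).toL1) ∧
      S.toContraction.IsMild (fun s => 𝓑 fun _ => (ρ (max s 0)).toL1)
        (fun t => (ρ (max t 0)).toL1) := by
  have h0 : (ρ 0).toL1 = ρ₀.toL1 := by
    rw [h𝓑.eq_duhamel (h 1 one_pos) ⟨le_rfl, zero_le_one⟩, S.toContraction.toFun_zero,
      ContractionSemigroup.duhamel, intervalIntegral.integral_same, add_zero]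
  have hc : ContinuousOn (fun t => (ρ t).toL1) (Ici 0) := fun t ht => by
    have ht : 0 ≤ t := ht
    refine ((h (t + 1) (by linarith)).continuousOn t ⟨ht, by linarith⟩).mono_of_mem_nhdsWithin ?_
    exact mem_nhdsWithin.2 ⟨Iio (t + 1), isOpen_Iio, by simp, fun s hs => ⟨hs.2, hs.1.le⟩⟩
  refine ⟨h0, hc.comp_continuous (continuous_id.max continuous_const) fun t =>
    mem_Ici.2 (le_max_right _ _),
    fun t ht => ?_⟩
  rw [S.toContraction.duhamel_congr ht (g := fun s => 𝓑 fun _ => (ρ s).toL1)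
    fun s hs => by simp only [max_eq_left hs.1]]
  simp only [max_self, max_eq_left ht, h0]
  exact h𝓑.eq_duhamel (h (t + 1) (by linarith)) ⟨ht, by linarith⟩

/-- Densities have norm one, where the diagonal of `𝓑` is Lipschitz, so the distance of two
solutions satisfies a Grönwall inequality. -/
theorem IsMultilinearExtension.eqOn (h𝓑 : IsMultilinearExtension Λ 𝓑)
    {S : AdjointMarkovSemigroup ν} {ρ₀ : ProbDensity ν} {T : ℝ} {ρ σ : ℝ → ProbDensity ν}
    (hρ : IsMildSolutionOn S Λ ρ₀ T ρ) (hσ : IsMildSolutionOn S Λ ρ₀ T σ) :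
    EqOn ρ σ (Icc 0 T) := by
  obtain ⟨L, Q, hL, -, g', -, -, -, hlip⟩ := exists_diagonal_deriv_bounds 𝓑
  have hφ : ContinuousOn (fun t => ‖(ρ t).toL1 - (σ t).toL1‖) (Icc 0 T) :=
    (hρ.continuousOn.sub hσ.continuousOn).norm
  have hc : ∀ {ρ : ℝ → ProbDensity ν}, ContinuousOn (fun t => (ρ t).toL1) (Icc 0 T) →
      ContinuousOn (fun s => 𝓑 fun _ => (ρ s).toL1) (Icc 0 T) := fun h =>
    𝓑.cont.comp_continuousOn (continuousOn_pi.2 fun _ => h)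
  intro t ht
  have := le_mul_exp_of_le_add_integral (a := 0) hφ hL (fun t ht => by
    have hsub : Icc 0 t ⊆ Icc 0 T := Icc_subset_Icc_right ht.2
    rw [h𝓑.eq_duhamel hρ ht, h𝓑.eq_duhamel hσ ht, add_sub_add_left_eq_sub,
      ← S.toContraction.duhamel_sub ht.1 ((hc hρ.continuousOn).mono hsub)
        ((hc hσ.continuousOn).mono hsub), zero_add, ← intervalIntegral.integral_const_mul]
    refine S.toContraction.norm_duhamel_le ht.1 (ContinuousOn.intervalIntegrable ?_) fun s hs =>
      (hlip _ _ (σ s).norm_eq_one.le (ρ s).norm_eq_one.le).1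
    rw [uIcc_of_le ht.1]
    exact continuousOn_const.mul (hφ.mono hsub)) t ht
  rw [zero_mul] at this
  exact ProbDensity.ext (sub_eq_zero.1 (norm_le_zero_iff.1 this))

theorem integral_mul_exp (c t : ℝ) :
    ∫ s in (0 : ℝ)..t, c * Real.exp (c * s) = Real.exp (c * t) - 1 := by
  have := intervalIntegral.integral_eq_sub_of_hasDerivAt (a := 0) (b := t)
    (f := fun s => Real.exp (c * s)) (f' := fun s => c * Real.exp (c * s)) (fun s _ => by
      simpa [mul_comm] using ((hasDerivAt_id s).const_mul c).exp)
    (Continuous.intervalIntegrable (by fun_prop) _ _)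
  rw [this, mul_zero, Real.exp_zero]

/-- The nonnegative integrable functions of total mass `exp (c t)`. -/
def scaledDensities (ν : Measure X) (c t : ℝ) : Set (Lp ℝ 1 ν) :=
  {x | 0 ≤ x ∧ mass ν x = Real.exp (c * t)}

/-- The nonlinearity of the equation satisfied by `exp (c t) ρₜ`. -/
noncomputable def scaledField
    (𝓑 : ContinuousMultilinearMap ℝ (fun _ : Fin (N - 1 + 1) => Lp ℝ 1 ν) (Lp ℝ 1 ν)) (c t : ℝ)
    (x : Lp ℝ 1 ν) : Lp ℝ 1 ν :=
  (Real.exp (c * t) • 𝓑 fun _ => Real.exp (-(c * t)) • x) + c • x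

theorem exp_smul_exp_neg_smul {E : Type*} [AddCommGroup E] [Module ℝ E] (a : ℝ) (x : E) :
    Real.exp a • Real.exp (-a) • x = x := by
  rw [smul_smul, ← Real.exp_add, add_neg_cancel, Real.exp_zero, one_smul]

theorem isClosed_scaledDensities (c t : ℝ) : IsClosed (scaledDensities ν c t) :=
  (isClosed_Ici (a := (0 : Lp ℝ 1 ν))).inter (isClosed_eq (mass ν).continuous continuous_const)

theorem exists_probDensity_eq_smul {c t : ℝ} {x : Lp ℝ 1 ν} (hx : x ∈ scaledDensities ν c t) :
    ∃ ρ : ProbDensity ν, ρ.toL1 = Real.exp (-(c * t)) • x := by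
  refine ⟨⟨Real.exp (-(c * t)) • x, smul_nonneg_L1 (Real.exp_nonneg _) hx.1, ?_⟩, rfl⟩
  rw [← mass_apply, map_smul, hx.2, smul_eq_mul, ← Real.exp_add, neg_add_cancel, Real.exp_zero]

theorem smul_mem_scaledDensities (ρ : ProbDensity ν) (c t : ℝ) :
    Real.exp (c * t) • ρ.toL1 ∈ scaledDensities ν c t :=
  ⟨smul_nonneg_L1 (Real.exp_nonneg _) ρ.nonneg, by
    rw [map_smul, ρ.mass_eq_one, smul_eq_mul, mul_one]⟩

theorem continuous_scaledField (c : ℝ) : Continuous (Function.uncurry (scaledField 𝓑 c)) :=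
  ((by fun_prop : Continuous fun p : ℝ × Lp ℝ 1 ν => Real.exp (c * p.1)).smul
    (𝓑.cont.comp (continuous_pi fun _ => (by fun_prop : Continuous fun p : ℝ × Lp ℝ 1 ν =>
      Real.exp (-(c * p.1))).smul continuous_snd))).add (continuous_snd.const_smul c)

theorem continuous_scaledField_comp (c : ℝ) {v : ℝ → Lp ℝ 1 ν} (hv : Continuous v) :
    Continuous fun s => scaledField 𝓑 c s (v s) := by
  have h := (continuous_scaledField (𝓑 := 𝓑) c).comp (continuous_id.prodMk hv)
  simpa only [Function.comp_def, Function.uncurry_apply_pair, id_eq] using h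

/-- Writing `x = exp (c t) ρ` with `c = M_Λ`, the field is `exp (c t) (𝒜̄*(ρ; ρ) + c ρ)`, and the
added term compensates the loss. -/
theorem IsMultilinearExtension.scaledField_nonneg [IsFiniteMeasure ν]
    (h𝓑 : IsMultilinearExtension Λ 𝓑) (hΛ : Λ.BoundedIntensity ν) {t : ℝ} {x : Lp ℝ 1 ν}
    (hx : x ∈ scaledDensities ν (uniformIntensity Λ).toNNReal t) :
    0 ≤ scaledField 𝓑 (uniformIntensity Λ).toNNReal t x := by
  obtain ⟨ρ, hρ⟩ := exists_probDensity_eq_smul hx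
  have h1 := (EmpiricalJumpKernel.isL1Adjoint_averaged hΛ ρ.law).add_smul_nonneg
    (EmpiricalJumpKernel.averaged_le hΛ.uniform ρ.law) ρ.nonneg
  have h2 := smul_nonneg_L1
    (Real.exp_nonneg (((uniformIntensity Λ).toNNReal : ℝ) * t)) h1
  have h3 := h𝓑.averagedField_eq ρ
  rw [averagedField] at h3
  rw [h3, hρ, smul_add, smul_comm, exp_smul_exp_neg_smul] at h2
  exact h2

theorem IsMultilinearExtension.mass_scaledField [IsFiniteMeasure ν]
    (h𝓑 : IsMultilinearExtension Λ 𝓑) (hΛ : Λ.BoundedIntensity ν) {c t : ℝ} {x : Lp ℝ 1 ν}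
    (hx : x ∈ scaledDensities ν c t) : mass ν (scaledField 𝓑 c t x) = c * Real.exp (c * t) := by
  obtain ⟨ρ, hρ⟩ := exists_probDensity_eq_smul hx
  have h1 := (EmpiricalJumpKernel.isL1Adjoint_averaged hΛ ρ.law).mass_eq_zero ρ.toL1
  have h3 := h𝓑.averagedField_eq ρ
  rw [averagedField] at h3
  rw [h3, hρ] at h1
  rw [scaledField, map_add, map_smul, h1, smul_zero, zero_add, map_smul, hx.2, smul_eq_mul]

theorem norm_scaledField_sub_le {c L : ℝ} (hc : 0 ≤ c)
    (hlip : ∀ x y : Lp ℝ 1 ν, ‖x‖ ≤ 1 → ‖y‖ ≤ 1 →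
      ‖(𝓑 fun _ => y) - 𝓑 fun _ => x‖ ≤ L * ‖y - x‖) {t : ℝ} {x y : Lp ℝ 1 ν}
    (hx : x ∈ scaledDensities ν c t) (hy : y ∈ scaledDensities ν c t) :
    ‖scaledField 𝓑 c t x - scaledField 𝓑 c t y‖ ≤ (L + c) * ‖x - y‖ := by
  obtain ⟨ρ, hρ⟩ := exists_probDensity_eq_smul hx
  obtain ⟨σ, hσ⟩ := exists_probDensity_eq_smul hy
  have h1 := hlip _ _ σ.norm_eq_one.le ρ.norm_eq_one.le
  rw [hρ, hσ, ← smul_sub, norm_smul, Real.norm_eq_abs, Real.abs_exp] at h1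
  have h2 : scaledField 𝓑 c t x - scaledField 𝓑 c t y =
      Real.exp (c * t) • ((𝓑 fun _ => Real.exp (-(c * t)) • x) -
        𝓑 fun _ => Real.exp (-(c * t)) • y) + c • (x - y) := by
    simp only [scaledField, smul_sub]; abel
  rw [h2, add_mul]
  refine (norm_add_le _ _).trans (add_le_add ?_ ?_)
  · rw [norm_smul, Real.norm_eq_abs, Real.abs_exp]
    refine (mul_le_mul_of_nonneg_left h1 (Real.exp_nonneg _)).trans_eq ?_
    rw [mul_left_comm, ← mul_assoc (Real.exp _), ← Real.exp_add, add_neg_cancel,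
      Real.exp_zero, one_mul]
  · rw [norm_smul, Real.norm_eq_abs, abs_of_nonneg hc]

theorem norm_scaledField_le {c L : ℝ} (hc : 0 ≤ c)
    (hbd : ∀ x : Lp ℝ 1 ν, ‖x‖ ≤ 1 → ‖𝓑 fun _ => x‖ ≤ L * ‖x‖) {t : ℝ} {x : Lp ℝ 1 ν}
    (hx : x ∈ scaledDensities ν c t) : ‖scaledField 𝓑 c t x‖ ≤ (L + c) * ‖x‖ := by
  obtain ⟨ρ, hρ⟩ := exists_probDensity_eq_smul hx
  have h1 := hbd _ ρ.norm_eq_one.le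
  rw [hρ, norm_smul, Real.norm_eq_abs, Real.abs_exp] at h1
  rw [add_mul]
  refine (norm_add_le _ _).trans (add_le_add ?_ ?_)
  · rw [norm_smul, Real.norm_eq_abs, Real.abs_exp]
    refine (mul_le_mul_of_nonneg_left h1 (Real.exp_nonneg _)).trans_eq ?_
    rw [mul_left_comm, ← mul_assoc (Real.exp _), ← Real.exp_add, add_neg_cancel,
      Real.exp_zero, one_mul]
  · rw [norm_smul, Real.norm_eq_abs, abs_of_nonneg hc]

/-- The purpose of the rescaling: both terms are nonnegative, and the masses add up to `1 + ∫₀ᵗ c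
exp (c s) ds = exp (c t)`. -/
theorem IsMultilinearExtension.add_duhamel_mem_scaledDensities [IsFiniteMeasure ν]
    (h𝓑 : IsMultilinearExtension Λ 𝓑) (hΛ : Λ.BoundedIntensity ν) (S : AdjointMarkovSemigroup ν)
    (ρ₀ : ProbDensity ν) {c : ℝ} (hc : c = (uniformIntensity Λ).toNNReal) {v : ℝ → Lp ℝ 1 ν}
    (hvc : Continuous v) (hv : ∀ t, 0 ≤ t → v t ∈ scaledDensities ν c t) {t : ℝ} (ht : 0 ≤ t) :
    S.toContraction t ρ₀.toL1 + S.toContraction.duhamel (fun s => scaledField 𝓑 c s (v s)) t ∈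
      scaledDensities ν c t := by
  have hFv : Continuous fun s => scaledField 𝓑 c s (v s) :=
    continuous_scaledField_comp c hvc
  have hpos : ∀ s, 0 ≤ s → 0 ≤ scaledField 𝓑 c s (v s) := fun s hs => by
    have h1 := hv s hs
    rw [hc] at h1 ⊢
    exact h𝓑.scaledField_nonneg hΛ h1
  have hm : mass ν (S.toContraction t ρ₀.toL1) = 1 := by
    rw [S.toContraction_apply, mass_apply, S.mass t ht, ← mass_apply, ρ₀.mass_eq_one]
  have hd : mass ν (S.toContraction.duhamel (fun s => scaledField 𝓑 c s (v s)) t) =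
      Real.exp (c * t) - 1 := by
    rw [S.mass_duhamel ht hFv, ← integral_mul_exp]
    refine intervalIntegral.integral_congr fun s hs => ?_
    rw [uIcc_of_le ht] at hs
    exact h𝓑.mass_scaledField hΛ (hv s hs.1)
  have h1 : 0 ≤ S.toContraction t ρ₀.toL1 := S.nonneg t ht _ ρ₀.nonneg
  have h2 := S.duhamel_nonneg ht fun s hs => hpos s hs.1
  have h3 := add_nonneg h1 h2
  refine ⟨h3, ?_⟩
  rw [map_add, hm, hd]
  ring

theorem IsMultilinearExtension.exists_isMildSolution [IsFiniteMeasure ν]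
    (h𝓑 : IsMultilinearExtension Λ 𝓑) (hΛ : Λ.BoundedIntensity ν) (S : AdjointMarkovSemigroup ν)
    (ρ₀ : ProbDensity ν) : ∃ ρ : ℝ → ProbDensity ν, IsMildSolution S Λ ρ₀ ρ := by
  obtain ⟨L, Q, hL, -, g', -, hbd, -, hlip⟩ := exists_diagonal_deriv_bounds 𝓑
  obtain ⟨c, hc⟩ : ∃ c : ℝ, c = (uniformIntensity Λ).toNNReal := ⟨_, rfl⟩
  have hc0 : 0 ≤ c := hc ▸ NNReal.coe_nonneg _
  obtain ⟨v, hvc, hv0, hvK, hv⟩ := S.toContraction.exists_isMild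
    (K := scaledDensities ν c) (F := scaledField 𝓑 c) (L := L + c)
    (fun t _ => isClosed_scaledDensities c t) (continuous_scaledField c) (by positivity)
    (fun t _ x hx y hy =>
      norm_scaledField_sub_le hc0 (fun x y hx hy => (hlip x y hx hy).1) hx hy)
    (fun t _ x hx => norm_scaledField_le hc0 hbd hx) ρ₀.toL1
    (fun v hvc hvK t ht => by
      exact h𝓑.add_duhamel_mem_scaledDensities hΛ S ρ₀ hc hvc hvK ht)
    (v₀ := fun t => Real.exp (c * t) • ρ₀.toL1) (C := 1)
    ((by fun_prop : Continuous fun t => Real.exp (c * t)).smul continuous_const)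
    (fun t _ => smul_mem_scaledDensities ρ₀ c t)
    (fun t ht => by
      rw [norm_smul, ρ₀.norm_eq_one, Real.norm_eq_abs, Real.abs_exp, mul_one, one_mul]
      gcongr
      linarith)
  have he : ∀ t : ℝ, HasDerivAt (fun t => Real.exp (-(c * t))) (-c * Real.exp (-(c * t))) t :=
    fun t => by simpa [mul_comm] using (((hasDerivAt_id t).const_mul c).neg).exp
  have hFv : Continuous fun s => scaledField 𝓑 c s (v s) :=
    continuous_scaledField_comp c hvc
  -- Undoing the rescaling: the derivative of `exp (-c t)` cancels the term `c • v` of the field.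
  have hu := hv.smul hFv he (by fun_prop)
  choose ρ hρ using fun t : Ici (0 : ℝ) => exists_probDensity_eq_smul (hvK t t.2)
  refine ⟨fun t => ρ ⟨max t 0, mem_Ici.2 (le_max_right _ _)⟩, h𝓑.isMildSolution (S := S)
    (u := fun t => Real.exp (-(c * t)) • v t)
    ((by fun_prop : Continuous fun t => Real.exp (-(c * t))).smul hvc) (hu.congr fun s _ => ?_)
    (by simp [hv0]) fun t ht => ?_⟩
  · simp only [scaledField, smul_add, smul_smul]
    rw [← Real.exp_add, neg_add_cancel, Real.exp_zero, one_smul, add_assoc, ← add_smul]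
    have : Real.exp (-(c * s)) * c + -c * Real.exp (-(c * s)) = 0 := by ring
    rw [this, zero_smul, add_zero]
  · simp only [hρ, max_eq_left ht]

theorem AdjointMarkovSemigroup.hasGenerator_generator (S : AdjointMarkovSemigroup ν)
    (x : S.generator.domain) : S.HasGenerator x (S.generator x) := Classical.choose_spec x.2

theorem IsMultilinearExtension.isClassicalSolution (h𝓑 : IsMultilinearExtension Λ 𝓑)
    {S : AdjointMarkovSemigroup ν} {ρ₀ : ProbDensity ν} {ρ : ℝ → ProbDensity ν}
    (h0 : ρ₀.toL1 ∈ S.generator.domain) (h : IsMildSolution S Λ ρ₀ ρ) :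
    IsClassicalSolution S Λ ρ₀ ρ := by
  obtain ⟨L, Q, hL, hQ, g', hg', -, hnorm, hlip⟩ := exists_diagonal_deriv_bounds 𝓑
  obtain ⟨hρ0, huc, hu⟩ := h𝓑.isMild h
  have hbc : Continuous fun x : Lp ℝ 1 ν => 𝓑 fun _ => x :=
    𝓑.cont.comp (continuous_pi fun _ => continuous_id)
  have hg : S.HasGenerator ρ₀.toL1 (S.generator ⟨_, h0⟩) := S.hasGenerator_generator ⟨_, h0⟩
  obtain ⟨w, hwc, hw⟩ := hu.tendsto_difference_quotient (b := fun x => 𝓑 fun _ => x) (b' := g')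
    hbc hg' huc hL hQ
    (fun s t _ _ => (hlip _ _ (ρ _).norm_eq_one.le (ρ _).norm_eq_one.le).1)
    (fun s _ => hnorm _ (ρ _).norm_eq_one.le)
    (fun s t _ _ => (hlip _ _ (ρ _).norm_eq_one.le (ρ _).norm_eq_one.le).2)
    (g := S.generator ⟨_, h0⟩) (by simp only [max_self, hρ0]; exact hg)
  have hd := fun t (ht : 0 ≤ t) =>
    ContractionSemigroup.hasDerivWithinAt_Ici_of_tendsto huc hwc hw ht
  refine ⟨hρ0, w, hwc.continuousOn, fun t ht => (hd t ht).congr (fun s hs => ?_) ?_,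
    fun t ht => ?_⟩
  · rw [max_eq_left (mem_Ici.1 hs)]
  · rw [max_eq_left ht]
  · have h1 := hu.tendsto_generator (hbc.comp huc) ht.le (hw t ht.le)
    simp only [max_eq_left ht.le] at h1
    have h2 : (ρ t).toL1 ∈ S.generator.domain := ⟨_, h1⟩
    refine ⟨h2, ?_⟩
    rw [tendsto_nhds_unique (S.hasGenerator_generator ⟨_, h2⟩) h1, h𝓑.averagedField_eq,
      sub_add_cancel]

end WellPosed

/-! ### Growth of the logarithmic oscillation -/

section Oscillation

variable {X : Type*} [MeasurableSpace X] {ν : Measure X} [IsFiniteMeasure ν] {N : ℕ}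

theorem coeFn_one : one ν =ᵐ[ν] fun _ => (1 : ℝ) := Lp.coeFn_const 1 ν 1

theorem coeFn_smul_add_smul_one (ε C : ℝ) (f : Lp ℝ 1 ν) :
    (ε • f + C • one ν : Lp ℝ 1 ν) =ᵐ[ν] fun x => ε * f x + C := by
  filter_upwards [Lp.coeFn_add (ε • f) (C • one ν), Lp.coeFn_smul ε f, Lp.coeFn_smul C (one ν),
    coeFn_one (ν := ν)] with x h1 h2 h3 h4
  rw [h1, Pi.add_apply, h2, h3, Pi.smul_apply, Pi.smul_apply, h4, smul_eq_mul, smul_eq_mul, mul_one]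

/-- Sup bounds are handled through integrals over sets, since these are linear and survive averaging
over configurations. The signs `ε = ± 1` give the two one-sided bounds. -/
theorem nonneg_of_abs_setIntegral_le {f : Lp ℝ 1 ν} {C : ℝ}
    (h : ∀ s, MeasurableSet s → |∫ x in s, f x ∂ν| ≤ C * ν.real s) {ε : ℝ} (hε : |ε| = 1) :
    0 ≤ ε • f + C • one ν := by
  refine Lp_nonneg_of_forall_setIntegral_nonneg fun s hs => ?_
  rw [integral_congr_ae (ae_restrict_of_ae (coeFn_smul_add_smul_one ε C f)),
    integral_add ((L1.integrable_coeFn f).const_mul ε).integrableOn (integrable_const C),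
    integral_const_mul, setIntegral_const, smul_eq_mul]
  have h1 : |ε * ∫ x in s, f x ∂ν| ≤ C * ν.real s := by rw [abs_mul, hε, one_mul]; exact h s hs
  linarith [neg_abs_le (ε * ∫ x in s, f x ∂ν)]

theorem abs_setIntegral_le_of_supNorm_le {f : Lp ℝ 1 ν} {C : ℝ≥0} (h : supNorm f ≤ C) (s : Set X) :
    |∫ x in s, f x ∂ν| ≤ C * ν.real s := by
  rw [← Real.norm_eq_abs]
  refine norm_setIntegral_le_of_norm_le_const_ae' (f := fun x => f x) (measure_lt_top ν s) ?_
  filter_upwards [ae_le_eLpNormEssSup (f := f) (μ := ν)] with x hx _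
  rw [supNorm, eLpNorm_exponent_top] at h
  exact enorm_le_coe.1 (hx.trans h)

theorem supNorm_le_of_abs_setIntegral_le {f : Lp ℝ 1 ν} {C : ℝ≥0}
    (h : ∀ s, MeasurableSet s → |∫ x in s, f x ∂ν| ≤ C * ν.real s) : supNorm f ≤ C := by
  have h1 := nonneg_of_abs_setIntegral_le h (ε := 1) (by simp)
  have h2 := nonneg_of_abs_setIntegral_le h (ε := -1) (by simp)
  rw [supNorm, eLpNorm_exponent_top, ← ENNReal.ofReal_coe_nnreal]
  refine eLpNormEssSup_le_of_ae_bound ?_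
  filter_upwards [(Lp.coeFn_nonneg _).2 h1, (Lp.coeFn_nonneg _).2 h2,
    coeFn_smul_add_smul_one 1 C f, coeFn_smul_add_smul_one (-1) C f] with x h3 h4 h5 h6
  rw [h5, Pi.zero_apply] at h3
  rw [h6, Pi.zero_apply] at h4
  exact abs_le.2 ⟨by linarith, by linarith⟩

theorem IsL1Adjoint.setIntegral_one {Λ : Kernel X X} {A : Lp ℝ 1 ν →L[ℝ] Lp ℝ 1 ν}
    (hA : IsL1Adjoint ν Λ A) {s : Set X} (hs : MeasurableSet s) :
    ∫ x in s, A (one ν) x ∂ν = ∫ x, jumpGenerator Λ (s.indicator fun _ => 1) x ∂ν := by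
  rw [hA.setIntegral_eq hs]
  refine integral_congr_ae ?_
  filter_upwards [coeFn_one (ν := ν)] with x hx
  rw [hx, one_mul]

/-- Over a set `s`, the integral of `𝒜*1` is `∫ Λ(x, s) dν - ∫ₛ Λ(x, X) dν`. By duality the gain is
`∫ₛ Λ'(y, X) dν`, so the two terms are at most `C' ν(s)` and `C ν(s)`. -/
theorem IsAdjointKernel.supNorm_adjoint_one_le {Λ Λ' : Kernel X X} {A : Lp ℝ 1 ν →L[ℝ] Lp ℝ 1 ν}
    (hA : IsL1Adjoint ν Λ A) (h : IsAdjointKernel ν Λ Λ') {C C' : ℝ≥0}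
    (hC : ∀ x, Λ x univ ≤ C) (hC' : ∀ x, Λ' x univ ≤ C') :
    supNorm (A (one ν)) ≤ (C + C' : ℝ≥0) := by
  refine supNorm_le_of_abs_setIntegral_le fun s hs => ?_
  have hfin := isFiniteKernel_of_le hC
  have hle : ∀ x, (Λ x univ).toReal ≤ C := fun x =>
    ENNReal.toReal_le_of_le_ofReal C.2 (by simpa using hC x)
  have hint : ∀ t, MeasurableSet t → Integrable (fun x => (Λ x t).toReal) ν := fun t ht =>
    (integrable_const (C : ℝ)).mono' (Λ.measurable_coe ht).ennreal_toReal.aestronglyMeasurable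
      (ae_of_all _ fun x => by
        rw [Real.norm_eq_abs, abs_of_nonneg ENNReal.toReal_nonneg]
        exact (ENNReal.toReal_mono (measure_ne_top _ _) (measure_mono (subset_univ t))).trans
          (hle x))
  have hmul : (fun x => (Λ x univ).toReal * s.indicator (fun _ => (1 : ℝ)) x) =
      s.indicator fun x => (Λ x univ).toReal := by
    funext x; by_cases hx : x ∈ s <;> simp [hx]
  have hgain : ∫ x, (Λ x s).toReal ∂ν ≤ C' * ν.real s := by
    have h1 := h.lintegral_eq (fun p => s.indicator 1 p.2)
      ((measurable_one.indicator hs).comp measurable_snd)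
    simp only [lintegral_indicator_one hs, lintegral_const] at h1
    rw [integral_toReal (Λ.measurable_coe hs).aemeasurable
      (ae_of_all _ fun x => measure_lt_top _ _), h1]
    refine ENNReal.toReal_le_of_le_ofReal (by positivity) ?_
    calc ∫⁻ y, s.indicator 1 y * Λ' y univ ∂ν ≤ ∫⁻ y, C' * s.indicator 1 y ∂ν :=
          lintegral_mono fun y => by
            rw [mul_comm]; gcongr; exact hC' y
      _ = ENNReal.ofReal (C' * ν.real s) := by
        rw [lintegral_const_mul _ (measurable_one.indicator hs), lintegral_indicator_one hs,
          ENNReal.ofReal_mul (NNReal.coe_nonneg C'), ENNReal.ofReal_coe_nnreal, ofReal_measureReal]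
  have hloss : ∫ x in s, (Λ x univ).toReal ∂ν ≤ C * ν.real s := by
    refine (setIntegral_mono (hint _ .univ).integrableOn (integrable_const (C : ℝ)) hle).trans_eq ?_
    rw [setIntegral_const, smul_eq_mul, mul_comm]
  have hgain0 : 0 ≤ ∫ x, (Λ x s).toReal ∂ν := integral_nonneg fun _ => ENNReal.toReal_nonneg
  have hloss0 : 0 ≤ ∫ x in s, (Λ x univ).toReal ∂ν :=
    integral_nonneg fun _ => ENNReal.toReal_nonneg
  rw [hA.setIntegral_one hs]
  simp only [jumpGenerator_indicator hC hs]
  rw [integral_sub (hint s hs) (by rw [hmul]; exact (hint _ .univ).indicator hs), hmul,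
    integral_indicator hs, NNReal.coe_add, add_mul]
  rw [abs_le]
  have : 0 ≤ (C' : ℝ) * ν.real s := by positivity
  have : 0 ≤ (C : ℝ) * ν.real s := by positivity
  constructor <;> linarith

theorem supNorm_add_adjoint_one_le (k : Lp ℝ 1 ν) {Λ Λstar : empiricalMeasures X N → Kernel X X}
    (h : uniformIntensity Λ < ∞) (h' : uniformIntensity Λstar < ∞) {μ : empiricalMeasures X N}
    {A : Lp ℝ 1 ν →L[ℝ] Lp ℝ 1 ν} (hA : IsL1Adjoint ν (Λ μ) A)
    (hadj : IsAdjointKernel ν (Λ μ) (Λstar μ)) :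
    supNorm (k + A (one ν)) ≤ supNorm k + uniformIntensity Λ + uniformIntensity Λstar := by
  have hle : ∀ {Γ : empiricalMeasures X N → Kernel X X}, uniformIntensity Γ < ∞ →
      ∀ x, Γ μ x univ ≤ (uniformIntensity Γ).toNNReal := fun {Γ} hΓ x => by
    rw [ENNReal.coe_toNNReal hΓ.ne]
    exact (le_iSup (fun x => Γ μ x univ) x).trans (le_iSup (fun μ => kernelNorm (Γ μ)) μ)
  have h1 := hadj.supNorm_adjoint_one_le hA (hle h) (hle h')
  rw [ENNReal.coe_add, ENNReal.coe_toNNReal h.ne, ENNReal.coe_toNNReal h'.ne] at h1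
  rw [add_assoc]
  refine le_trans ?_ (add_le_add_right h1 _)
  rw [supNorm, eLpNorm_congr_ae (Lp.coeFn_add k _)]
  exact eLpNorm_add_le (Lp.aestronglyMeasurable _) (Lp.aestronglyMeasurable _) le_top

/-- By Fubini, the integral over `s` is the mean, under a probability measure on configurations, of
the corresponding integrals for `Λ(μ)`. Passing to the jump generator of the indicator supplies the
joint measurability. -/
theorem EmpiricalJumpKernel.abs_setIntegral_averaged_le {Λ : EmpiricalJumpKernel X N}
    (hΛ : Λ.BoundedIntensity ν) {k : Lp ℝ 1 ν} {C : ℝ≥0}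
    (hC : ∀ μ, supNorm (k + adjointGenerator ν (Λ μ) (one ν)) ≤ C) (ρ : ProbabilityMeasure X)
    {s : Set X} (hs : MeasurableSet s) :
    |∫ x in s, (k + adjointGenerator ν (Λ.averaged ρ) (one ν) : Lp ℝ 1 ν) x ∂ν| ≤
      C * ν.real s := by
  set π := Measure.pi fun _ : Fin (N - 1) => (ρ : Measure X) with hπ
  have hadd : ∀ f : Lp ℝ 1 ν, ∫ x in s, (k + f : Lp ℝ 1 ν) x ∂ν =
      ∫ x in s, k x ∂ν + ∫ x in s, f x ∂ν := fun f => by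
    rw [integral_congr_ae (ae_restrict_of_ae (Lp.coeFn_add k f))]
    exact integral_add (L1.integrable_coeFn k).integrableOn (L1.integrable_coeFn f).integrableOn
  have hm : Measurable (s.indicator fun _ => (1 : ℝ)) := measurable_const.indicator hs
  have hb : ∃ B : ℝ, ∀ x, |s.indicator (fun _ => (1 : ℝ)) x| ≤ B :=
    ⟨1, fun x => by by_cases hx : x ∈ s <;> simp [hx]⟩
  have hCc : ∀ p, Λ.config p univ ≤ (uniformIntensity Λ).toNNReal :=
    fun p => at_le hΛ.uniform p.2 p.1
  have hint : Integrable (Function.uncurry fun (x : X) (y : Fin (N - 1) → X) =>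
      jumpGenerator (Λ.at y) (s.indicator fun _ => 1) x) (ν.prod π) := by
    obtain ⟨B, hB⟩ := exists_abs_jump_le hCc hb Prod.fst
    exact (integrable_const B).mono' (measurable_jump hCc hm hb measurable_fst).aestronglyMeasurable
      (ae_of_all _ hB)
  have hinner : ∀ y, ∫ x, jumpGenerator (Λ.at y) (s.indicator fun _ => 1) x ∂ν =
      ∫ x in s, adjointGenerator ν (Λ.at y) (one ν) x ∂ν := fun y =>
    ((isL1Adjoint hΛ _).setIntegral_one hs).symm
  have hswap : ∫ x in s, adjointGenerator ν (Λ.averaged ρ) (one ν) x ∂ν =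
      ∫ y, ∫ x in s, adjointGenerator ν (Λ.at y) (one ν) x ∂ν ∂π := by
    rw [(isL1Adjoint_averaged hΛ ρ).setIntegral_one hs]
    simp only [jumpGenerator_averaged hΛ.uniform ρ hm hb]
    rw [integral_integral_swap hint]
    simp only [hinner]
  have hiy : Integrable (fun y => ∫ x in s, adjointGenerator ν (Λ.at y) (one ν) x ∂ν) π := by
    simpa only [Function.uncurry, hinner] using hint.integral_prod_right
  have hconst : ∫ x in s, k x ∂ν = ∫ _y, (∫ x in s, k x ∂ν) ∂π := by simp
  rw [hadd, hswap, hconst, ← integral_add (integrable_const _) hiy]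
  have hbound : ∀ᵐ y ∂π, ‖∫ x in s, k x ∂ν +
      ∫ x in s, adjointGenerator ν (Λ.at y) (one ν) x ∂ν‖ ≤ C * ν.real s := ae_of_all _ fun y => by
    rw [← hadd, Real.norm_eq_abs]
    exact abs_setIntegral_le_of_supNorm_le (hC _) s
  simpa using norm_integral_le_of_norm_le_const hbound

/-- Comparison of a mild solution with the multiples `a exp (∓ C t)` of the constant function. -/
theorem IsMultilinearExtension.barrier {Λ : EmpiricalJumpKernel X N}
    {𝓑 : ContinuousMultilinearMap ℝ (fun _ : Fin (N - 1 + 1) => Lp ℝ 1 ν) (Lp ℝ 1 ν)}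
    (h𝓑 : IsMultilinearExtension Λ 𝓑) (hΛ : Λ.BoundedIntensity ν) {S : AdjointMarkovSemigroup ν}
    {k : Lp ℝ 1 ν} (hk : S.HasGenerator (one ν) k) {C : ℝ≥0}
    (hC : ∀ μ, supNorm (k + adjointGenerator ν (Λ μ) (one ν)) ≤ C) {ρ₀ : ProbDensity ν}
    {ρ : ℝ → ProbDensity ν} (hρ : IsMildSolution S Λ ρ₀ ρ) {ε a : ℝ} (hε : |ε| = 1) (ha : 0 ≤ a)
    (h0 : 0 ≤ ε • (ρ₀.toL1 - a • one ν)) {t : ℝ} (ht : 0 ≤ t) :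
    0 ≤ ε • ((ρ t).toL1 - (a * Real.exp (-(ε * C) * t)) • one ν) := by
  obtain ⟨hρ0, huc, hu⟩ := h𝓑.isMild hρ
  -- For `ε = 1` this is a decaying lower barrier, for `ε = -1` a growing upper barrier.
  set α : ℝ → ℝ := fun t => a * Real.exp (-(ε * C) * t) with hα
  have hα0 : ∀ t, 0 ≤ α t := fun t => mul_nonneg ha (Real.exp_nonneg _)
  have hαd : ∀ t, HasDerivAt α (-(ε * C) * α t) t := fun t => by
    have := ((((hasDerivAt_id t).const_mul (-(ε * C))).exp).const_mul a)
    refine this.congr_deriv ?_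
    simp only [hα, id_eq]
    ring
  have hαc : Continuous α := by fun_prop
  have hv := (S.toContraction.isMild_const hk).smul continuous_const hαd
    (continuous_const.mul hαc)
  set u : ℝ → Lp ℝ 1 ν := fun t => (ρ (max t 0)).toL1 with hu'
  have hbc : Continuous fun s => 𝓑 fun _ => u s := 𝓑.cont.comp (continuous_pi fun _ => huc)
  have hfc : Continuous fun s => α s • -k + (-(ε * C) * α s) • one ν :=
    (hαc.smul continuous_const).add ((continuous_const.mul hαc).smul continuous_const)
  have hd := hu.sub hv hbc hfc
  have hw : S.toContraction.IsMild
      (fun s => ε • ((𝓑 fun _ => u s) - (α s • -k + (-(ε * C) * α s) • one ν)))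
      (fun s => ε • (u s - α s • one ν)) := fun t ht => by
    beta_reduce
    rw [S.toContraction.duhamel_const_smul, map_smul, ← smul_add, ← hd t ht]
  have hε2 : ε * ε = 1 := by rw [← abs_mul_abs_self, hε, one_mul]
  -- With the law of `ρ` frozen, the nonlinearity is linear in its first argument. Subtracting the
  -- barrier leaves the residual `r`, nonnegative because `K*1 + 𝒜̄*(1; ρ)` lies between `-C` and
  -- `C`.
  have hpos := S.nonneg_of_isMild (c := ((uniformIntensity Λ).toNNReal : ℝ≥0))
    (g := fun s => ε • ((𝓑 fun _ => u s) - (α s • -k + (-(ε * C) * α s) • one ν)))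
    (w := fun s => ε • (u s - α s • one ν))
    (A := fun t => adjointGenerator ν (Λ.averaged (ρ (max t 0)).law))
    (r := fun t => α t • (ε • (k + adjointGenerator ν (Λ.averaged (ρ (max t 0)).law) (one ν)) +
      (C : ℝ) • one ν)) (NNReal.coe_nonneg _)
    (fun t _ f hf => (EmpiricalJumpKernel.isL1Adjoint_averaged hΛ _).add_smul_nonneg
      (EmpiricalJumpKernel.averaged_le hΛ.uniform _) hf)
    (fun t _ f => (EmpiricalJumpKernel.isL1Adjoint_averaged hΛ _).mass_eq_zero f)
    (fun t _ => smul_nonneg_L1 (hα0 t) (nonneg_of_abs_setIntegral_le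
      (fun s hs => EmpiricalJumpKernel.abs_setIntegral_averaged_le hΛ hC _ hs) hε))
    ((hbc.sub hfc).const_smul ε) (fun t _ => by
      have h1 : (𝓑 fun _ => u t) =
          adjointGenerator ν (Λ.averaged (ρ (max t 0)).law) (u t) :=
        (h𝓑.averagedField_eq (ρ (max t 0))).symm
      rw [h1]
      simp only [map_smul, map_sub, smul_sub, smul_add, smul_smul, smul_neg]
      have h2 : ε * (-(ε * C) * α t) = -(α t * C) := by
        linear_combination (-(C : ℝ) * α t) * hε2
      rw [h2, mul_comm ε (α t), neg_smul]
      abel)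
    ((huc.sub (hαc.smul continuous_const)).const_smul ε) hw
    (by simpa [hα, hu', hρ0] using h0) ht
  simpa only [hu', max_eq_left ht] using hpos

theorem coeFn_smul_one (a : ℝ) : (a • one ν : Lp ℝ 1 ν) =ᵐ[ν] fun _ => a := by
  filter_upwards [Lp.coeFn_smul a (one ν), coeFn_one (ν := ν)] with x h1 h2
  rw [h1, Pi.smul_apply, h2, smul_eq_mul, mul_one]

theorem logOscillation_le {ν : Measure X} {ρ : ProbDensity ν} {a b : ℝ} (ha : 0 < a)
    (h1 : ∀ᵐ x ∂ν, a ≤ ρ.toL1 x)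
    (h2 : ∀ᵐ x ∂ν, ρ.toL1 x ≤ b) :
    logOscillation ρ ≤ ENNReal.ofReal (Real.log b - Real.log a) := by
  refine essSup_le_of_ae_le _ ?_
  filter_upwards [Measure.quasiMeasurePreserving_fst.ae (h1.and h2),
    Measure.quasiMeasurePreserving_snd.ae (h1.and h2)] with p hp hq
  have hp0 : 0 < ρ.toL1 p.1 := ha.trans_le hp.1
  have hq0 : 0 < ρ.toL1 p.2 := ha.trans_le hq.1
  rw [ENNReal.log_ofReal_of_pos hp0, ENNReal.log_ofReal_of_pos hq0, ← EReal.coe_sub, EReal.abs_def]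
  refine ENNReal.ofReal_le_ofReal (abs_le.2 ⟨?_, ?_⟩)
  · linarith [Real.log_le_log ha hp.1, Real.log_le_log hq0 hq.2]
  · linarith [Real.log_le_log ha hq.1, Real.log_le_log hp0 hp.2]

theorem abs_log_sub_log_bound {r s : ℝ} {D : ℝ≥0} (h : (ENNReal.log (ENNReal.ofReal r) -
    ENNReal.log (ENNReal.ofReal s)).abs ≤ D) : 0 < s ∧ r ≤ Real.exp D * s := by
  rcases le_or_gt s 0 with hs | hs
  · exfalso
    rw [ENNReal.ofReal_eq_zero.2 hs, ENNReal.log_zero] at h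
    rcases le_or_gt r 0 with hr | hr
    -- In `EReal`, `⊥ - ⊥ = ⊥` has absolute value `∞`, in accordance with the convention for two
    -- vanishing densities.
    · rw [ENNReal.ofReal_eq_zero.2 hr, ENNReal.log_zero] at h
      simp at h
    · rw [ENNReal.log_ofReal_of_pos hr] at h
      simp at h
  refine ⟨hs, ?_⟩
  rcases le_or_gt r 0 with hr | hr
  · exact hr.trans (by positivity)
  rw [ENNReal.log_ofReal_of_pos hr, ENNReal.log_ofReal_of_pos hs, ← EReal.coe_sub, EReal.abs_def,
    ← ENNReal.ofReal_coe_nnreal, ENNReal.ofReal_le_ofReal_iff (NNReal.coe_nonneg D)] at h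
  have h1 : Real.log r ≤ D + Real.log s := by linarith [le_abs_self (Real.log r - Real.log s)]
  calc r = Real.exp (Real.log r) := (Real.exp_log hr).symm
    _ ≤ Real.exp (D + Real.log s) := Real.exp_le_exp.2 h1
    _ = Real.exp D * s := by rw [Real.exp_add, Real.exp_log hs]

/-- A density of finite logarithmic oscillation is bounded between two positive constants. -/
theorem exists_bounds_of_logOscillation_lt_top (ρ : ProbDensity ν) (h : logOscillation ρ < ∞) :
    ∃ a b : ℝ, 0 < a ∧ (∀ᵐ x ∂ν, a ≤ ρ.toL1 x) ∧ (∀ᵐ x ∂ν, ρ.toL1 x ≤ b) ∧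
      Real.log b - Real.log a = (logOscillation ρ).toReal := by
  obtain ⟨D, hD⟩ : ∃ D : ℝ≥0, logOscillation ρ = D := ⟨_, (ENNReal.coe_toNNReal h.ne).symm⟩
  have hν : ν ≠ 0 := by
    rintro rfl
    have := ρ.2.2
    simp at this
  have : (ae ν).NeBot := ae_neBot.2 hν
  have h1 : ∀ᵐ p ∂(ν.prod ν), (ENNReal.log (ENNReal.ofReal (ρ.toL1 p.1)) -
      ENNReal.log (ENNReal.ofReal (ρ.toL1 p.2))).abs ≤ D := by
    rw [← hD]; exact ae_le_essSup
  have h2 : ∀ᵐ y ∂ν, ∀ᵐ x ∂ν, 0 < ρ.toL1 y ∧ ρ.toL1 x ≤ Real.exp D * ρ.toL1 y := by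
    refine Measure.ae_ae_of_ae_prod (p := fun p : X × X =>
      0 < ρ.toL1 p.1 ∧ ρ.toL1 p.2 ≤ Real.exp D * ρ.toL1 p.1) ?_
    filter_upwards [Measure.measurePreserving_swap.quasiMeasurePreserving.ae h1] with p hp
    exact abs_log_sub_log_bound hp
  -- Almost every value of the density is at least `exp (-D)` times the essential supremum, which is
  -- therefore finite.
  set B := essSup (fun x => ENNReal.ofReal (ρ.toL1 x)) ν with hB
  have h3 : ∀ᵐ y ∂ν, 0 < ρ.toL1 y ∧ B ≤ ENNReal.ofReal (Real.exp D * ρ.toL1 y) := by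
    filter_upwards [h2] with y hy
    refine ⟨hy.exists.choose_spec.1, essSup_le_of_ae_le _ ?_⟩
    filter_upwards [hy] with x hx
    exact ENNReal.ofReal_le_ofReal hx.2
  have hBfin : B ≠ ∞ := by
    obtain ⟨y, hy⟩ := h3.exists
    exact (hy.2.trans_lt ENNReal.ofReal_lt_top).ne
  have h4 : ∀ᵐ x ∂ν, ρ.toL1 x ≤ B.toReal := by
    filter_upwards [ae_le_essSup (f := fun x => ENNReal.ofReal (ρ.toL1 x)) (μ := ν)] with x hx
    exact (ENNReal.ofReal_le_iff_le_toReal hBfin).1 hx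
  have hb : 0 < B.toReal := by
    obtain ⟨y, hy, hy'⟩ := (h3.and h4).exists
    exact hy.1.trans_le hy'
  -- The lower bound is defined from the upper one so that the difference of logarithms is exactly
  -- `D`.
  refine ⟨Real.exp (-D) * B.toReal, B.toReal, by positivity, ?_, h4, ?_⟩
  · filter_upwards [h3] with y hy
    have h5 : B.toReal ≤ Real.exp D * ρ.toL1 y :=
      ENNReal.toReal_le_of_le_ofReal (mul_nonneg (Real.exp_nonneg _) hy.1.le) hy.2
    calc Real.exp (-D) * B.toReal ≤ Real.exp (-D) * (Real.exp D * ρ.toL1 y) := by gcongr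
      _ = ρ.toL1 y := by rw [← mul_assoc, ← Real.exp_add, neg_add_cancel, Real.exp_zero, one_mul]
  · rw [Real.log_mul (Real.exp_ne_zero _) hb.ne', Real.log_exp, hD, ENNReal.coe_toReal]
    ring

/-- The bounds `a ≤ ρ₀ ≤ b` evolve into `a exp (-C t)` and `b exp (C t)`; each barrier contributes
`C t` to the difference of logarithms. -/
theorem IsMultilinearExtension.logOscillation_le {Λ : EmpiricalJumpKernel X N}
    {𝓑 : ContinuousMultilinearMap ℝ (fun _ : Fin (N - 1 + 1) => Lp ℝ 1 ν) (Lp ℝ 1 ν)}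
    (h𝓑 : IsMultilinearExtension Λ 𝓑) (hΛ : Λ.BoundedIntensity ν) {S : AdjointMarkovSemigroup ν}
    {k : Lp ℝ 1 ν} (hk : S.HasGenerator (one ν) k) {C : ℝ≥0}
    (hC : ∀ μ, supNorm (k + adjointGenerator ν (Λ μ) (one ν)) ≤ C) {ρ₀ : ProbDensity ν}
    {ρ : ℝ → ProbDensity ν} (hρ : IsMildSolution S Λ ρ₀ ρ) {t : ℝ} (ht : 0 ≤ t) :
    logOscillation (ρ t) ≤ logOscillation ρ₀ + 2 * C * ENNReal.ofReal t := by
  rcases eq_or_ne (logOscillation ρ₀) ∞ with htop | hfin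
  · rw [htop, top_add]; exact le_top
  obtain ⟨a, b, ha, h1, h2, hab⟩ := exists_bounds_of_logOscillation_lt_top ρ₀ hfin.lt_top
  have : (ae ν).NeBot := ae_neBot.2 fun h0 => by
    subst h0
    have := ρ₀.2.2
    simp at this
  have hb : 0 < b := by
    obtain ⟨x, hx, hx'⟩ := (h1.and h2).exists
    exact ha.trans_le (hx.trans hx')
  have hl := h𝓑.barrier hΛ hk hC hρ (ε := 1) (a := a) (by simp) ha.le (by
    rw [one_smul, sub_nonneg, ← Lp.coeFn_le]
    filter_upwards [h1, coeFn_smul_one (ν := ν) a] with x h3 h4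
    rwa [h4]) ht
  have hr := h𝓑.barrier hΛ hk hC hρ (ε := -1) (a := b) (by simp) hb.le (by
    rw [neg_one_smul, neg_sub, sub_nonneg, ← Lp.coeFn_le]
    filter_upwards [h2, coeFn_smul_one (ν := ν) b] with x h3 h4
    rwa [h4]) ht
  rw [one_smul, sub_nonneg, ← Lp.coeFn_le] at hl
  rw [neg_one_smul, neg_sub, sub_nonneg, ← Lp.coeFn_le] at hr
  refine (MeanField.logOscillation_le (a := a * Real.exp (-(1 * C) * t))
    (b := b * Real.exp (-(-1 * C) * t)) (by positivity) ?_ ?_).trans ?_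
  · filter_upwards [hl, coeFn_smul_one (ν := ν) (a * Real.exp (-(1 * C) * t))] with x h3 h4
    rwa [h4] at h3
  · filter_upwards [hr, coeFn_smul_one (ν := ν) (b * Real.exp (-(-1 * C) * t))] with x h3 h4
    rwa [h4] at h3
  · rw [Real.log_mul ha.ne' (Real.exp_ne_zero _), Real.log_mul hb.ne' (Real.exp_ne_zero _),
      Real.log_exp, Real.log_exp]
    have : Real.log b + -(-1 * C) * t - (Real.log a + -(1 * C) * t) =
        (logOscillation ρ₀).toReal + 2 * C * t := by rw [← hab]; ring
    rw [this, ENNReal.ofReal_add ENNReal.toReal_nonneg (by positivity),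
      ENNReal.ofReal_toReal hfin, ENNReal.ofReal_mul (by positivity),
      ENNReal.ofReal_mul (by norm_num), ENNReal.ofReal_coe_nnreal, ENNReal.ofReal_ofNat]

end Oscillation

end MeanField

/-! ### The main theorem -/

theorem theorem2p10 {X : Type*} [TopologicalSpace X] [PolishSpace X] [MeasurableSpace X]
    [BorelSpace X] (ν : Measure X) [IsFiniteMeasure ν] (N : ℕ) (hN : 2 ≤ N)
    (S : MeanField.AdjointMarkovSemigroup ν) (Λ : MeanField.EmpiricalJumpKernel X N)
    (hΛ : Λ.BoundedIntensity ν) :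
    -- the adjoint generators in the statement exist
    (∀ μ, MeanField.IsL1Adjoint ν (Λ μ) (MeanField.adjointGenerator ν (Λ μ))) ∧
    (∀ ρ : ProbabilityMeasure X, MeanField.IsL1Adjoint ν (Λ.averaged ρ)
      (MeanField.adjointGenerator ν (Λ.averaged ρ))) ∧
    -- (i) existence of a global mild solution, and uniqueness on every time interval
    (∀ ρ₀ : MeanField.ProbDensity ν,
      (∃ ρ : ℝ → MeanField.ProbDensity ν, MeanField.IsMildSolution S Λ ρ₀ ρ) ∧
      ∀ T : ℝ, 0 < T → ∀ ρ σ : ℝ → MeanField.ProbDensity ν,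
        MeanField.IsMildSolutionOn S Λ ρ₀ T ρ → MeanField.IsMildSolutionOn S Λ ρ₀ T σ →
        EqOn ρ σ (Icc 0 T)) ∧
    -- (ii) classical solutions
    (∀ (ρ₀ : MeanField.ProbDensity ν) (ρ : ℝ → MeanField.ProbDensity ν),
      ρ₀.toL1 ∈ S.generator.domain → MeanField.IsMildSolution S Λ ρ₀ ρ →
      MeanField.IsClassicalSolution S Λ ρ₀ ρ) ∧
    -- (iii) growth of the logarithmic oscillation
    (∀ (h1 : MeanField.one ν ∈ S.generator.domain),
      MeanField.supNorm (S.generator ⟨MeanField.one ν, h1⟩) < ∞ →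
      ∀ Λstar : MeanField.empiricalMeasures X N → Kernel X X,
      (∀ μ, MeanField.IsAdjointKernel ν (Λ μ) (Λstar μ)) →
      MeanField.uniformIntensity Λstar < ∞ →
      ∀ (ρ₀ : MeanField.ProbDensity ν) (ρ : ℝ → MeanField.ProbDensity ν),
      MeanField.IsMildSolution S Λ ρ₀ ρ → ∀ t : ℝ, 0 ≤ t →
      MeanField.logOscillation (ρ t) ≤ MeanField.logOscillation ρ₀ +
        2 * (⨆ μ, MeanField.supNorm (S.generator ⟨MeanField.one ν, h1⟩ +
          MeanField.adjointGenerator ν (Λ μ) (MeanField.one ν))) * ENNReal.ofReal t ∧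
      MeanField.logOscillation (ρ t) ≤ MeanField.logOscillation ρ₀ +
        2 * (MeanField.supNorm (S.generator ⟨MeanField.one ν, h1⟩) +
          MeanField.uniformIntensity Λ + MeanField.uniformIntensity Λstar) *
          ENNReal.ofReal t) := by
  obtain ⟨𝓑, (h𝓑 : MeanField.IsMultilinearExtension Λ 𝓑)⟩ :=
    MeanField.EmpiricalJumpKernel.exists_multilinear hΛ
  refine ⟨MeanField.EmpiricalJumpKernel.isL1Adjoint hΛ,
    MeanField.EmpiricalJumpKernel.isL1Adjoint_averaged hΛ,
    fun ρ₀ => ⟨h𝓑.exists_isMildSolution hΛ S ρ₀, fun T _ ρ σ hρ hσ => h𝓑.eqOn hρ hσ⟩,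
    fun ρ₀ ρ h0 hρ => h𝓑.isClassicalSolution h0 hρ,
    fun h1 hk Λstar hΛstar hfin ρ₀ ρ hρ t ht => ?_⟩
  set k := S.generator ⟨MeanField.one ν, h1⟩ with hkdef
  set D := MeanField.supNorm k + MeanField.uniformIntensity Λ + MeanField.uniformIntensity Λstar
    with hD
  set M := ⨆ μ, MeanField.supNorm (k + MeanField.adjointGenerator ν (Λ μ) (MeanField.one ν))
    with hM
  -- This comparison yields the second bound, and also the finiteness of `M` needed for the barrier
  -- argument.
  have hMD : M ≤ D := iSup_le fun μ =>
    MeanField.supNorm_add_adjoint_one_le k hΛ.uniform hfin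
      (MeanField.EmpiricalJumpKernel.isL1Adjoint hΛ μ) (hΛstar μ)
  have hMfin : M ≠ ∞ :=
    (hMD.trans_lt (ENNReal.add_lt_top.2 ⟨ENNReal.add_lt_top.2 ⟨hk, hΛ.uniform⟩, hfin⟩)).ne
  have hbound : MeanField.logOscillation (ρ t) ≤
      MeanField.logOscillation ρ₀ + 2 * M * ENNReal.ofReal t := by
    have := h𝓑.logOscillation_le hΛ (S.hasGenerator_generator ⟨MeanField.one ν, h1⟩)
      (C := M.toNNReal) (fun μ => by
        rw [ENNReal.coe_toNNReal hMfin]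
        exact le_iSup (fun μ =>
          MeanField.supNorm (k + MeanField.adjointGenerator ν (Λ μ) (MeanField.one ν))) μ) hρ ht
    rwa [ENNReal.coe_toNNReal hMfin] at this
  exact ⟨hbound, hbound.trans (by gcongr)⟩
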